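/- Let $\varepsilon,\sigma,\alpha,C>0$. For $\beta,B>0$ let $\text{Hölder}^{\beta}(B)$ be the set of $h:\mathbb R\to\mathbb R$ that are $k$ times continuously differentiable with $|h^{(k)}(t)-h^{(k)}(t')|\le B|t-t'|^{\beta-k}$ for all $t,t'\in\mathbb R$, where $k$ is the largest integer strictly less than $\beta$ (so $\text{Hölder}^1(1)$ is the set of $1$-Lipschitz functions). Let $$H^\alpha(C)=\{f_h: h\in \text{Hölder}^\alpha(C)\cap\text{Hölder}^1(1)\},\qquad f_h(t_1,t_2)=\mathbf 1_{\{t_2<h(t_1)\}}\ \text{ on } [0,1]^2 .$$ For $f\in H^\alpha(C)$ and $n\ge1$, let $x_{i,j}$, $0\le i,j\le n-1$, be the average of $f$ over $[\frac in,\frac{i+1}n)\times[\frac jn,\frac{j+1}n)$, and observe $y_{i,j}=x_{i,j}+z_{i,j}$ with $z_{i,j}$ i.i.d. $N(0,\sigma^2)$; indices are extended $n$-periodically. For an integer $\delta\ge1$ put $\rho^2=(2\delta+1)^2-1$ and $$d_\delta^2(y_{i,j},y_{p,q})=\frac1{\rho^2}\Big(\sum_{m=-\delta}^{\delta}\sum_{\ell=-\delta}^{\delta}|y_{i+\ell,j+m}-y_{p+\ell,q+m}|^2-|y_{i,j}-y_{p,q}|^2\Big).$$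 The nonlocal means (NLM) estimator with patch half-width $\delta$ and threshold parameter $t$ is $$\hat f^N_{i,j}=\frac{\sum_{p,q=0}^{n-1} w_{i,j}(p,q)\,y_{p,q}}{\sum_{p,q=0}^{n-1} w_{i,j}(p,q)},\qquad w_{i,j}(p,q)=\begin{cases}1&\text{if } d_\delta^2(y_{i,j},y_{p,q})\le 2\sigma^2+t,\\0&\text{otherwise.}\end{cases}$$ Run NLM with $\delta=\delta_n=\lfloor 2(\log n)^{1/2+\varepsilon}\rfloor$ and $t=t_n=2\sigma^2/(\log n)^{\varepsilon/2}$, and let $R_n(f,\hat f^N)=\mathbb E\big(\frac1{n^2}\sum_{i,j=0}^{n-1}(x_{i,j}-\hat f^N_{i,j})^2\big)$. Then, as $n\to\infty$, $$\sup_{f\in H^\alpha(C)}R_n(f,\hat f^N)=O\Big(\frac{(\log n)^{1/2+\varepsilon}}{n}\Big),$$ that is, there are a constant $c$ and an $n_0$, depending only on $\varepsilon,\sigma,\alpha,C$, such that the supremum is at most $c\,(\log n)^{1/2+\varepsilon}/n$ for all $n>n_0$. -/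

import Mathlib

open MeasureTheory ProbabilityTheory
open scoped ENNReal

noncomputable section

/-- The Hölder class of order `α > 0` with constant `C` on the real line. The order of
differentiation is the largest integer strictly less than `α`, so that order `1` means Lipschitz. -/
def IsHolder (α C : ℝ) (h : ℝ → ℝ) : Prop :=
  ContDiff ℝ ((⌈α⌉₊ - 1 : ℕ) : ℕ∞) h ∧
    ∀ t t' : ℝ, |iteratedDeriv (⌈α⌉₊ - 1) h t - iteratedDeriv (⌈α⌉₊ - 1) h t'|
      ≤ C * |t - t'| ^ (α - ((⌈α⌉₊ - 1 : ℕ) : ℝ))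

/-- The image with value `1` below the graph of `h` and `0` on and above it. Only its values on
the unit square are ever used. -/
def horizonImage (h : ℝ → ℝ) (p : ℝ × ℝ) : ℝ :=
  Set.indicator {q : ℝ × ℝ | q.2 < h q.1} (fun _ => 1) p

/-- The Horizon class `H^α(C)`. -/
def horizonClass (α C : ℝ) : Set (ℝ × ℝ → ℝ) :=
  {f | ∃ h : ℝ → ℝ, IsHolder α C h ∧ IsHolder 1 1 h ∧ f = horizonImage h}

/-- An `n × n` array of pixel values. Indexing by `ZMod n` (representatives `0, …, n - 1`)
is the periodic extension at the image boundaries. -/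
abbrev PixelArray (n : ℕ) : Type := ZMod n × ZMod n → ℝ

/-- `[i/n, (i+1)/n) × [j/n, (j+1)/n)`. -/
def pixel (n : ℕ) (p : ZMod n × ZMod n) : Set (ℝ × ℝ) :=
  Set.Ico ((p.1.val : ℝ) / n) (((p.1.val : ℝ) + 1) / n) ×ˢ
    Set.Ico ((p.2.val : ℝ) / n) (((p.2.val : ℝ) + 1) / n)

/-- The averages of `f` over the pixels. -/
def pixelAverages (n : ℕ) (f : ℝ × ℝ → ℝ) : PixelArray n :=
  fun p => ⨍ q in pixel n p, f q

/-- The law of an array of independent `N(0, σ²)` variables. -/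
def noiseLaw (n : ℕ) [NeZero n] (σ : ℝ) : Measure (PixelArray n) :=
  Measure.pi fun _ => gaussianReal 0 (σ ^ 2).toNNReal

/-- The mean-square risk of the estimator `est`, which maps the observed array `x + z` to an
estimate of the array `x` of pixel averages of `f`. -/
def risk (n : ℕ) [NeZero n] (σ : ℝ) (est : PixelArray n → PixelArray n)
    (f : ℝ × ℝ → ℝ) : ℝ≥0∞ :=
  ∫⁻ z, ENNReal.ofReal (1 / (n : ℝ) ^ 2 *
    ∑ p : ZMod n × ZMod n,
      (pixelAverages n f p - est (pixelAverages n f + z) p) ^ 2) ∂(noiseLaw n σ)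

/-- The worst-case risk over a class `F` of images. -/
def worstCaseRisk (n : ℕ) [NeZero n] (σ : ℝ) (est : PixelArray n → PixelArray n)
    (F : Set (ℝ × ℝ → ℝ)) : ℝ≥0∞ :=
  ⨆ f ∈ F, risk n σ est f

/-- The squared distance between the patches of half-width `δ` around `p` and `q`,
with the centre pixel left out. -/
def patchDistSq {n : ℕ} (δ : ℕ) (y : PixelArray n) (p q : ZMod n × ZMod n) : ℝ :=
  1 / ((2 * (δ : ℝ) + 1) ^ 2 - 1) *
    ((∑ m ∈ Finset.Icc (-(δ : ℤ)) δ, ∑ l ∈ Finset.Icc (-(δ : ℤ)) δ,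
        |y (p.1 + (l : ZMod n), p.2 + (m : ZMod n))
          - y (q.1 + (l : ZMod n), q.2 + (m : ZMod n))| ^ 2)
      - |y p - y q| ^ 2)

/-- The weight of pixel `q` in the estimate at pixel `p`. -/
def nlmWeight {n : ℕ} (σ : ℝ) (δ : ℕ) (t : ℝ) (y : PixelArray n)
    (p q : ZMod n × ZMod n) : ℝ :=
  if patchDistSq δ y p q ≤ 2 * σ ^ 2 + t then 1 else 0

/-- The nonlocal means estimator with 0/1 weights. -/
def nlm (n : ℕ) [NeZero n] (σ : ℝ) (δ : ℕ) (t : ℝ) (y : PixelArray n) : PixelArray n :=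
  fun p => (∑ q, nlmWeight σ δ t y p q * y q) / ∑ q, nlmWeight σ δ t y p q

/-- The patch half-width: the integers `k` with `|k| ≤ 2 (log n)^(1/2+ε)` are those with
`|k| ≤ patchHalfWidth ε n`. -/
def patchHalfWidth (ε : ℝ) (n : ℕ) : ℕ :=
  ⌊2 * Real.log n ^ (1 / 2 + ε)⌋₊

/-- The threshold parameter. -/
def thresholdParam (ε σ : ℝ) (n : ℕ) : ℝ :=
  2 * σ ^ 2 / Real.log n ^ (ε / 2)

end

/-!
The estimator averages `y` over the points whose patch is similar to the given one. Call a point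
flat if the image is constant on its patch. Concentration of the patch sums of the noise, of its
squares and of its products with shifted noise shows that, with high probability, a flat point
selects all flat points with its own value and none with the opposite value. The products in one
patch sum are not independent, but two-colouring the offsets makes them independent within each
colour class.

The image is a horizon image of a Lipschitz function, so only `E = O(n (log n) ^ (1/2 + ε))` points
are not flat. With `F` the number of flat points of a given value, the squared error at such a point
is of order `(F + E ^ 2) / F ^ 2`, and it is bounded in any case, so that the flat points contribute
`O(E)` in total.

At the remaining points a bounded mean squared error suffices. The error is at most a constant
plus the average of `z q ^ 2` over the selected points `q`, so what has to be bounded is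
`𝔼 ∑ q, z q ^ 2 * w q`. Replacing `z q` by another value moves the patch distances little, hence
the weight `w q` decouples from `z q`, unless a slight increase of the threshold more than
quadruples the number of selected points. Such instability is rare: multiplying the noise in the
patch around `p` by `1 + κ` raises all patch distances and changes the Gaussian law by a bounded
factor only; along a sequence of such dilations every unstable configuration divides the number of
selected points by four, so only logarithmically many of them are unstable.
-/

section ProductMeasure

variable {ι κ : Type*} [Fintype ι] {E : ι → Type*} [∀ i, MeasurableSpace (E i)]
  {μ : ∀ i, Measure (E i)} [∀ i, IsProbabilityMeasure (μ i)]

lemma indepFun_pi_of_dependsOn {β γ : Type*} [MeasurableSpace β] [MeasurableSpace γ]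
    {A B : Finset ι} (hAB : Disjoint A B) {F : (∀ i, E i) → β} {G : (∀ i, E i) → γ}
    (hF : Measurable F) (hG : Measurable G) (hFA : DependsOn F (A : Set ι))
    (hGB : DependsOn G (B : Set ι)) : IndepFun F G (Measure.pi μ) := by
  classical
  have hind : IndepFun A.restrict B.restrict (Measure.pi μ) :=
    (iIndepFun_pi (μ := μ) (X := fun _ x => x) fun _ => aemeasurable_id).indepFun_finset
      A B hAB fun i => measurable_pi_apply i
  have w : ∀ i, E i := fun i => (nonempty_of_isProbabilityMeasure (μ i)).some
  have agree (C : Finset ι) (z : ∀ i, E i) (i : ι) (hi : i ∈ (C : Set ι)) :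
      z i = Function.updateFinset w C (C.restrict z) i := by
    simp [Function.updateFinset, Finset.mem_coe.1 hi]
  rw [show F = (fun y => F (Function.updateFinset w A y)) ∘ A.restrict from
      funext fun z => hFA (agree A z),
    show G = (fun y => G (Function.updateFinset w B y)) ∘ B.restrict from
      funext fun z => hGB (agree B z)]
  exact hind.comp (hF.comp measurable_updateFinset) (hG.comp measurable_updateFinset)

lemma lintegral_mul_pi_of_dependsOn {A B : Finset ι} (hAB : Disjoint A B)
    {F G : (∀ i, E i) → ℝ≥0∞} (hF : Measurable F) (hG : Measurable G)
    (hFA : DependsOn F (A : Set ι)) (hGB : DependsOn G (B : Set ι)) :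
    ∫⁻ z, F z * G z ∂Measure.pi μ = (∫⁻ z, F z ∂Measure.pi μ) * ∫⁻ z, G z ∂Measure.pi μ :=
  lintegral_mul_eq_lintegral_mul_lintegral_of_indepFun'' hF.aemeasurable hG.aemeasurable
    (indepFun_pi_of_dependsOn hAB hF hG hFA hGB)

lemma lintegral_eval_pi (i : ι) {f : E i → ℝ≥0∞} (hf : Measurable f) :
    ∫⁻ z, f (z i) ∂Measure.pi μ = ∫⁻ x, f x ∂μ i :=
  (measurePreserving_eval μ i).lintegral_comp hf

lemma lintegral_eval_mul_pi_of_update [DecidableEq ι] {i : ι} {f : E i → ℝ≥0∞} (hf : Measurable f)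
    {F : (∀ i, E i) → ℝ≥0∞} (hF : Measurable F)
    (hFi : ∀ z c, F (Function.update z i c) = F z) :
    ∫⁻ z, f (z i) * F z ∂Measure.pi μ = (∫⁻ x, f x ∂μ i) * ∫⁻ z, F z ∂Measure.pi μ := by
  rw [← lintegral_eval_pi i hf]
  refine lintegral_mul_pi_of_dependsOn (A := {i}) (B := Finset.univ.erase i) (by simp)
    (hf.comp (measurable_pi_apply i)) hF (fun z w h => by rw [h i (by simp)]) fun z w h => ?_
  rw [← hFi z (w i)]
  congr 1
  funext j
  obtain rfl | hj := eq_or_ne j i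
  · simp
  · simpa [hj] using h j (by simp [hj])

lemma lintegral_exp_sum_pi_le {I : Finset κ} {Y : κ → (∀ i, E i) → ℝ}
    (hY : ∀ l, Measurable (Y l)) {A : κ → Finset ι} (hYA : ∀ l, DependsOn (Y l) (A l : Set ι))
    (hA : (I : Set κ).PairwiseDisjoint A) {b : ℝ}
    (hb : ∀ l ∈ I, ∫⁻ z, ENNReal.ofReal (Real.exp (Y l z)) ∂Measure.pi μ ≤
      ENNReal.ofReal (Real.exp b)) :
    ∫⁻ z, ENNReal.ofReal (Real.exp (∑ l ∈ I, Y l z)) ∂Measure.pi μ ≤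
      ENNReal.ofReal (Real.exp (I.card * b)) := by
  classical
  induction I using Finset.induction_on with
  | empty => simp
  | insert a s ha ih =>
    simp only [Finset.coe_insert, Set.pairwiseDisjoint_insert_of_notMem (Finset.mem_coe.not.2 ha)]
      at hA
    have hdisj : Disjoint (A a) (s.biUnion A) := (Finset.disjoint_biUnion_right _ _ _).2 hA.2
    have hdep : DependsOn (fun z => ∑ l ∈ s, Y l z) (s.biUnion A : Set ι) := fun z w h =>
      Finset.sum_congr rfl fun l hl => hYA l fun i hi => h i <|
        Finset.mem_coe.2 (Finset.mem_biUnion.2 ⟨l, hl, hi⟩)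
    simp_rw [Finset.sum_insert ha, Real.exp_add, ENNReal.ofReal_mul (Real.exp_pos _).le]
    rw [lintegral_mul_pi_of_dependsOn hdisj (by fun_prop) (by fun_prop)
      (fun z w h => by rw [hYA a h]) fun z w h =>
        congrArg (fun t => ENNReal.ofReal (Real.exp t)) (hdep h)]
    calc _ ≤ ENNReal.ofReal (Real.exp b) * ENNReal.ofReal (Real.exp (s.card * b)) :=
          mul_le_mul' (hb a (by simp)) (ih hA.1 fun l hl => hb l (by simp [hl]))
      _ = _ := by
          rw [← ENNReal.ofReal_mul (Real.exp_pos _).le, ← Real.exp_add,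
            Finset.card_insert_of_notMem ha]
          push_cast
          ring_nf

lemma pi_withDensity {r : ∀ i, E i → ℝ≥0∞} (hr : ∀ i, Measurable (r i))
    [∀ i, SigmaFinite ((μ i).withDensity (r i))] :
    Measure.pi (fun i => (μ i).withDensity (r i)) =
      (Measure.pi μ).withDensity fun z => ∏ i, r i (z i) := by
  refine Measure.pi_eq fun s hs => ?_
  have hm : MeasurableSet (Set.univ.pi s) := MeasurableSet.univ_pi hs
  have hprod : ∀ z : ∀ i, E i, (Set.univ.pi s).indicator (fun z => ∏ i, r i (z i)) z =
      ∏ i, (s i).indicator (r i) (z i) := fun z => by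
    classical
    simp [Set.indicator_apply, Finset.prod_ite_zero]
  rw [withDensity_apply _ hm, ← lintegral_indicator hm]
  simp_rw [hprod]
  rw [lintegral_prod_eq_prod_lintegral_of_indepFun Finset.univ
    (fun i (z : ∀ i, E i) => (s i).indicator (r i) (z i))
    (iIndepFun_pi (μ := μ) fun i => ((hr i).indicator (hs i)).aemeasurable)
    fun i => ((hr i).indicator (hs i)).comp (measurable_pi_apply i)]
  refine Finset.prod_congr rfl fun i _ => ?_
  rw [lintegral_eval_pi i ((hr i).indicator (hs i)), lintegral_indicator (hs i),
    withDensity_apply _ (hs i)]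

end ProductMeasure

section Chernoff

variable {Ω : Type*} [MeasurableSpace Ω] {μ : Measure Ω} {Y : Ω → ℝ}

lemma measure_ge_le_mul_lintegral_exp (hY : Measurable Y) (x : ℝ) :
    μ {ω | x ≤ Y ω} ≤
      ENNReal.ofReal (Real.exp (-x)) * ∫⁻ ω, ENNReal.ofReal (Real.exp (Y ω)) ∂μ := by
  have h := meas_ge_le_lintegral_div (μ := μ) (f := fun ω => ENNReal.ofReal (Real.exp (Y ω)))
    (by fun_prop) (ε := ENNReal.ofReal (Real.exp x)) (by simpa using Real.exp_pos x) (by simp)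
  simpa [ENNReal.ofReal_le_ofReal_iff (Real.exp_pos _).le, Real.exp_neg, ENNReal.div_eq_inv_mul,
    ENNReal.ofReal_inv_of_pos (Real.exp_pos _)] using h

lemma measure_abs_ge_le_of_lintegral_exp (hY : Measurable Y) {s x b : ℝ} (hs : 0 ≤ s)
    (hpos : ∫⁻ ω, ENNReal.ofReal (Real.exp (s * Y ω)) ∂μ ≤ ENNReal.ofReal (Real.exp b))
    (hneg : ∫⁻ ω, ENNReal.ofReal (Real.exp (-s * Y ω)) ∂μ ≤ ENNReal.ofReal (Real.exp b)) :
    μ {ω | x ≤ |Y ω|} ≤ ENNReal.ofReal (2 * Real.exp (b - s * x)) := by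
  have tail : ∀ t : ℝ, ∫⁻ ω, ENNReal.ofReal (Real.exp (t * Y ω)) ∂μ ≤
      ENNReal.ofReal (Real.exp b) →
      μ {ω | s * x ≤ t * Y ω} ≤ ENNReal.ofReal (Real.exp (b - s * x)) := fun t ht => by
    refine (measure_ge_le_mul_lintegral_exp (hY.const_mul t) _).trans ?_
    rw [sub_eq_neg_add, Real.exp_add, ENNReal.ofReal_mul (Real.exp_pos _).le]
    gcongr
  calc μ {ω | x ≤ |Y ω|} ≤ μ ({ω | s * x ≤ s * Y ω} ∪ {ω | s * x ≤ -s * Y ω}) := by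
        refine measure_mono fun ω (hω : x ≤ |Y ω|) => (le_abs.1 hω).imp (fun h => ?_) fun h => ?_
        · exact mul_le_mul_of_nonneg_left h hs
        · exact (mul_le_mul_of_nonneg_left h hs).trans_eq (by ring)
    _ ≤ _ := (measure_union_le _ _).trans (add_le_add (tail _ hpos) (tail _ hneg))
    _ = _ := by rw [← ENNReal.ofReal_add (Real.exp_pos _).le (Real.exp_pos _).le, two_mul]

lemma measure_pi_abs_sum_ge_le {ι κ : Type*} [Fintype ι] {E : ι → Type*}
    [∀ i, MeasurableSpace (E i)] {μ : ∀ i, Measure (E i)} [∀ i, IsProbabilityMeasure (μ i)]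
    {I : Finset κ} {Y : κ → (∀ i, E i) → ℝ} (hY : ∀ l, Measurable (Y l)) {A : κ → Finset ι}
    (hYA : ∀ l, DependsOn (Y l) (A l : Set ι)) (hA : (I : Set κ).PairwiseDisjoint A) {s b x : ℝ}
    (hs : 0 ≤ s)
    (hpos : ∀ l ∈ I, ∫⁻ z, ENNReal.ofReal (Real.exp (s * Y l z)) ∂Measure.pi μ ≤
      ENNReal.ofReal (Real.exp b))
    (hneg : ∀ l ∈ I, ∫⁻ z, ENNReal.ofReal (Real.exp (-s * Y l z)) ∂Measure.pi μ ≤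
      ENNReal.ofReal (Real.exp b)) :
    Measure.pi μ {z | x ≤ |∑ l ∈ I, Y l z|} ≤
      ENNReal.ofReal (2 * Real.exp (I.card * b - s * x)) := by
  have expSum : ∀ t : ℝ, (∀ l ∈ I, ∫⁻ z, ENNReal.ofReal (Real.exp (t * Y l z)) ∂Measure.pi μ ≤
      ENNReal.ofReal (Real.exp b)) →
      ∫⁻ z, ENNReal.ofReal (Real.exp (t * ∑ l ∈ I, Y l z)) ∂Measure.pi μ ≤
        ENNReal.ofReal (Real.exp (I.card * b)) := fun t ht => by
    simp_rw [Finset.mul_sum]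
    exact lintegral_exp_sum_pi_le (fun l => (hY l).const_mul t)
      (fun l z w h => congrArg (t * ·) (hYA l h)) hA ht
  exact measure_abs_ge_le_of_lintegral_exp (by fun_prop) hs (expSum _ hpos) (expSum _ hneg)

end Chernoff

section Gaussian

variable {σ : ℝ}

lemma toNNReal_sq_ne_zero (hσ : 0 < σ) : (σ ^ 2).toNNReal ≠ 0 := by
  simp [hσ.ne']

lemma exp_sq_mul_gaussianPDF (hσ : 0 < σ) {s b : ℝ} (hb : b = 1 - 2 * s * σ ^ 2) (hb0 : 0 < b)
    (x : ℝ) :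
    ENNReal.ofReal (Real.exp (s * x ^ 2)) * gaussianPDF 0 (σ ^ 2).toNNReal x =
      ENNReal.ofReal (√b)⁻¹ * gaussianPDF 0 (σ ^ 2 / b).toNNReal x := by
  have hvar : √(2 * Real.pi * (σ ^ 2 / b)) = √(2 * Real.pi * σ ^ 2) / √b := by
    rw [← mul_div_assoc, Real.sqrt_div (by positivity)]
  have hexp : Real.exp (-(x - 0) ^ 2 / (2 * (σ ^ 2 / b))) =
      Real.exp (s * x ^ 2) * Real.exp (-(x - 0) ^ 2 / (2 * σ ^ 2)) := by
    rw [← Real.exp_add]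
    congr 1
    field_simp
    rw [hb]
    ring
  rw [gaussianPDF, gaussianPDF, ← ENNReal.ofReal_mul (Real.exp_pos _).le,
    ← ENNReal.ofReal_mul (by positivity), gaussianPDFReal, gaussianPDFReal,
    Real.coe_toNNReal _ (sq_nonneg σ), Real.coe_toNNReal _ (by positivity), hvar, hexp]
  congr 1
  field_simp

lemma lintegral_exp_sq_gaussianReal (hσ : 0 < σ) {s : ℝ} (hs : 0 < 1 - 2 * s * σ ^ 2) :
    ∫⁻ x, ENNReal.ofReal (Real.exp (s * x ^ 2)) ∂gaussianReal 0 (σ ^ 2).toNNReal =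
      ENNReal.ofReal (√(1 - 2 * s * σ ^ 2))⁻¹ := by
  rw [gaussianReal_of_var_ne_zero 0 (toNNReal_sq_ne_zero hσ),
    lintegral_withDensity_eq_lintegral_mul _ (measurable_gaussianPDF _ _) (by fun_prop)]
  simp only [Pi.mul_apply]
  simp_rw [mul_comm (gaussianPDF _ _ _), exp_sq_mul_gaussianPDF hσ rfl hs]
  rw [lintegral_const_mul _ (measurable_gaussianPDF _ _), lintegral_gaussianPDF_eq_one, mul_one]
  have : 0 < σ ^ 2 / (1 - 2 * s * σ ^ 2) := by positivity
  simpa using this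

lemma inv_sqrt_one_sub_le_exp {a : ℝ} (ha : a ≤ 1 / 2) :
    (√(1 - a))⁻¹ ≤ Real.exp (a / 2 + a ^ 2) := by
  have hpos : 0 < 1 - a := by linarith
  have hsq : 1 ≤ (1 - a) * Real.exp (a + 2 * a ^ 2) :=
    calc 1 ≤ (1 - a) * (a + 2 * a ^ 2 + 1) := by
          nlinarith [mul_nonneg (sq_nonneg a) (by linarith : 0 ≤ 1 - 2 * a)]
      _ ≤ _ := mul_le_mul_of_nonneg_left (Real.add_one_le_exp _) hpos.le
  rw [show a / 2 + a ^ 2 = (a + 2 * a ^ 2) / 2 by ring, Real.exp_half,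
    inv_le_iff_one_le_mul₀ (Real.sqrt_pos.2 hpos), ← Real.sqrt_mul (Real.exp_pos _).le,
    Real.one_le_sqrt, mul_comm]
  exact hsq

lemma lintegral_exp_sq_gaussianReal_le (hσ : 0 < σ) {s : ℝ} (hs : s * σ ^ 2 ≤ 1 / 4) :
    ∫⁻ x, ENNReal.ofReal (Real.exp (s * x ^ 2)) ∂gaussianReal 0 (σ ^ 2).toNNReal ≤
      ENNReal.ofReal (Real.exp (s * σ ^ 2 + 4 * s ^ 2 * σ ^ 4)) := by
  rw [lintegral_exp_sq_gaussianReal hσ (by linarith)]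
  refine ENNReal.ofReal_le_ofReal ((inv_sqrt_one_sub_le_exp (by linarith)).trans_eq ?_)
  congr 1
  ring

lemma lintegral_exp_sq_sub_gaussianReal_le (hσ : 0 < σ) {s : ℝ} (hs : s * σ ^ 2 ≤ 1 / 4) :
    ∫⁻ x, ENNReal.ofReal (Real.exp (s * (x ^ 2 - σ ^ 2))) ∂gaussianReal 0 (σ ^ 2).toNNReal ≤
      ENNReal.ofReal (Real.exp (4 * s ^ 2 * σ ^ 4)) := by
  simp_rw [mul_sub, sub_eq_neg_add, Real.exp_add, ENNReal.ofReal_mul (Real.exp_pos _).le]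
  rw [lintegral_const_mul _ (by fun_prop)]
  grw [lintegral_exp_sq_gaussianReal_le hσ hs]
  rw [← ENNReal.ofReal_mul (Real.exp_pos _).le, ← Real.exp_add, neg_add_cancel_left]

lemma lintegral_exp_mul_gaussianReal (σ s : ℝ) :
    ∫⁻ x, ENNReal.ofReal (Real.exp (s * x)) ∂gaussianReal 0 (σ ^ 2).toNNReal =
      ENNReal.ofReal (Real.exp (s ^ 2 * σ ^ 2 / 2)) := by
  rw [← ofReal_integral_eq_lintegral_ofReal (integrable_exp_mul_gaussianReal s)
    (Filter.Eventually.of_forall fun x => (Real.exp_pos _).le)]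
  have hmgf := congrFun (mgf_fun_id_gaussianReal (μ := 0) (v := (σ ^ 2).toNNReal)) s
  simp only [mgf] at hmgf
  rw [hmgf, Real.coe_toNNReal _ (sq_nonneg σ)]
  congr 2
  ring

lemma lintegral_sq_gaussianReal (σ : ℝ) :
    ∫⁻ x, ENNReal.ofReal (x ^ 2) ∂gaussianReal 0 (σ ^ 2).toNNReal = ENNReal.ofReal (σ ^ 2) := by
  have hL : MemLp id 2 (gaussianReal 0 (σ ^ 2).toNNReal) := memLp_id_gaussianReal' 2 (by simp)
  have hvar := variance_eq_sub hL
  rw [variance_id_gaussianReal] at hvar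
  have hmean : ∫ x, x ∂gaussianReal 0 (σ ^ 2).toNNReal = 0 := integral_id_gaussianReal
  rw [← ofReal_integral_eq_lintegral_ofReal (by simpa using hL.integrable_sq)
    (Filter.Eventually.of_forall fun x => sq_nonneg x)]
  congr 1
  simpa [hmean, Real.coe_toNNReal _ (sq_nonneg σ)] using hvar.symm

lemma lintegral_exp_sq_quarter_gaussianReal_le (hσ : 0 < σ) :
    ∫⁻ x, ENNReal.ofReal (Real.exp (1 / (4 * σ ^ 2) * x ^ 2)) ∂gaussianReal 0 (σ ^ 2).toNNReal ≤
      ENNReal.ofReal 2 := by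
  have h : 1 - 2 * (1 / (4 * σ ^ 2)) * σ ^ 2 = 1 / 2 := by field_simp; norm_num
  rw [lintegral_exp_sq_gaussianReal hσ (by rw [h]; norm_num), h]
  refine ENNReal.ofReal_le_ofReal ?_
  rw [inv_le_comm₀ (by positivity) (by norm_num)]
  exact Real.le_sqrt_of_sq_le (by norm_num)

lemma sq_le_mul_exp_of_lt_sq (hσ : 0 < σ) {K x : ℝ} (hx : K < x ^ 2) :
    x ^ 2 ≤ 8 * σ ^ 2 * Real.exp (-K / (8 * σ ^ 2)) * Real.exp (1 / (4 * σ ^ 2) * x ^ 2) := by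
  set u := x ^ 2 / (8 * σ ^ 2) with hu
  have hexp : u ≤ -K / (8 * σ ^ 2) + 1 / (4 * σ ^ 2) * x ^ 2 := by
    rw [show -K / (8 * σ ^ 2) + 1 / (4 * σ ^ 2) * x ^ 2 = u + (x ^ 2 - K) / (8 * σ ^ 2) by
      rw [hu]; field_simp; ring]
    have : 0 ≤ (x ^ 2 - K) / (8 * σ ^ 2) := div_nonneg (by linarith) (by positivity)
    linarith
  calc x ^ 2 = 8 * σ ^ 2 * u := by rw [hu]; field_simp
    _ ≤ 8 * σ ^ 2 * Real.exp u := by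
        gcongr
        linarith [Real.add_one_le_exp u]
    _ ≤ 8 * σ ^ 2 * Real.exp (-K / (8 * σ ^ 2) + 1 / (4 * σ ^ 2) * x ^ 2) := by gcongr
    _ = _ := by rw [Real.exp_add, mul_assoc (8 * σ ^ 2)]

lemma setLIntegral_sq_gaussianReal_le (hσ : 0 < σ) (K : ℝ) :
    ∫⁻ x in {x | x ^ 2 ≤ K}ᶜ, ENNReal.ofReal (x ^ 2) ∂gaussianReal 0 (σ ^ 2).toNNReal ≤
      ENNReal.ofReal (16 * σ ^ 2 * Real.exp (-K / (8 * σ ^ 2))) := by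
  set A := 8 * σ ^ 2 * Real.exp (-K / (8 * σ ^ 2)) with hA
  calc _ ≤ ∫⁻ x in {x | x ^ 2 ≤ K}ᶜ, ENNReal.ofReal (A * Real.exp (1 / (4 * σ ^ 2) * x ^ 2))
        ∂gaussianReal 0 (σ ^ 2).toNNReal :=
        setLIntegral_mono (by fun_prop) fun x hx =>
          ENNReal.ofReal_le_ofReal (sq_le_mul_exp_of_lt_sq hσ (not_le.1 hx))
    _ ≤ ∫⁻ x, ENNReal.ofReal (A * Real.exp (1 / (4 * σ ^ 2) * x ^ 2))
        ∂gaussianReal 0 (σ ^ 2).toNNReal := setLIntegral_le_lintegral _ _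
    _ ≤ ENNReal.ofReal A * ENNReal.ofReal 2 := by
        simp_rw [ENNReal.ofReal_mul (show 0 ≤ A by positivity)]
        rw [lintegral_const_mul _ (by fun_prop)]
        gcongr
        exact lintegral_exp_sq_quarter_gaussianReal_le hσ
    _ = _ := by
        rw [← ENNReal.ofReal_mul (by positivity), hA]
        congr 1
        ring

lemma gaussianReal_lt_sq_le (hσ : 0 < σ) (K : ℝ) :
    gaussianReal 0 (σ ^ 2).toNNReal {x | K < x ^ 2} ≤
      ENNReal.ofReal (2 * Real.exp (-K / (4 * σ ^ 2))) := by
  calc _ ≤ gaussianReal 0 (σ ^ 2).toNNReal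
        {x | 1 / (4 * σ ^ 2) * K ≤ 1 / (4 * σ ^ 2) * x ^ 2} :=
        measure_mono fun x (hx : K < x ^ 2) =>
          mul_le_mul_of_nonneg_left hx.le (by positivity)
    _ ≤ _ := measure_ge_le_mul_lintegral_exp (by fun_prop) _
    _ ≤ ENNReal.ofReal (Real.exp (-(1 / (4 * σ ^ 2) * K))) * ENNReal.ofReal 2 := by
        gcongr
        exact lintegral_exp_sq_quarter_gaussianReal_le hσ
    _ = _ := by
        rw [← ENNReal.ofReal_mul (Real.exp_pos _).le, mul_comm]
        congr 3
        ring

end Gaussian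

/-- The law of a family of independent `N(0, σ²)` variables indexed by `V`; for
`V = ZMod n × ZMod n` it is `noiseLaw n σ`. -/
noncomputable def gaussNoise (V : Type*) [Fintype V] (σ : ℝ) : Measure (V → ℝ) :=
  Measure.pi fun _ => gaussianReal 0 (σ ^ 2).toNNReal

instance (V : Type*) [Fintype V] (σ : ℝ) : IsProbabilityMeasure (gaussNoise V σ) := by
  unfold gaussNoise
  infer_instance

section GaussNoise

variable {V : Type*} [Fintype V] {σ : ℝ}

lemma lintegral_eval_gaussNoise (σ : ℝ) (i : V) {f : ℝ → ℝ≥0∞} (hf : Measurable f) :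
    ∫⁻ z, f (z i) ∂gaussNoise V σ = ∫⁻ x, f x ∂gaussianReal 0 (σ ^ 2).toNNReal :=
  lintegral_eval_pi i hf

lemma lintegral_exp_mul_mul_gaussNoise_le (hσ : 0 < σ) {i j : V} (hij : i ≠ j) {s : ℝ}
    (hs : s ^ 2 * σ ^ 4 ≤ 1 / 2) :
    ∫⁻ z, ENNReal.ofReal (Real.exp (s * (z i * z j))) ∂gaussNoise V σ ≤
      ENNReal.ofReal (Real.exp (s ^ 2 * σ ^ 4)) := by
  have hind : IndepFun (fun z : V → ℝ => z i) (fun z => z j) (gaussNoise V σ) :=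
    (iIndepFun_pi (μ := fun _ : V => gaussianReal 0 (σ ^ 2).toNNReal) (X := fun _ x => x)
      fun _ => aemeasurable_id).indepFun hij
  have hmap (l : V) : (gaussNoise V σ).map (fun z => z l) = gaussianReal 0 (σ ^ 2).toNNReal :=
    (measurePreserving_eval (fun _ : V => gaussianReal 0 (σ ^ 2).toNNReal) l).map_eq
  have hprod := (indepFun_iff_map_prod_eq_prod_map_map (measurable_pi_apply i).aemeasurable
    (measurable_pi_apply j).aemeasurable).1 hind
  rw [hmap, hmap] at hprod
  calc _ = ∫⁻ w, ENNReal.ofReal (Real.exp (s * (w.1 * w.2)))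
        ∂(gaussNoise V σ).map fun z => (z i, z j) :=
        (lintegral_map (f := fun w : ℝ × ℝ => ENNReal.ofReal (Real.exp (s * (w.1 * w.2))))
          (by fun_prop) (by fun_prop)).symm
    _ = ∫⁻ x, ENNReal.ofReal (Real.exp (s ^ 2 * σ ^ 2 / 2 * x ^ 2))
        ∂gaussianReal 0 (σ ^ 2).toNNReal := by
        rw [hprod, lintegral_prod _ (by fun_prop)]
        simp_rw [← mul_assoc, lintegral_exp_mul_gaussianReal]
        refine lintegral_congr fun x => ?_
        congr 2
        ring
    _ ≤ _ := lintegral_exp_sq_gaussianReal_le hσ (by nlinarith)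
    _ ≤ _ := by
        refine ENNReal.ofReal_le_ofReal (Real.exp_le_exp.2 ?_)
        nlinarith [mul_le_mul_of_nonneg_left hs (by positivity : 0 ≤ s ^ 2 * σ ^ 4)]

lemma measurableSet_forall_abs_le {V : Type*} [Countable V] (M : ℝ) :
    MeasurableSet {z : V → ℝ | ∀ i, |z i| ≤ M} := by
  simp only [Set.ofPred_forall]
  exact MeasurableSet.iInter fun i => measurableSet_le (by fun_prop) measurable_const

lemma gaussNoise_compl_forall_abs_le_le (hσ : 0 < σ) {M : ℝ} (hM : 0 ≤ M) :
    gaussNoise V σ {z | ∀ i, |z i| ≤ M}ᶜ ≤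
      ENNReal.ofReal (Fintype.card V * (2 * Real.exp (-M ^ 2 / (4 * σ ^ 2)))) := by
  calc _ ≤ gaussNoise V σ (⋃ i, {z | M ^ 2 < z i ^ 2}) := by
        refine measure_mono fun z hz => ?_
        obtain ⟨i, hi⟩ : ∃ i, M < |z i| := by simpa using hz
        refine Set.mem_iUnion.2 ⟨i, ?_⟩
        rw [Set.mem_ofPred_eq, ← sq_abs (z i)]
        gcongr
    _ ≤ ∑ i : V, gaussNoise V σ {z | M ^ 2 < z i ^ 2} := measure_iUnion_fintype_le _ _
    _ ≤ ∑ i : V, ENNReal.ofReal (2 * Real.exp (-M ^ 2 / (4 * σ ^ 2))) := by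
        refine Finset.sum_le_sum fun i _ => ?_
        have hm : MeasurableSet {x : ℝ | M ^ 2 < x ^ 2} :=
          measurableSet_lt (by fun_prop) (by fun_prop)
        exact ((measurePreserving_eval (fun _ : V => gaussianReal 0 (σ ^ 2).toNNReal)
          i).measure_preimage hm.nullMeasurableSet).trans_le (gaussianReal_lt_sq_le hσ _)
    _ = _ := by
        rw [Finset.sum_const, Finset.card_univ, nsmul_eq_mul,
          ENNReal.ofReal_mul (p := (Fintype.card V : ℝ)) (by positivity), ENNReal.ofReal_natCast]

end GaussNoise

section Scaling

variable {V : Type*} [DecidableEq V] {σ κ : ℝ}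

/-- Multiplication of the coordinates in `U` by `1 + κ`. Comparing the noise with its scaled copy
shows that configurations with an unstable selection are rare. -/
def scaleOn (U : Finset V) (κ : ℝ) (z : V → ℝ) (i : V) : ℝ :=
  (if i ∈ U then 1 + κ else 1) * z i

lemma measurable_scaleOn (U : Finset V) (κ : ℝ) : Measurable (scaleOn U κ) :=
  measurable_pi_lambda _ fun i => (measurable_pi_apply i).const_mul _

lemma gaussianReal_eq_withDensity_map_const_mul (hσ : 0 < σ) {c : ℝ} (hc : 0 < c) :
    gaussianReal 0 (σ ^ 2).toNNReal = ((gaussianReal 0 (σ ^ 2).toNNReal).map (c * ·)).withDensity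
      fun x => ENNReal.ofReal (c * Real.exp (-((1 - (c ^ 2)⁻¹) / (2 * σ ^ 2)) * x ^ 2)) := by
  have hvar : NNReal.mk (c ^ 2) (sq_nonneg _) * (σ ^ 2).toNNReal =
      (σ ^ 2 / (c ^ 2)⁻¹).toNNReal := by
    ext
    rw [Real.coe_toNNReal _ (by positivity)]
    simp only [NNReal.coe_mul, NNReal.coe_mk, div_inv_eq_mul, Real.coe_toNNReal _ (sq_nonneg σ)]
    ring
  rw [gaussianReal_map_const_mul, mul_zero, hvar,
    gaussianReal_of_var_ne_zero 0 (toNNReal_sq_ne_zero hσ),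
    gaussianReal_of_var_ne_zero 0 (Real.toNNReal_pos.2 (by positivity)).ne',
    ← withDensity_mul _ (measurable_gaussianPDF _ _) (by fun_prop)]
  congr 1
  funext x
  have h := exp_sq_mul_gaussianPDF hσ (s := (1 - (c ^ 2)⁻¹) / (2 * σ ^ 2)) (b := (c ^ 2)⁻¹)
    (by field_simp; ring) (by positivity) x
  rw [Real.sqrt_inv, Real.sqrt_sq hc.le, inv_inv] at h
  rw [Pi.mul_apply, mul_comm, ENNReal.ofReal_mul hc.le, mul_right_comm, ← h, mul_right_comm,
    ← ENNReal.ofReal_mul (Real.exp_pos _).le, ← Real.exp_add]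
  simp

lemma gaussNoise_eq_withDensity_map_scaleOn [Fintype V] (hσ : 0 < σ) (U : Finset V)
    (hκ : 0 ≤ κ) :
    gaussNoise V σ = ((gaussNoise V σ).map (scaleOn U κ)).withDensity fun z =>
      ENNReal.ofReal ((1 + κ) ^ U.card *
        Real.exp (-((1 - ((1 + κ) ^ 2)⁻¹) / (2 * σ ^ 2)) * ∑ i ∈ U, z i ^ 2)) := by
  set c : V → ℝ := fun i => if i ∈ U then 1 + κ else 1 with hc
  have hc0 : ∀ i, 0 < c i := fun i => by simp only [hc]; split_ifs <;> linarith
  set ν := gaussianReal 0 (σ ^ 2).toNNReal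
  set r : V → ℝ → ℝ := fun i x =>
    c i * Real.exp (-((1 - (c i ^ 2)⁻¹) / (2 * σ ^ 2)) * x ^ 2) with hr
  have hdens : ∀ i, ν = (ν.map (c i * ·)).withDensity fun x => ENNReal.ofReal (r i x) := fun i =>
    gaussianReal_eq_withDensity_map_const_mul hσ (hc0 i)
  have : ∀ i, IsProbabilityMeasure (ν.map (c i * ·)) := fun i =>
    Measure.isProbabilityMeasure_map (by fun_prop)
  have : ∀ i, SigmaFinite ((ν.map (c i * ·)).withDensity fun x => ENNReal.ofReal (r i x)) :=
    fun i => by rw [← hdens]; infer_instance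
  have hmap : Measure.pi (fun i => ν.map (c i * ·)) = (gaussNoise V σ).map (scaleOn U κ) :=
    (Measure.pi_map_pi fun i => by fun_prop).symm
  have hprod : ∀ z : V → ℝ, ∏ i, r i (z i) = (1 + κ) ^ U.card *
      Real.exp (-((1 - ((1 + κ) ^ 2)⁻¹) / (2 * σ ^ 2)) * ∑ i ∈ U, z i ^ 2) := fun z => by
    rw [← Finset.prod_subset (Finset.subset_univ U) fun i _ hi => by simp [hr, hc, hi],
      Finset.mul_sum, Real.exp_sum, ← Finset.prod_const, ← Finset.prod_mul_distrib]
    exact Finset.prod_congr rfl fun i hi => by simp [hr, hc, hi]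
  calc gaussNoise V σ =
        Measure.pi fun i => (ν.map (c i * ·)).withDensity fun x => ENNReal.ofReal (r i x) :=
        congrArg Measure.pi (funext hdens)
    _ = (Measure.pi fun i => ν.map (c i * ·)).withDensity
        fun z => ∏ i, ENNReal.ofReal (r i (z i)) :=
        pi_withDensity fun i => by simp only [hr]; fun_prop
    _ = _ := by
        rw [hmap]
        congr 1
        funext z
        rw [← hprod, ENNReal.ofReal_prod_of_nonneg fun i _ =>
          mul_nonneg (hc0 i).le (Real.exp_pos _).le]

lemma one_sub_inv_one_add_sq_div_two_mem_Icc (hκ : 0 ≤ κ) :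
    (1 - ((1 + κ) ^ 2)⁻¹) / 2 ∈ Set.Icc (κ - 2 * κ ^ 2) κ := by
  have hinv : 1 - ((1 + κ) ^ 2)⁻¹ = (2 * κ + κ ^ 2) / (1 + κ) ^ 2 := by field_simp; ring
  rw [hinv]
  constructor
  · rw [le_div_iff₀ (by norm_num), le_div_iff₀ (by positivity)]
    nlinarith [pow_nonneg hκ 2, pow_nonneg hκ 3, pow_nonneg hκ 4]
  · rw [div_le_iff₀ (by norm_num), div_le_iff₀ (by positivity)]
    nlinarith [pow_nonneg hκ 2, pow_nonneg hκ 3]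

lemma one_add_pow_mul_exp_le (hσ : 0 < σ) (hκ : 0 ≤ κ) {X S : ℝ} {N : ℕ} (hX : 0 ≤ X)
    (hS : σ ^ 2 * N - X ≤ S) :
    (1 + κ) ^ N * Real.exp (-((1 - ((1 + κ) ^ 2)⁻¹) / (2 * σ ^ 2)) * S) ≤
      Real.exp (κ * X / σ ^ 2 + 2 * κ ^ 2 * N) := by
  set a := (1 - ((1 + κ) ^ 2)⁻¹) / 2 with ha
  obtain ⟨hlow, hup⟩ : a ∈ Set.Icc (κ - 2 * κ ^ 2) κ := one_sub_inv_one_add_sq_div_two_mem_Icc hκ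
  have ha0 : 0 ≤ a := by
    have : ((1 + κ) ^ 2)⁻¹ ≤ 1 := inv_le_one_of_one_le₀ (one_le_pow₀ (by linarith))
    rw [ha]
    linarith
  have hSσ : N - X / σ ^ 2 ≤ S / σ ^ 2 := by
    rw [show (N : ℝ) - X / σ ^ 2 = (σ ^ 2 * N - X) / σ ^ 2 by field_simp]
    gcongr
  have hexp : -((1 - ((1 + κ) ^ 2)⁻¹) / (2 * σ ^ 2)) * S = -(a * (S / σ ^ 2)) := by
    rw [ha]; ring
  calc _ ≤ Real.exp κ ^ N * Real.exp (-(a * (S / σ ^ 2))) := by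
        rw [hexp]
        gcongr
        linarith [Real.add_one_le_exp κ]
    _ = Real.exp (N * κ - a * (S / σ ^ 2)) := by
        rw [← Real.exp_nat_mul, ← Real.exp_add, sub_eq_add_neg]
    _ ≤ _ := by
        refine Real.exp_le_exp.2 ?_
        have hXσ : a * (X / σ ^ 2) ≤ κ * (X / σ ^ 2) := by gcongr
        have hN := mul_le_mul_of_nonneg_right hlow (Nat.cast_nonneg (α := ℝ) N)
        rw [mul_div_assoc]
        linarith [mul_le_mul_of_nonneg_left hSσ ha0]

lemma gaussNoise_le_mul_scaleOn_preimage [Fintype V] (hσ : 0 < σ) (U : Finset V) {X : ℝ}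
    (hκ : 0 ≤ κ) (hX : 0 ≤ X) {B : Set (V → ℝ)} (hBm : MeasurableSet B)
    (hB : ∀ z ∈ B, σ ^ 2 * U.card - X ≤ ∑ i ∈ U, z i ^ 2) :
    gaussNoise V σ B ≤ ENNReal.ofReal (Real.exp (κ * X / σ ^ 2 + 2 * κ ^ 2 * U.card)) *
      gaussNoise V σ (scaleOn U κ ⁻¹' B) := by
  rw [gaussNoise_eq_withDensity_map_scaleOn hσ U hκ, withDensity_apply _ hBm,
    ← gaussNoise_eq_withDensity_map_scaleOn hσ U hκ,
    ← Measure.map_apply (measurable_scaleOn U κ) hBm, ← setLIntegral_const]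
  exact setLIntegral_mono measurable_const fun z hz =>
    ENNReal.ofReal_le_ofReal (one_add_pow_mul_exp_le hσ hκ hX (hB z hz))

end Scaling

section Concentration

variable {V κ : Type*} [Fintype V] {σ τ : ℝ} {I : Finset κ} {φ : κ → V} {N : ℕ}

lemma gaussNoise_abs_sum_sq_sub_ge_le (hσ : 0 < σ) (hφ : Set.InjOn φ I) (hI : I.card ≤ N)
    (hτ0 : 0 ≤ τ) (hτ1 : τ ≤ 1) :
    gaussNoise V σ {z | τ * σ ^ 2 * N ≤ |∑ l ∈ I, z (φ l) ^ 2 - σ ^ 2 * I.card|} ≤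
      ENNReal.ofReal (2 * Real.exp (-(τ ^ 2 * N / 16))) := by
  classical
  have hs : τ / (8 * σ ^ 2) * σ ^ 2 = τ / 8 := by field_simp
  have mgf : ∀ t : ℝ, t ^ 2 = (τ / (8 * σ ^ 2)) ^ 2 → t * σ ^ 2 ≤ 1 / 4 → ∀ l ∈ I,
      ∫⁻ z, ENNReal.ofReal (Real.exp (t * (z (φ l) ^ 2 - σ ^ 2))) ∂gaussNoise V σ ≤
        ENNReal.ofReal (Real.exp (τ ^ 2 / 16)) := fun t ht htσ l _ => by
    rw [lintegral_eval_gaussNoise σ (φ l)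
      (f := fun x => ENNReal.ofReal (Real.exp (t * (x ^ 2 - σ ^ 2)))) (by fun_prop),
      show τ ^ 2 / 16 = 4 * t ^ 2 * σ ^ 4 by rw [ht]; field_simp; ring]
    exact lintegral_exp_sq_sub_gaussianReal_le hσ htσ
  have h := measure_pi_abs_sum_ge_le (μ := fun _ : V => gaussianReal 0 (σ ^ 2).toNNReal)
    (I := I) (Y := fun l z => z (φ l) ^ 2 - σ ^ 2) (A := fun l => {φ l}) (x := τ * σ ^ 2 * N)
    (fun l => by fun_prop) (fun l z w h => by simp [h (φ l) (by simp)])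
    (fun l hl l' hl' hll => by simpa using hφ.ne hl hl' hll)
    (by positivity) (mgf _ rfl (by rw [hs]; linarith))
    (mgf _ (by ring) (by rw [neg_mul, hs]; linarith))
  simp only [Finset.sum_sub_distrib, Finset.sum_const, nsmul_eq_mul, mul_comm (I.card : ℝ)] at h
  refine h.trans (ENNReal.ofReal_le_ofReal ?_)
  have hsx : τ / (8 * σ ^ 2) * (τ * σ ^ 2 * N) = τ ^ 2 * N / 8 := by field_simp
  have hIN : τ ^ 2 * I.card ≤ τ ^ 2 * N := by gcongr
  rw [hsx]
  gcongr
  linarith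

lemma gaussNoise_abs_sum_mul_const_ge_le (hσ : 0 < σ) (hφ : Set.InjOn φ I) (hI : I.card ≤ N)
    {c : κ → ℝ} (hc : ∀ l ∈ I, |c l| ≤ 1) (hτ : 0 ≤ τ) :
    gaussNoise V σ {z | τ * σ * N ≤ |∑ l ∈ I, c l * z (φ l)|} ≤
      ENNReal.ofReal (2 * Real.exp (-(τ ^ 2 * N / 2))) := by
  classical
  have mgf : ∀ t : ℝ, t ^ 2 = (τ / σ) ^ 2 → ∀ l ∈ I,
      ∫⁻ z, ENNReal.ofReal (Real.exp (t * (c l * z (φ l)))) ∂gaussNoise V σ ≤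
        ENNReal.ofReal (Real.exp (τ ^ 2 / 2)) := fun t ht l hl => by
    simp_rw [← mul_assoc]
    rw [lintegral_eval_gaussNoise σ (φ l)
      (f := fun x => ENNReal.ofReal (Real.exp (t * c l * x))) (by fun_prop),
      lintegral_exp_mul_gaussianReal]
    refine ENNReal.ofReal_le_ofReal (Real.exp_le_exp.2 ?_)
    have hc2 : c l ^ 2 ≤ 1 := sq_le_one_iff_abs_le_one _ |>.2 (hc l hl)
    calc (t * c l) ^ 2 * σ ^ 2 / 2 = τ ^ 2 * c l ^ 2 / 2 := by rw [mul_pow, ht]; field_simp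
      _ ≤ τ ^ 2 * 1 / 2 := by gcongr
      _ = τ ^ 2 / 2 := by ring
  refine (measure_pi_abs_sum_ge_le (μ := fun _ : V => gaussianReal 0 (σ ^ 2).toNNReal)
    (Y := fun l z => c l * z (φ l)) (A := fun l => {φ l}) (fun l => by fun_prop)
    (fun l z w h => by simp [h (φ l) (by simp)])
    (fun l hl l' hl' hll => by simpa using hφ.ne hl hl' hll)
    (by positivity) (mgf _ rfl) (mgf _ (by ring))).trans (ENNReal.ofReal_le_ofReal ?_)
  have hsx : τ / σ * (τ * σ * N) = τ ^ 2 * N := by field_simp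
  have hIN : τ ^ 2 * I.card ≤ τ ^ 2 * N := by gcongr
  rw [hsx]
  gcongr
  linarith

lemma gaussNoise_abs_sum_mul_ge_le_of_pairwiseDisjoint [DecidableEq V] (hσ : 0 < σ) {ψ : κ → V}
    (hφψ : ∀ l ∈ I, φ l ≠ ψ l)
    (hd : (I : Set κ).PairwiseDisjoint fun l => ({φ l, ψ l} : Finset V)) (hI : I.card ≤ N)
    (hτ0 : 0 ≤ τ) (hτ1 : τ ≤ 1) :
    gaussNoise V σ {z | τ * σ ^ 2 * N / 2 ≤ |∑ l ∈ I, z (φ l) * z (ψ l)|} ≤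
      ENNReal.ofReal (2 * Real.exp (-(τ ^ 2 * N / 16))) := by
  have mgf : ∀ t : ℝ, t ^ 2 = (τ / (4 * σ ^ 2)) ^ 2 → ∀ l ∈ I,
      ∫⁻ z, ENNReal.ofReal (Real.exp (t * (z (φ l) * z (ψ l)))) ∂gaussNoise V σ ≤
        ENNReal.ofReal (Real.exp (τ ^ 2 / 16)) := fun t ht l hl => by
    have htσ : t ^ 2 * σ ^ 4 = τ ^ 2 / 16 := by rw [ht]; field_simp; norm_num
    rw [← htσ]
    exact lintegral_exp_mul_mul_gaussNoise_le hσ (hφψ l hl) (by rw [htσ]; nlinarith)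
  refine (measure_pi_abs_sum_ge_le (μ := fun _ : V => gaussianReal 0 (σ ^ 2).toNNReal)
    (Y := fun l z => z (φ l) * z (ψ l)) (A := fun l => {φ l, ψ l}) (fun l => by fun_prop)
    (fun l z w h => by simp [h (φ l) (by simp), h (ψ l) (by simp)]) hd
    (by positivity) (mgf _ rfl) (mgf _ (by ring))).trans (ENNReal.ofReal_le_ofReal ?_)
  have hsx : τ / (4 * σ ^ 2) * (τ * σ ^ 2 * N / 2) = τ ^ 2 * N / 8 := by field_simp; ring
  have hIN : τ ^ 2 * I.card ≤ τ ^ 2 * N := by gcongr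
  rw [hsx]
  gcongr
  linarith

end Concentration

section Bicolour

variable {V : Type*} [AddCommGroup V]

/-- For every nonzero shift, `O` has a two-colouring in which points of `O` that differ by the
shift get different colours. Each colour class of the products `z (p + l) * z (q + l)`, `l ∈ O`,
then consists of independent variables. -/
def ShiftBicolorable (O : Finset V) : Prop :=
  ∀ k : V, k ≠ 0 → ∃ c : V → Bool, ∀ l ∈ O, l + k ∈ O → c (l + k) ≠ c l

lemma pairwiseDisjoint_pair_add [DecidableEq V] {p q : V} {I : Finset V}
    (hI : ∀ l ∈ I, l + (q - p) ∉ I) :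
    (I : Set V).PairwiseDisjoint fun l => ({p + l, q + l} : Finset V) := by
  have hne : ∀ l ∈ I, ∀ l' ∈ I, q + l ≠ p + l' := fun l hl l' hl' h => by
    have hll' : l + (q - p) = l' := by rw [← add_sub_assoc, add_comm l q, h, add_sub_cancel_left]
    exact hI l hl (hll' ▸ hl')
  intro l hl l' hl' hll'
  simp [Function.onFun, hll'.symm, (hne l hl l' hl').symm, hne l' hl' l hl]

lemma gaussNoise_abs_sum_mul_ge_le [Fintype V] {σ τ : ℝ} (hσ : 0 < σ)
    {O : Finset V} (hO : ShiftBicolorable O) {p q : V} (hpq : p ≠ q) {I : Finset V} (hIsub : I ⊆ O)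
    {N : ℕ} (hI : I.card ≤ N) (hτ0 : 0 ≤ τ) (hτ1 : τ ≤ 1) :
    gaussNoise V σ {z | τ * σ ^ 2 * N ≤ |∑ l ∈ I, z (p + l) * z (q + l)|} ≤
      ENNReal.ofReal (4 * Real.exp (-(τ ^ 2 * N / 16))) := by
  classical
  obtain ⟨c, hc⟩ := hO (q - p) (sub_ne_zero.2 hpq.symm)
  have hclass : ∀ b : Bool, gaussNoise V σ
      {z | τ * σ ^ 2 * N / 2 ≤ |∑ l ∈ I.filter (c · = b), z (p + l) * z (q + l)|} ≤
      ENNReal.ofReal (2 * Real.exp (-(τ ^ 2 * N / 16))) := fun b => by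
    refine gaussNoise_abs_sum_mul_ge_le_of_pairwiseDisjoint hσ (fun l _ => by simpa using hpq)
      (pairwiseDisjoint_pair_add fun l hl hl' => ?_) ((Finset.card_filter_le _ _).trans hI) hτ0 hτ1
    rw [Finset.mem_filter] at hl hl'
    exact hc l (hIsub hl.1) (hIsub hl'.1) (hl'.2.trans hl.2.symm)
  calc _ ≤ gaussNoise V σ
        ({z | τ * σ ^ 2 * N / 2 ≤ |∑ l ∈ I.filter (c · = true), z (p + l) * z (q + l)|} ∪
          {z | τ * σ ^ 2 * N / 2 ≤ |∑ l ∈ I.filter (c · = false), z (p + l) * z (q + l)|}) := by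
        refine measure_mono fun z hz => ?_
        have hsplit := Finset.sum_filter_add_sum_filter_not I (c · = true)
          fun l => z (p + l) * z (q + l)
        simp only [Bool.not_eq_true] at hsplit
        by_contra h
        simp only [Set.mem_union, Set.mem_ofPred_eq, not_or, not_le, ← hsplit] at h hz
        exact (hz.trans (abs_add_le _ _)).not_gt (by linarith)
    _ ≤ _ := (measure_union_le _ _).trans (add_le_add (hclass true) (hclass false))
    _ = _ := by
        rw [← ENNReal.ofReal_add (by positivity) (by positivity)]
        ring_nf

end Bicolour

section Selection

/-- The number of indices `q` with `e q z ≤ v`. -/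
noncomputable def countLe {V Ω : Type*} [Fintype V] (e : V → Ω → ℝ) (v : ℝ) (z : Ω) : ℕ :=
  (Finset.univ.filter fun q => e q z ≤ v).card

/-- The weight of `q` in the uniform average over the indices whose score `e q z` is at most `v`,
which is how nonlocal means averages over the pixels with a similar patch. -/
noncomputable def selWeight {V Ω : Type*} [Fintype V] (e : V → Ω → ℝ) (v : ℝ) (q : V) (z : Ω) :
    ℝ≥0∞ :=
  if e q z ≤ v then (countLe e v z : ℝ≥0∞)⁻¹ else 0

/-- The configurations for which raising the threshold from `v` to `v + H` at most quadruples the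
number of selected indices. -/
def stableSet {V Ω : Type*} [Fintype V] (e : V → Ω → ℝ) (v H : ℝ) : Set Ω :=
  {z | countLe e (v + H) z ≤ 4 * countLe e v z}

lemma inv_le_mul_inv_of_le_mul {a b c : ℝ≥0∞} (hc : c ≠ 0) (hc' : c ≠ ∞) (h : a ≤ c * b) :
    b⁻¹ ≤ c * a⁻¹ := by
  calc b⁻¹ = c * (c * b)⁻¹ := by
        rw [ENNReal.mul_inv (Or.inl hc) (Or.inl hc'), ← mul_assoc, ENNReal.mul_inv_cancel hc hc',
          one_mul]
    _ ≤ c * a⁻¹ := by gcongr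

variable {V Ω : Type*} [Fintype V] {e : V → Ω → ℝ} {v : ℝ}

lemma countLe_pos {q : V} {z : Ω} (h : e q z ≤ v) : 0 < countLe e v z :=
  Finset.card_pos.2 ⟨q, by simp [h]⟩

lemma countLe_mono {v' : ℝ} {z z' : Ω} (h : ∀ q, e q z ≤ v → e q z' ≤ v') :
    countLe e v z ≤ countLe e v' z' :=
  Finset.card_le_card (Finset.monotone_filter_right _ fun q _ => h q)

lemma sum_selWeight_le_one (z : Ω) : ∑ q, selWeight e v q z ≤ 1 := by
  simp only [selWeight]
  rw [← Finset.sum_filter, Finset.sum_const, nsmul_eq_mul]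
  exact ENNReal.mul_inv_le_one (countLe e v z : ℝ≥0∞)

lemma selWeight_le_one (q : V) (z : Ω) : selWeight e v q z ≤ 1 :=
  (Finset.single_le_sum (f := fun q => selWeight e v q z) (fun _ _ => zero_le)
    (Finset.mem_univ q)).trans (sum_selWeight_le_one z)

lemma selWeight_le_inv (q : V) (z : Ω) : selWeight e v q z ≤ (countLe e v z : ℝ≥0∞)⁻¹ := by
  unfold selWeight
  split_ifs
  exacts [le_rfl, zero_le]

lemma selWeight_le_mul_selWeight {v' : ℝ} {z z' : Ω} {q : V} {c : ℕ} (hc : c ≠ 0)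
    (hq : e q z ≤ v → e q z' ≤ v') (hcount : countLe e v' z' ≤ c * countLe e v z) :
    selWeight e v q z ≤ c * selWeight e v' q z' := by
  by_cases h : e q z ≤ v
  · simp only [selWeight, h, hq h, if_true]
    exact inv_le_mul_inv_of_le_mul (by exact_mod_cast hc) (ENNReal.natCast_ne_top c)
      (by exact_mod_cast hcount)
  · simp [selWeight, h]

lemma selWeight_le_mul_indicator_stableSet {G : ℝ} {z z' : Ω}
    (hz : ∀ q, |e q z - e q z'| ≤ G) (hst : z ∈ stableSet e v (4 * G)) (q : V) :
    selWeight e v q z ≤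
      4 * (stableSet e (v + G) (2 * G)).indicator (selWeight e (v + G) q) z' := by
  have hG : 0 ≤ G := (abs_nonneg _).trans (hz q)
  have hcount₁ : countLe e v z ≤ countLe e (v + G) z' :=
    countLe_mono fun p h => by linarith [(abs_le.1 (hz p)).1]
  have hcount₂ : countLe e (v + G + 2 * G) z' ≤ countLe e (v + 4 * G) z :=
    countLe_mono fun p h => by linarith [(abs_le.1 (hz p)).2]
  have hcount₃ : countLe e (v + G) z' ≤ countLe e (v + G + 2 * G) z' :=
    countLe_mono fun p h => by linarith
  have hst' : countLe e (v + 4 * G) z ≤ 4 * countLe e v z := hst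
  rw [Set.indicator_of_mem (show z' ∈ stableSet e (v + G) (2 * G) from
    hcount₂.trans (hst'.trans (by gcongr)))]
  exact_mod_cast selWeight_le_mul_selWeight (c := 4) (by norm_num)
    (fun h => by linarith [(abs_le.1 (hz q)).1]) (hcount₃.trans (hcount₂.trans hst'))

lemma indicator_stableSet_le_mul_selWeight {G : ℝ} {z z' : Ω}
    (hz : ∀ q, |e q z - e q z'| ≤ G) (q : V) :
    (stableSet e (v + G) (2 * G)).indicator (selWeight e (v + G) q) z' ≤
      4 * selWeight e (v + 2 * G) q z := by
  by_cases hst : z' ∈ stableSet e (v + G) (2 * G)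
  · rw [Set.indicator_of_mem hst]
    have hcount : countLe e (v + 2 * G) z ≤ countLe e (v + G + 2 * G) z' :=
      countLe_mono fun p h => by linarith [(abs_le.1 (hz p)).1]
    exact_mod_cast selWeight_le_mul_selWeight (c := 4) (by norm_num)
      (fun h => by linarith [(abs_le.1 (hz q)).2]) (hcount.trans hst)
  · simp [Set.indicator_of_notMem hst]

variable [MeasurableSpace Ω]

lemma measurable_countLe (he : ∀ q, Measurable (e q)) (v : ℝ) : Measurable (countLe e v) := by
  have hsum : countLe e v = fun z => ∑ q, if e q z ≤ v then 1 else 0 := by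
    funext z
    rw [countLe, Finset.card_filter]
  rw [hsum]
  exact Finset.measurable_sum _ fun q _ =>
    Measurable.ite (measurableSet_le (he q) measurable_const) measurable_const measurable_const

lemma measurable_selWeight (he : ∀ q, Measurable (e q)) (v : ℝ) (q : V) :
    Measurable (selWeight e v q) :=
  Measurable.ite (measurableSet_le (he q) measurable_const)
    ((measurable_of_countable _).comp (measurable_countLe he v)).inv measurable_const

lemma measurableSet_stableSet (he : ∀ q, Measurable (e q)) (v H : ℝ) :
    MeasurableSet (stableSet e v H) :=
  measurableSet_le (measurable_countLe he _) ((measurable_countLe he v).const_mul 4)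

lemma measurableSet_le_countLe (he : ∀ q, Measurable (e q)) (v : ℝ) (b : ℕ) :
    MeasurableSet {z | b ≤ countLe e v z} :=
  measurableSet_le measurable_const (measurable_countLe he v)

lemma sum_lintegral_selWeight_le_one (he : ∀ q, Measurable (e q)) (v : ℝ)
    (μ : Measure Ω) [IsProbabilityMeasure μ] :
    ∑ q, ∫⁻ z, selWeight e v q z ∂μ ≤ 1 := by
  rw [← lintegral_finsetSum _ fun q _ => measurable_selWeight he v q]
  calc _ ≤ ∫⁻ _, 1 ∂μ := lintegral_mono fun z => sum_selWeight_le_one z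
    _ = 1 := by simp

end Selection

section CountLeOff

/-- The number of indices `q ∉ B` with `e q z ≤ v`. It replaces `countLe` when the scores outside
`B` do not depend on some coordinate of the noise. -/
noncomputable def countLeOff {V Ω : Type*} [Fintype V] [DecidableEq V] (e : V → Ω → ℝ) (v : ℝ)
    (B : Finset V) (z : Ω) : ℕ :=
  (Finset.univ.filter fun q => q ∉ B ∧ e q z ≤ v).card

variable {V Ω : Type*} [Fintype V] [DecidableEq V] {e : V → Ω → ℝ} {v : ℝ}

lemma countLeOff_le_countLe (B : Finset V) (z : Ω) : countLeOff e v B z ≤ countLe e v z :=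
  Finset.card_le_card (Finset.monotone_filter_right _ fun _ _ => And.right)

lemma countLe_le_countLeOff_add {B : Finset V} {b : ℕ} (hB : B.card ≤ b) (z : Ω) :
    countLe e v z ≤ countLeOff e v B z + b := by
  have hsub : (Finset.univ.filter fun q => e q z ≤ v) ⊆
      (Finset.univ.filter fun q => q ∉ B ∧ e q z ≤ v) ∪ B := by
    intro q hq
    simp only [Finset.mem_filter, Finset.mem_univ, true_and, Finset.mem_union] at hq ⊢
    tauto
  exact (Finset.card_le_card hsub).trans ((Finset.card_union_le _ _).trans (by
    unfold countLeOff; gcongr))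

lemma measurable_countLeOff [MeasurableSpace Ω] (he : ∀ q, Measurable (e q)) (v : ℝ)
    (B : Finset V) : Measurable (countLeOff e v B) := by
  have hsum : countLeOff e v B = fun z => ∑ q, if q ∉ B ∧ e q z ≤ v then 1 else 0 := by
    funext z
    rw [countLeOff, Finset.card_filter]
  rw [hsum]
  exact Finset.measurable_sum _ fun q _ =>
    Measurable.ite ((MeasurableSet.const _).inter (measurableSet_le (he q) measurable_const))
      measurable_const measurable_const

lemma countLeOff_update {E : Type*} {e : V → (V → E) → ℝ} {B : Finset V} {q : V}
    (hB : ∀ q' ∉ B, ∀ z c, e q' (Function.update z q c) = e q' z) (z : V → E) (c : E) :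
    countLeOff e v B (Function.update z q c) = countLeOff e v B z := by
  unfold countLeOff
  congr 1
  refine Finset.filter_congr fun q' _ => ?_
  by_cases h : q' ∈ B
  · simp [h]
  · simp [h, hB q' h]

end CountLeOff

section Decoupling

variable {V E : Type*} [Fintype V] [DecidableEq V] [MeasurableSpace E] {ν : Measure E}
  [IsProbabilityMeasure ν] {e : V → (V → E) → ℝ} {v : ℝ}

lemma lintegral_eval_mul_le_of_sandwich {q : V} {f : E → ℝ≥0∞} (hf : Measurable f)
    {L F H : (V → E) → ℝ≥0∞} (hF : Measurable F) (hH : Measurable H)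
    (hFq : ∀ z c, F (Function.update z q c) = F z) {c : ℝ≥0∞}
    (hLF : ∀ z, L z ≤ F z) (hFH : ∀ z, F z ≤ c * H z) :
    ∫⁻ z, f (z q) * L z ∂(Measure.pi fun _ => ν) ≤
      c * (∫⁻ x, f x ∂ν) * ∫⁻ z, H z ∂(Measure.pi fun _ => ν) := by
  calc _ ≤ ∫⁻ z, f (z q) * F z ∂(Measure.pi fun _ => ν) :=
        lintegral_mono fun z => by gcongr; exact hLF z
    _ = (∫⁻ x, f x ∂ν) * ∫⁻ z, F z ∂(Measure.pi fun _ => ν) :=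
        lintegral_eval_mul_pi_of_update hf hF hFq
    _ ≤ (∫⁻ x, f x ∂ν) * ∫⁻ z, c * H z ∂(Measure.pi fun _ => ν) := by
        gcongr with z
        exact hFH z
    _ = _ := by rw [lintegral_const_mul _ hH]; ring

lemma lintegral_eval_mul_selWeight_le_of_large_count (he : ∀ q, Measurable (e q)) {q : V}
    {B : Finset V} {b : ℕ} (hBb : B.card ≤ b)
    (hq : ∀ z c, e q (Function.update z q c) = e q z)
    (hB : ∀ q' ∉ B, ∀ z c, e q' (Function.update z q c) = e q' z)
    {f : E → ℝ≥0∞} (hf : Measurable f) :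
    ∫⁻ z, f (z q) * {z | 2 * b ≤ countLe e v z}.indicator (selWeight e v q) z
        ∂(Measure.pi fun _ => ν) ≤
      2 * (∫⁻ x, f x ∂ν) * ∫⁻ z, selWeight e v q z ∂(Measure.pi fun _ => ν) := by
  refine lintegral_eval_mul_le_of_sandwich hf
    (F := fun z => if e q z ≤ v ∧ b ≤ countLeOff e v B z then
      (countLeOff e v B z : ℝ≥0∞)⁻¹ else 0) ?_ (measurable_selWeight he v q)
    (fun z c => by simp only [hq, countLeOff_update hB]) (fun z => ?_) fun z => ?_
  · refine Measurable.ite ((measurableSet_le (he q) measurable_const).inter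
      (measurableSet_le measurable_const (measurable_countLeOff he v B))) ?_ measurable_const
    exact ((measurable_of_countable _).comp (measurable_countLeOff he v B)).inv
  · refine Set.indicator_apply_le' (fun hz => ?_) fun _ => zero_le
    have hadd := countLe_le_countLeOff_add (e := e) (v := v) hBb z
    have hz : 2 * b ≤ countLe e v z := hz
    by_cases h : e q z ≤ v
    · rw [selWeight, if_pos h, if_pos ⟨h, by omega⟩]
      gcongr
      exact countLeOff_le_countLe B z
    · simp [selWeight, h]
  · have hadd := countLe_le_countLeOff_add (e := e) (v := v) hBb z
    split_ifs with h
    · rw [selWeight, if_pos h.1]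
      refine inv_le_mul_inv_of_le_mul (by norm_num) (by norm_num) ?_
      exact_mod_cast (by omega : countLe e v z ≤ 2 * countLeOff e v B z)
    · exact zero_le

lemma lintegral_eval_mul_selWeight_le_of_small_count (he : ∀ q, Measurable (e q)) {q : V}
    {B : Finset V} {b : ℕ} (hb : 0 < b) (hBb : B.card ≤ b)
    (hq : ∀ z c, e q (Function.update z q c) = e q z)
    (hB : ∀ q' ∉ B, ∀ z c, e q' (Function.update z q c) = e q' z)
    {f : E → ℝ≥0∞} (hf : Measurable f) :
    ∫⁻ z, f (z q) * {z | 2 * b ≤ countLe e v z}ᶜ.indicator (selWeight e v q) z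
        ∂(Measure.pi fun _ => ν) ≤
      (3 * b : ℕ) * (∫⁻ x, f x ∂ν) * ∫⁻ z, selWeight e v q z ∂(Measure.pi fun _ => ν) := by
  refine lintegral_eval_mul_le_of_sandwich hf
    (F := fun z => if e q z ≤ v ∧ countLeOff e v B z < 2 * b then 1 else 0)
    (Measurable.ite ((measurableSet_le (he q) measurable_const).inter
      (measurableSet_lt (measurable_countLeOff he v B) measurable_const)) measurable_const
      measurable_const) (measurable_selWeight he v q)
    (fun z c => by simp only [hq, countLeOff_update hB]) (fun z => ?_) fun z => ?_
  · refine Set.indicator_apply_le' (fun hz => ?_) fun _ => zero_le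
    have hz : ¬ 2 * b ≤ countLe e v z := hz
    have hle := countLeOff_le_countLe (e := e) (v := v) B z
    by_cases h : e q z ≤ v
    · rw [if_pos ⟨h, by omega⟩]
      exact selWeight_le_one q z
    · simp [selWeight, h]
  · have hadd := countLe_le_countLeOff_add (e := e) (v := v) hBb z
    split_ifs with h
    · rw [selWeight, if_pos h.1, ← inv_one]
      refine inv_le_mul_inv_of_le_mul (by simp; omega) (ENNReal.natCast_ne_top _) ?_
      rw [mul_one]
      exact_mod_cast (by omega : countLe e v z ≤ 3 * b)
    · exact zero_le

variable {G : ℝ} {Ω₀ : Set (V → E)} {S : Set E} {x₀ : E}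

lemma lintegral_eval_mul_selWeight_le_of_stable_count (he : ∀ q, Measurable (e q)) {q : V}
    (hG : ∀ z ∈ Ω₀, z q ∈ S → ∀ q', |e q' z - e q' (Function.update z q x₀)| ≤ G)
    {f : E → ℝ≥0∞} (hf : Measurable f) :
    ∫⁻ z, f (z q) * {z | z ∈ Ω₀ ∧ z q ∈ S ∧ z ∈ stableSet e v (4 * G)}.indicator
        (selWeight e v q) z ∂(Measure.pi fun _ => ν) ≤
      4 * (∫⁻ x, f x ∂ν) * ∫⁻ z, (stableSet e (v + G) (2 * G)).indicator
        (selWeight e (v + G) q) (Function.update z q x₀) ∂(Measure.pi fun _ => ν) := by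
  have hmeas : Measurable fun z : V → E => (stableSet e (v + G) (2 * G)).indicator
      (selWeight e (v + G) q) (Function.update z q x₀) :=
    ((measurable_selWeight he _ q).indicator (measurableSet_stableSet he _ _)).comp
      measurable_update_left
  exact lintegral_eval_mul_le_of_sandwich hf (hmeas.const_mul 4) hmeas
    (fun z c => by simp only [Function.update_idem])
    (fun z => Set.indicator_apply_le' (fun hz =>
      selWeight_le_mul_indicator_stableSet (hG z hz.1 hz.2.1) hz.2.2 q) fun _ => zero_le)
    fun _ => le_rfl

/-- Integrating the independent event `z q ∈ S` against the decoupled weight brings back an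
honest weight at the threshold `v + 2 * G`. -/
lemma lintegral_indicator_stableSet_update_le (he : ∀ q, Measurable (e q)) {q : V}
    (hΩ : MeasurableSet Ω₀) (hS : MeasurableSet S) (hνS : 1 / 2 ≤ ν S)
    (hG : ∀ z ∈ Ω₀, z q ∈ S → ∀ q', |e q' z - e q' (Function.update z q x₀)| ≤ G) :
    ∫⁻ z, (stableSet e (v + G) (2 * G)).indicator (selWeight e (v + G) q)
        (Function.update z q x₀) ∂(Measure.pi fun _ => ν) ≤
      2 * (4 * ∫⁻ z, selWeight e (v + 2 * G) q z ∂(Measure.pi fun _ => ν) +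
        Measure.pi (fun _ => ν) Ω₀ᶜ) := by
  set μ := Measure.pi fun _ : V => ν
  set X : (V → E) → ℝ≥0∞ := fun z => (stableSet e (v + G) (2 * G)).indicator
    (selWeight e (v + G) q) (Function.update z q x₀)
  have hmeas : Measurable X :=
    ((measurable_selWeight he _ q).indicator (measurableSet_stableSet he _ _)).comp
      measurable_update_left
  have hindep : ∫⁻ z, S.indicator 1 (z q) * X z ∂μ = ν S * ∫⁻ z, X z ∂μ := by
    rw [lintegral_eval_mul_pi_of_update (measurable_one.indicator hS) hmeas
      (fun z c => by simp only [X, Function.update_idem]), lintegral_indicator_one hS]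
  have hpoint (z : V → E) : S.indicator 1 (z q) * X z ≤
      4 * selWeight e (v + 2 * G) q z + Ω₀ᶜ.indicator 1 z := by
    by_cases hz : z ∈ Ω₀
    · by_cases hzS : z q ∈ S
      · simpa [hz, hzS] using indicator_stableSet_le_mul_selWeight (hG z hz hzS) q
      · simp [hzS]
    · refine le_add_left ?_
      rw [Set.indicator_of_mem (show z ∈ Ω₀ᶜ from hz)]
      exact mul_le_one' (Set.indicator_le_self _ _ _)
        ((Set.indicator_le_self _ _ _).trans (selWeight_le_one q _))
  calc ∫⁻ z, X z ∂μ = 2 * (1 / 2 * ∫⁻ z, X z ∂μ) := by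
        rw [← mul_assoc, one_div, ENNReal.mul_inv_cancel (by norm_num) (by norm_num), one_mul]
    _ ≤ 2 * ∫⁻ z, S.indicator 1 (z q) * X z ∂μ := by rw [hindep]; gcongr
    _ ≤ 2 * ∫⁻ z, (4 * selWeight e (v + 2 * G) q z + Ω₀ᶜ.indicator 1 z) ∂μ := by
        gcongr with z
        exact hpoint z
    _ = _ := by
        rw [lintegral_add_left ((measurable_selWeight he _ q).const_mul 4),
          lintegral_const_mul _ (measurable_selWeight he _ q), lintegral_indicator_one hΩ.compl]

lemma sum_lintegral_eval_mul_selWeight_le_of_stable_count (he : ∀ q, Measurable (e q))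
    (hΩ : MeasurableSet Ω₀) (hS : MeasurableSet S) (hνS : 1 / 2 ≤ ν S)
    (hG : ∀ q, ∀ z ∈ Ω₀, z q ∈ S → ∀ q', |e q' z - e q' (Function.update z q x₀)| ≤ G)
    {f : E → ℝ≥0∞} (hf : Measurable f) :
    ∑ q, ∫⁻ z, f (z q) * {z | z ∈ Ω₀ ∧ z q ∈ S ∧ z ∈ stableSet e v (4 * G)}.indicator
        (selWeight e v q) z ∂(Measure.pi fun _ => ν) ≤
      8 * (∫⁻ x, f x ∂ν) * (4 + Fintype.card V * Measure.pi (fun _ => ν) Ω₀ᶜ) := by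
  set μ := Measure.pi fun _ : V => ν
  calc _ ≤ ∑ q, 4 * (∫⁻ x, f x ∂ν) *
        (2 * (4 * ∫⁻ z, selWeight e (v + 2 * G) q z ∂μ + μ Ω₀ᶜ)) :=
        Finset.sum_le_sum fun q _ =>
          (lintegral_eval_mul_selWeight_le_of_stable_count he (hG q) hf).trans (by
            gcongr
            exact lintegral_indicator_stableSet_update_le he hΩ hS hνS (hG q))
    _ = 8 * (∫⁻ x, f x ∂ν) *
        (4 * ∑ q, ∫⁻ z, selWeight e (v + 2 * G) q z ∂μ + Fintype.card V * μ Ω₀ᶜ) := by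
        rw [← Finset.mul_sum, ← Finset.mul_sum, Finset.sum_add_distrib, ← Finset.mul_sum,
          Finset.sum_const, Finset.card_univ, nsmul_eq_mul]
        ring
    _ ≤ 8 * (∫⁻ x, f x ∂ν) * (4 * 1 + Fintype.card V * μ Ω₀ᶜ) := by
        gcongr
        exact sum_lintegral_selWeight_le_one he _ _
    _ = _ := by rw [mul_one]

end Decoupling

section Decomposition

/-- The configurations for which fewer than `2 * b` indices are selected and raising the threshold
from `v` to `v + H` more than quadruples their number. -/
def unstableSet {V Ω : Type*} [Fintype V] (e : V → Ω → ℝ) (v H : ℝ) (b : ℕ) : Set Ω :=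
  {z | z ∉ stableSet e v H ∧ countLe e v z < 2 * b}

lemma measurableSet_unstableSet {V Ω : Type*} [Fintype V] [MeasurableSpace Ω] {e : V → Ω → ℝ}
    (he : ∀ q, Measurable (e q)) (v H : ℝ) (b : ℕ) : MeasurableSet (unstableSet e v H b) :=
  (measurableSet_stableSet he v H).compl.inter
    (measurableSet_lt (measurable_countLe he v) measurable_const)

lemma sum_lintegral_indicator_selWeight_le {V Ω : Type*} [Fintype V] [MeasurableSpace Ω]
    {e : V → Ω → ℝ} {v : ℝ} (he : ∀ q, Measurable (e q)) {W : Set Ω} (hW : MeasurableSet W)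
    (μ : Measure Ω) : ∑ q, ∫⁻ z, W.indicator (selWeight e v q) z ∂μ ≤ μ W := by
  rw [← lintegral_finsetSum _ fun q _ => (measurable_selWeight he v q).indicator hW]
  calc ∫⁻ z, ∑ q, W.indicator (selWeight e v q) z ∂μ ≤ ∫⁻ z, W.indicator 1 z ∂μ := by
        refine lintegral_mono fun z => ?_
        by_cases hz : z ∈ W
        · simpa [hz] using sum_selWeight_le_one z
        · simp [hz]
    _ = μ W := lintegral_indicator_one hW

lemma sum_le_add_card_mul {V : Type*} [Fintype V] {a w : V → ℝ≥0∞} {c d : ℝ≥0∞} {N : Finset V}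
    (hw : ∑ q, w q ≤ 1) (hoff : ∀ q ∉ N, a q ≤ c * w q) (hon : ∀ q ∈ N, a q ≤ d) :
    ∑ q, a q ≤ c + N.card * d := by
  classical
  calc ∑ q, a q ≤ ∑ q, (c * w q + if q ∈ N then d else 0) := by
        refine Finset.sum_le_sum fun q _ => ?_
        split_ifs with hq
        · exact le_add_left (hon q hq)
        · exact le_add_right (hoff q hq)
    _ = c * ∑ q, w q + N.card * d := by
        rw [Finset.sum_add_distrib, ← Finset.mul_sum]
        simp
    _ ≤ c * 1 + N.card * d := by gcongr
    _ = c + N.card * d := by rw [mul_one]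

lemma eval_mul_selWeight_le_add {V E : Type*} [Fintype V] {e : V → (V → E) → ℝ} {v H : ℝ} {b : ℕ}
    {f : E → ℝ≥0∞} {M : ℝ≥0∞} {S : Set E} (hfS : ∀ x ∈ S, f x ≤ M) (Ω₀ : Set (V → E)) (q : V)
    (z : V → E) :
    f (z q) * selWeight e v q z ≤
      f (z q) * {z | 2 * b ≤ countLe e v z}.indicator (selWeight e v q) z +
      Sᶜ.indicator f (z q) * {z | 2 * b ≤ countLe e v z}ᶜ.indicator (selWeight e v q) z +
      f (z q) * {z | z ∈ Ω₀ ∧ z q ∈ S ∧ z ∈ stableSet e v H}.indicator (selWeight e v q) z +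
      M * (Ω₀ᶜ ∪ unstableSet e v H b).indicator (selWeight e v q) z := by
  by_cases hlarge : z ∈ {z | 2 * b ≤ countLe e v z}
  · rw [Set.indicator_of_mem hlarge]
    exact le_add_right (le_add_right le_self_add)
  by_cases hzS : z q ∈ S
  · by_cases hst : z ∈ {z | z ∈ Ω₀ ∧ z q ∈ S ∧ z ∈ stableSet e v H}
    · rw [Set.indicator_of_mem hst]
      exact le_add_right le_add_self
    · have hz : z ∈ Ω₀ᶜ ∪ unstableSet e v H b := by
        by_cases hzΩ : z ∈ Ω₀
        · exact Or.inr ⟨fun h => hst ⟨hzΩ, hzS, h⟩, not_le.1 hlarge⟩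
        · exact Or.inl hzΩ
      rw [Set.indicator_of_mem hz]
      exact le_add_left (by gcongr; exact hfS _ hzS)
  · rw [Set.indicator_of_mem (show z q ∈ Sᶜ from hzS), Set.indicator_of_mem
      (show z ∈ {z | 2 * b ≤ countLe e v z}ᶜ from hlarge)]
    exact le_add_right (le_add_right le_add_self)

lemma lintegral_eval_mul_selWeight_le_add {V E : Type*} [Fintype V] [MeasurableSpace E]
    {e : V → (V → E) → ℝ} {v H : ℝ} {f : E → ℝ≥0∞} {M : ℝ≥0∞} {S : Set E} {Ω₀ : Set (V → E)}
    (he : ∀ q, Measurable (e q))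
    (hΩ : MeasurableSet Ω₀) (hS : MeasurableSet S) (hf : Measurable f) (hfS : ∀ x ∈ S, f x ≤ M)
    (b : ℕ) (μ : Measure (V → E)) (q : V) :
    ∫⁻ z, f (z q) * selWeight e v q z ∂μ ≤
      ∫⁻ z, f (z q) * {z | 2 * b ≤ countLe e v z}.indicator (selWeight e v q) z ∂μ +
      ∫⁻ z, Sᶜ.indicator f (z q) * {z | 2 * b ≤ countLe e v z}ᶜ.indicator (selWeight e v q) z ∂μ +
      ∫⁻ z, f (z q) * {z | z ∈ Ω₀ ∧ z q ∈ S ∧ z ∈ stableSet e v H}.indicator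
        (selWeight e v q) z ∂μ +
      M * ∫⁻ z, (Ω₀ᶜ ∪ unstableSet e v H b).indicator (selWeight e v q) z ∂μ := by
  have hbad := hΩ.compl.union (measurableSet_unstableSet he v H b)
  have hf_eval : Measurable fun z : V → E => f (z q) := hf.comp (measurable_pi_apply q)
  have hw := measurable_selWeight he v q
  have hlarge : Measurable fun z => f (z q) *
      {z | 2 * b ≤ countLe e v z}.indicator (selWeight e v q) z :=
    hf_eval.mul (hw.indicator (measurableSet_le_countLe he v (2 * b)))
  have hgood : Measurable fun z => f (z q) *
      {z | z ∈ Ω₀ ∧ z q ∈ S ∧ z ∈ stableSet e v H}.indicator (selWeight e v q) z :=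
    hf_eval.mul (hw.indicator
      (hΩ.inter ((measurable_pi_apply q hS).inter (measurableSet_stableSet he v _))))
  rw [← lintegral_const_mul M (hw.indicator hbad), ← lintegral_add_left hlarge,
    ← lintegral_add_right _ hgood, ← lintegral_add_right _ ((hw.indicator hbad).const_mul M)]
  exact lintegral_mono fun z => eval_mul_selWeight_le_add hfS Ω₀ q z

variable {V E : Type*} [Fintype V] [DecidableEq V] [MeasurableSpace E] {ν : Measure E}
  [IsProbabilityMeasure ν] {e : V → (V → E) → ℝ} {v : ℝ} {N : Finset V} {b : ℕ}
  {B : V → Finset V} {f : E → ℝ≥0∞}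

lemma sum_lintegral_eval_mul_selWeight_le_of_large_count (he : ∀ q, Measurable (e q))
    (hb : 0 < b) (hN : N.card ≤ b) (hBb : ∀ q, (B q).card ≤ b)
    (hq : ∀ q ∉ N, ∀ z c, e q (Function.update z q c) = e q z)
    (hB : ∀ q ∉ N, ∀ q' ∉ B q, ∀ z c, e q' (Function.update z q c) = e q' z)
    (hf : Measurable f) :
    ∑ q, ∫⁻ z, f (z q) * {z | 2 * b ≤ countLe e v z}.indicator (selWeight e v q) z
      ∂(Measure.pi fun _ => ν) ≤ 3 * ∫⁻ x, f x ∂ν := by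
  have hon : ∀ q ∈ N, ∫⁻ z, f (z q) * {z | 2 * b ≤ countLe e v z}.indicator
      (selWeight e v q) z ∂(Measure.pi fun _ => ν) ≤ (∫⁻ x, f x ∂ν) * (b : ℝ≥0∞)⁻¹ := by
    intro q _
    have hf_eval : Measurable fun z : V → E => f (z q) := hf.comp (measurable_pi_apply q)
    rw [← lintegral_eval_pi (μ := fun _ : V => ν) q hf, ← lintegral_mul_const _ hf_eval]
    refine lintegral_mono fun z => mul_le_mul_right
      (Set.indicator_apply_le' (fun hz => ?_) fun _ => zero_le) (f (z q))
    have hz : 2 * b ≤ countLe e v z := hz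
    refine (selWeight_le_inv q z).trans ?_
    gcongr
    omega
  calc _ ≤ 2 * (∫⁻ x, f x ∂ν) + N.card * ((∫⁻ x, f x ∂ν) * (b : ℝ≥0∞)⁻¹) :=
        sum_le_add_card_mul (sum_lintegral_selWeight_le_one he v _) (fun q hqN =>
          lintegral_eval_mul_selWeight_le_of_large_count he (hBb q) (hq q hqN) (hB q hqN) hf) hon
    _ ≤ 2 * (∫⁻ x, f x ∂ν) + b * ((∫⁻ x, f x ∂ν) * (b : ℝ≥0∞)⁻¹) := by gcongr
    _ = 3 * ∫⁻ x, f x ∂ν := by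
        rw [mul_left_comm (b : ℝ≥0∞), ENNReal.mul_inv_cancel (by simp; omega)
          (ENNReal.natCast_ne_top _)]
        ring

lemma sum_lintegral_eval_mul_selWeight_le_of_small_count (he : ∀ q, Measurable (e q))
    (hb : 0 < b) (hN : N.card ≤ b) (hBb : ∀ q, (B q).card ≤ b)
    (hq : ∀ q ∉ N, ∀ z c, e q (Function.update z q c) = e q z)
    (hB : ∀ q ∉ N, ∀ q' ∉ B q, ∀ z c, e q' (Function.update z q c) = e q' z)
    (hf : Measurable f) :
    ∑ q, ∫⁻ z, f (z q) * {z | 2 * b ≤ countLe e v z}ᶜ.indicator (selWeight e v q) z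
      ∂(Measure.pi fun _ => ν) ≤ (4 * b : ℕ) * ∫⁻ x, f x ∂ν := by
  have hon : ∀ q ∈ N, ∫⁻ z, f (z q) * {z | 2 * b ≤ countLe e v z}ᶜ.indicator
      (selWeight e v q) z ∂(Measure.pi fun _ => ν) ≤ ∫⁻ x, f x ∂ν := by
    intro q _
    rw [← lintegral_eval_pi (μ := fun _ : V => ν) q hf]
    exact lintegral_mono fun z => mul_le_of_le_one_right zero_le
      ((Set.indicator_le_self _ _ _).trans (selWeight_le_one q z))
  calc _ ≤ (3 * b : ℕ) * (∫⁻ x, f x ∂ν) + N.card * ∫⁻ x, f x ∂ν :=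
        sum_le_add_card_mul (sum_lintegral_selWeight_le_one he v _) (fun q hqN =>
          lintegral_eval_mul_selWeight_le_of_small_count he hb (hBb q) (hq q hqN) (hB q hqN) hf)
          hon
    _ ≤ (3 * b : ℕ) * (∫⁻ x, f x ∂ν) + b * ∫⁻ x, f x ∂ν := by gcongr
    _ = _ := by push_cast; ring

variable {S : Set E} {x₀ : E} {G : ℝ} {M : ℝ≥0∞} {Ω₀ : Set (V → E)}

lemma sum_lintegral_eval_mul_selWeight_le (he : ∀ q, Measurable (e q))
    (hb : 0 < b) (hN : N.card ≤ b) (hBb : ∀ q, (B q).card ≤ b)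
    (hq : ∀ q ∉ N, ∀ z c, e q (Function.update z q c) = e q z)
    (hB : ∀ q ∉ N, ∀ q' ∉ B q, ∀ z c, e q' (Function.update z q c) = e q' z)
    (hΩ : MeasurableSet Ω₀)
    (hS : MeasurableSet S) (hνS : 1 / 2 ≤ ν S)
    (hG : ∀ q, ∀ z ∈ Ω₀, z q ∈ S → ∀ q', |e q' z - e q' (Function.update z q x₀)| ≤ G)
    (hf : Measurable f) (hfS : ∀ x ∈ S, f x ≤ M) :
    ∑ q, ∫⁻ z, f (z q) * selWeight e v q z ∂(Measure.pi fun _ => ν) ≤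
      3 * ∫⁻ x, f x ∂ν + (4 * b : ℕ) * ∫⁻ x in Sᶜ, f x ∂ν +
      8 * (∫⁻ x, f x ∂ν) * (4 + Fintype.card V * Measure.pi (fun _ => ν) Ω₀ᶜ) +
      M * (Measure.pi (fun _ => ν) Ω₀ᶜ +
        Measure.pi (fun _ => ν) (unstableSet e v (4 * G) b)) := by
  have hbad := hΩ.compl.union (measurableSet_unstableSet he v (4 * G) b)
  refine (Finset.sum_le_sum fun q _ =>
    lintegral_eval_mul_selWeight_le_add (H := 4 * G) he hΩ hS hf hfS b _ q).trans ?_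
  rw [Finset.sum_add_distrib, Finset.sum_add_distrib, Finset.sum_add_distrib, ← Finset.mul_sum]
  gcongr
  · exact sum_lintegral_eval_mul_selWeight_le_of_large_count he hb hN hBb hq hB hf
  · rw [← lintegral_indicator hS.compl]
    exact sum_lintegral_eval_mul_selWeight_le_of_small_count he hb hN hBb hq hB
      (hf.indicator hS.compl)
  · exact sum_lintegral_eval_mul_selWeight_le_of_stable_count he hΩ hS hνS hG hf
  · exact (sum_lintegral_indicator_selWeight_le he hbad _).trans (measure_union_le _ _)

end Decomposition

section Unstable

lemma card_filter_range_le_sub {φ : ℕ → ℝ} {J : ℕ} {P : ℕ → Prop} [DecidablePred P]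
    (hφ : ∀ j < J, φ (j + 1) ≤ φ j) (hP : ∀ j < J, P j → φ (j + 1) + 1 ≤ φ j) :
    (((Finset.range J).filter P).card : ℝ) ≤ φ 0 - φ J := by
  rw [← Finset.sum_range_sub', Finset.card_filter, Nat.cast_sum]
  refine Finset.sum_le_sum fun j hj => ?_
  have hj := Finset.mem_range.1 hj
  split_ifs with h
  · push_cast
    linarith [hP j hj h]
  · push_cast
    linarith [hφ j hj]

/-- The logarithm of `min (a j) (4 * R)` is nonincreasing and loses `log 4 ≥ 1` at each drop. -/
lemma card_quarter_drops_le_log {a : ℕ → ℕ} {J R : ℕ} (ha : ∀ j ≤ J, 0 < a j)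
    (hmono : ∀ j < J, a (j + 1) ≤ a j) (hR : 0 < R) :
    (((Finset.range J).filter fun j => 4 * a (j + 1) < a j ∧ a (j + 1) < R).card : ℝ) ≤
      Real.log (4 * R) := by
  set φ : ℕ → ℝ := fun j => Real.log (min (a j) (4 * R) : ℕ) with hφ
  have hpos (j : ℕ) (hj : j ≤ J) : 0 < min (a j) (4 * R) := lt_min (ha j hj) (by omega)
  have hφ_anti : ∀ j < J, φ (j + 1) ≤ φ j := fun j hj =>
    Real.log_le_log (by exact_mod_cast hpos (j + 1) hj) (by
      have := hmono j hj
      exact_mod_cast (by omega : min (a (j + 1)) (4 * R) ≤ min (a j) (4 * R)))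
  have hφ_drop : ∀ j < J, 4 * a (j + 1) < a j ∧ a (j + 1) < R → φ (j + 1) + 1 ≤ φ j := by
    intro j hj h
    have hposj : (0 : ℝ) < (min (a (j + 1)) (4 * R) : ℕ) := by exact_mod_cast hpos (j + 1) hj
    have hlog4 : 1 ≤ Real.log 4 := by
      rw [Real.le_log_iff_exp_le (by norm_num)]
      linarith [Real.exp_one_lt_d9]
    have hlog : Real.log (4 * (min (a (j + 1)) (4 * R) : ℕ)) ≤ φ j :=
      Real.log_le_log (by positivity)
        (by exact_mod_cast (by omega : 4 * min (a (j + 1)) (4 * R) ≤ min (a j) (4 * R)))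
    rw [Real.log_mul (by norm_num) hposj.ne'] at hlog
    simp only [hφ] at hlog ⊢
    linarith
  have hφ_zero : φ 0 ≤ Real.log (4 * R) :=
    Real.log_le_log (by exact_mod_cast hpos 0 (Nat.zero_le _)) (by
      exact_mod_cast min_le_right _ _)
  have hφ_last : 0 ≤ φ J := Real.log_nonneg (by exact_mod_cast hpos J le_rfl)
  linarith [card_filter_range_le_sub hφ_anti hφ_drop]

lemma sum_indicator_preimage_le {Ω : Type*} {J : ℕ} {Ψ : ℕ → Ω → Ω} {U D : Set Ω}
    [DecidablePred (· ∈ U)] {L : ℝ}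
    (hL : ∀ z ∈ D, (((Finset.range J).filter fun j => Ψ j z ∈ U).card : ℝ) ≤ L) (z : Ω) :
    ∑ j ∈ Finset.range J, (Ψ j ⁻¹' U).indicator (1 : Ω → ℝ≥0∞) z ≤
      ENNReal.ofReal L + J * Dᶜ.indicator 1 z := by
  have hcard : ∑ j ∈ Finset.range J, (Ψ j ⁻¹' U).indicator (1 : Ω → ℝ≥0∞) z =
      ((Finset.range J).filter fun j => Ψ j z ∈ U).card := by
    rw [Finset.card_filter, Nat.cast_sum]
    exact Finset.sum_congr rfl fun j _ => by by_cases h : Ψ j z ∈ U <;> simp [h]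
  rw [hcard]
  by_cases hz : z ∈ D
  · rw [← ENNReal.ofReal_natCast]
    exact le_add_right (ENNReal.ofReal_le_ofReal (hL z hz))
  · rw [Set.indicator_of_mem (show z ∈ Dᶜ from hz), Pi.one_apply, mul_one]
    refine le_add_left ?_
    exact_mod_cast (Finset.card_filter_le _ _).trans_eq (Finset.card_range J)

lemma mul_measure_le_of_forall_le_preimage {Ω : Type*} [MeasurableSpace Ω] {μ : Measure Ω}
    [IsProbabilityMeasure μ] {J : ℕ} {Ψ : ℕ → Ω → Ω} (hΨ : ∀ j, Measurable (Ψ j))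
    {U A D : Set Ω} [DecidablePred (· ∈ U)] (hU : MeasurableSet U) (hA : MeasurableSet A)
    (hD : MeasurableSet D)
    {c : ℝ≥0∞} (hc : ∀ j < J, ∀ B, MeasurableSet B → B ⊆ A → μ B ≤ c * μ (Ψ j ⁻¹' B)) {L : ℝ}
    (hL : ∀ z ∈ D, (((Finset.range J).filter fun j => Ψ j z ∈ U).card : ℝ) ≤ L) :
    J * μ U ≤ J * μ Aᶜ + c * (ENNReal.ofReal L + J * μ Dᶜ) := by
  have hinter : J * μ (U ∩ A) ≤ c * (ENNReal.ofReal L + J * μ Dᶜ) := by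
    calc J * μ (U ∩ A) = ∑ _j ∈ Finset.range J, μ (U ∩ A) := by simp
      _ ≤ ∑ j ∈ Finset.range J, c * ∫⁻ z, (Ψ j ⁻¹' U).indicator 1 z ∂μ := by
          refine Finset.sum_le_sum fun j hj => ?_
          rw [lintegral_indicator_one (hΨ _ hU)]
          refine (hc j (Finset.mem_range.1 hj) _ (hU.inter hA) Set.inter_subset_right).trans ?_
          gcongr
          exact Set.inter_subset_left
      _ = c * ∫⁻ z, ∑ j ∈ Finset.range J, (Ψ j ⁻¹' U).indicator 1 z ∂μ := by
          rw [← Finset.mul_sum, lintegral_finsetSum _ fun j _ =>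
            measurable_one.indicator (hΨ _ hU)]
      _ ≤ c * ∫⁻ z, (ENNReal.ofReal L + J * Dᶜ.indicator 1 z) ∂μ := by
          gcongr with z
          exact sum_indicator_preimage_le hL z
      _ = _ := by
          rw [lintegral_add_left measurable_const, lintegral_const_mul _
            (measurable_one.indicator hD.compl), lintegral_indicator_one hD.compl]
          simp
  calc J * μ U = J * (μ (U \ A) + μ (U ∩ A)) := by rw [measure_sdiff_add_inter _ hA]
    _ ≤ J * (μ Aᶜ + μ (U ∩ A)) := by
        gcongr
        exact fun _ hz => hz.2
    _ ≤ _ := by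
        rw [mul_add]
        gcongr

/-- Each visit to the unstable set along the orbit `Φ 0 z, Φ 1 z, …` quarters the count. -/
lemma mul_measure_unstableSet_le {V Ω : Type*} [Fintype V] [MeasurableSpace Ω] {e : V → Ω → ℝ}
    {v H : ℝ} {b J : ℕ} (he : ∀ q, Measurable (e q)) (hb : 0 < b) (hH : 0 ≤ H) {μ : Measure Ω}
    [IsProbabilityMeasure μ] {Φ : ℕ → Ω → Ω} (hΦ : ∀ j, Measurable (Φ j))
    {A D : Set Ω} (hA : MeasurableSet A) (hD : MeasurableSet D) {c : ℝ≥0∞}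
    (hc : ∀ j < J, ∀ B, MeasurableSet B → B ⊆ A → μ B ≤ c * μ (Φ (j + 1) ⁻¹' B))
    (hstep : ∀ z ∈ D, ∀ j < J, ∀ q, e q (Φ (j + 1) z) ≤ v + H → e q (Φ j z) ≤ v)
    (hp : ∀ z, ∃ q, e q z ≤ v) :
    J * μ (unstableSet e v H b) ≤
      J * μ Aᶜ + c * (ENNReal.ofReal (Real.log (8 * b)) + J * μ Dᶜ) := by
  classical
  refine mul_measure_le_of_forall_le_preimage (fun j => hΦ (j + 1))
    (measurableSet_unstableSet he v H b) hA hD hc fun z hz => ?_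
  have hdrops := card_quarter_drops_le_log (a := fun j => countLe e v (Φ j z)) (J := J)
    (R := 2 * b) (fun j _ => (hp (Φ j z)).elim fun _ => countLe_pos)
    (fun j hj => countLe_mono fun q h => hstep z hz j hj q (by linarith)) (by omega)
  have hsub : ((Finset.range J).filter fun j => Φ (j + 1) z ∈ unstableSet e v H b) ⊆
      (Finset.range J).filter fun j => 4 * countLe e v (Φ (j + 1) z) < countLe e v (Φ j z) ∧
        countLe e v (Φ (j + 1) z) < 2 * b := by
    refine fun j hj => Finset.mem_filter.2 ⟨Finset.mem_of_mem_filter j hj, ?_⟩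
    obtain ⟨hj, hunstable, hsmall⟩ := Finset.mem_filter.1 hj
    exact ⟨(not_le.1 hunstable).trans_le
      (countLe_mono fun q h => hstep z hz j (Finset.mem_range.1 hj) q h), hsmall⟩
  calc _ ≤ _ := by exact_mod_cast Finset.card_le_card hsub
    _ ≤ Real.log (4 * (2 * b : ℕ)) := hdrops
    _ = _ := by push_cast; ring_nf

end Unstable

/-- The squared distance of the patches with offsets `O` around `p` and `q`. -/
def patchEnergy {V : Type*} [Add V] (O : Finset V) (y : V → ℝ) (p q : V) : ℝ :=
  ∑ l ∈ O, (y (p + l) - y (q + l)) ^ 2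

section PatchEnergy

lemma abs_sub_update_zero_le {V : Type*} [DecidableEq V] {K : ℝ} {z : V → ℝ} {q : V}
    (hq : z q ^ 2 ≤ K) (i : V) :
    |z i - Function.update z q 0 i| ≤ √K * if i = q then 1 else 0 := by
  by_cases h : i = q
  · subst h
    simpa using Real.abs_le_sqrt hq
  · simp [h]

lemma abs_update_zero_le {V : Type*} [DecidableEq V] {M : ℝ} {z : V → ℝ}
    (hz : ∀ i, |z i| ≤ M) (q i : V) :
    |Function.update z q 0 i| ≤ M := by
  by_cases h : i = q
  · subst h
    simpa using (abs_nonneg _).trans (hz i)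
  · simpa [h] using hz i

variable {V : Type*} [AddCommGroup V] {O : Finset V} {x : V → ℝ} {p q : V}

lemma measurable_patchEnergy (O : Finset V) (x : V → ℝ) (p q : V) :
    Measurable fun z => patchEnergy O (x + z) p q := by
  unfold patchEnergy
  simp only [Pi.add_apply]
  fun_prop

@[simp]
lemma patchEnergy_self (O : Finset V) (y : V → ℝ) (p : V) : patchEnergy O y p p = 0 := by
  simp [patchEnergy]

variable [DecidableEq V]

lemma patchEnergy_update {q' : V} (hq : q ∉ O.image (p + ·)) (hq' : q' ∉ O.image (q - ·))
    (z : V → ℝ) (c : ℝ) :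
    patchEnergy O (x + Function.update z q c) p q' = patchEnergy O (x + z) p q' := by
  refine Finset.sum_congr rfl fun l hl => ?_
  have hpl : p + l ≠ q := fun h => hq (Finset.mem_image.2 ⟨l, hl, h⟩)
  have hql : q' + l ≠ q := fun h => hq' (Finset.mem_image.2 ⟨l, hl, by rw [← h]; abel⟩)
  simp [Function.update_of_ne hpl, Function.update_of_ne hql]

lemma abs_sq_sub_sq_update_le (hx : ∀ i, x i ∈ Set.Icc (0 : ℝ) 1) {K M : ℝ} {z : V → ℝ}
    (hz : ∀ i, |z i| ≤ M) (hq : z q ^ 2 ≤ K) (q' l : V) :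
    |((x + z) (p + l) - (x + z) (q' + l)) ^ 2 -
      ((x + Function.update z q 0) (p + l) - (x + Function.update z q 0) (q' + l)) ^ 2| ≤
      4 * √K * (M + 1) * ((if l = q - p then 1 else 0) + if l = q - q' then 1 else 0) := by
  set z' := Function.update z q 0
  have hM : 0 ≤ M := (abs_nonneg _).trans (hz q)
  have hp : |z (p + l) - z' (p + l)| ≤ √K * if l = q - p then 1 else 0 := by
    simpa only [eq_sub_iff_add_eq, add_comm l] using abs_sub_update_zero_le hq (p + l)
  have hq' : |z (q' + l) - z' (q' + l)| ≤ √K * if l = q - q' then 1 else 0 := by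
    simpa only [eq_sub_iff_add_eq, add_comm l] using abs_sub_update_zero_le hq (q' + l)
  have hdiff (i : V) : |(x + z) i - (x + z) (q' + l)| ≤ 2 * M + 1 := by
    have hi := abs_le.1 (hz i)
    have hj := abs_le.1 (hz (q' + l))
    rw [Pi.add_apply, Pi.add_apply, abs_le]
    constructor <;> linarith [(hx i).1, (hx i).2, (hx (q' + l)).1, (hx (q' + l)).2]
  have hdiff' (i : V) : |(x + z') i - (x + z') (q' + l)| ≤ 2 * M + 1 := by
    have hi := abs_le.1 (abs_update_zero_le hz q i)
    have hj := abs_le.1 (abs_update_zero_le hz q (q' + l))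
    rw [Pi.add_apply, Pi.add_apply, abs_le]
    constructor <;> linarith [(hx i).1, (hx i).2, (hx (q' + l)).1, (hx (q' + l)).2]
  rw [sq_sub_sq, abs_mul]
  calc _ ≤ (2 * M + 1 + (2 * M + 1)) *
        (|z (p + l) - z' (p + l)| + |z (q' + l) - z' (q' + l)|) := by
        gcongr
        · exact (abs_add_le _ _).trans (add_le_add (hdiff _) (hdiff' _))
        · refine le_of_eq_of_le (congrArg _ ?_) (abs_sub _ _)
          simp only [Pi.add_apply]
          ring
    _ ≤ 4 * (M + 1) * (√K * (if l = q - p then 1 else 0) +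
          √K * if l = q - q' then 1 else 0) := by
        gcongr
        linarith
    _ = _ := by ring

lemma abs_patchEnergy_sub_update_le (hx : ∀ i, x i ∈ Set.Icc (0 : ℝ) 1) {K M : ℝ}
    {z : V → ℝ} (hz : ∀ i, |z i| ≤ M) (hq : z q ^ 2 ≤ K) (q' : V) :
    |patchEnergy O (x + z) p q' - patchEnergy O (x + Function.update z q 0) p q'| ≤
      8 * √K * (M + 1) := by
  have hM : 0 ≤ M := (abs_nonneg _).trans (hz q)
  have hite (P : Prop) [Decidable P] : (if P then (1 : ℝ) else 0) ≤ 1 := by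
    split_ifs <;> norm_num
  unfold patchEnergy
  rw [← Finset.sum_sub_distrib]
  calc _ ≤ ∑ l ∈ O, 4 * √K * (M + 1) *
        ((if l = q - p then 1 else 0) + if l = q - q' then 1 else 0) :=
        (Finset.abs_sum_le_sum_abs _ _).trans
          (Finset.sum_le_sum fun l _ => abs_sq_sub_sq_update_le hx hz hq q' l)
    _ ≤ 4 * √K * (M + 1) * (1 + 1) := by
        rw [← Finset.mul_sum, Finset.sum_add_distrib, Finset.sum_ite_eq', Finset.sum_ite_eq']
        gcongr <;> exact hite _
    _ = _ := by ring

/-- The derivative at `κ = 0` of half the patch distance when the noise in the patch around `p` is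
multiplied by `1 + κ`. -/
def scaleSlope (O : Finset V) (x : V → ℝ) (p q : V) (z : V → ℝ) : ℝ :=
  ∑ l ∈ O, (x (p + l) + z (p + l) - (x (q + l) + z (q + l))) *
    (z (p + l) - if q + l ∈ O.image (p + ·) then z (q + l) else 0)

lemma patchEnergy_scaleOn_eq (O : Finset V) (x : V → ℝ) (p q : V) (z : V → ℝ) (κ : ℝ) :
    patchEnergy O (x + scaleOn (O.image (p + ·)) κ z) p q =
      patchEnergy O (x + z) p q + 2 * κ * scaleSlope O x p q z + κ ^ 2 *
        ∑ l ∈ O, (z (p + l) - if q + l ∈ O.image (p + ·) then z (q + l) else 0) ^ 2 := by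
  unfold patchEnergy scaleSlope
  rw [Finset.mul_sum, Finset.mul_sum, ← Finset.sum_add_distrib, ← Finset.sum_add_distrib]
  refine Finset.sum_congr rfl fun l hl => ?_
  simp only [Pi.add_apply, scaleOn, Finset.mem_image_of_mem (p + ·) hl, if_true]
  split_ifs <;> ring

lemma patchEnergy_scaleOn_mono {z : V → ℝ} {m : ℝ} (hm : m ≤ scaleSlope O x p q z)
    {κ κ' : ℝ} (hκ : 0 ≤ κ) (hκ' : κ ≤ κ') :
    patchEnergy O (x + scaleOn (O.image (p + ·)) κ z) p q + 2 * (κ' - κ) * m ≤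
      patchEnergy O (x + scaleOn (O.image (p + ·)) κ' z) p q := by
  rw [patchEnergy_scaleOn_eq, patchEnergy_scaleOn_eq]
  have hlin := mul_le_mul_of_nonneg_left hm (sub_nonneg.2 hκ')
  have hquad := mul_le_mul_of_nonneg_right (by gcongr : κ ^ 2 ≤ κ' ^ 2) (Finset.sum_nonneg
    fun l (_ : l ∈ O) => sq_nonneg (z (p + l) - if q + l ∈ O.image (p + ·) then z (q + l) else 0))
  linarith

lemma measurable_scaleSlope (O : Finset V) (x : V → ℝ) (p q : V) :
    Measurable (scaleSlope O x p q) := by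
  refine Finset.measurable_sum _ fun l _ => Measurable.mul (by fun_prop) ?_
  split_ifs <;> fun_prop

lemma measurableSet_forall_ne_le_scaleSlope [Countable V] (O : Finset V) (x : V → ℝ) (p : V)
    (m : ℝ) : MeasurableSet {z | ∀ q ≠ p, m ≤ scaleSlope O x p q z} := by
  simp only [Set.ofPred_forall]
  exact MeasurableSet.iInter fun q => MeasurableSet.iInter fun _ =>
    measurableSet_le measurable_const (measurable_scaleSlope O x p q)

lemma scaleSlope_ge {z : V → ℝ} {s t : ℝ} {I : Finset V}
    (hI : I = O.filter (q + · ∈ O.image (p + ·)))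
    (hsq : t - 2 * s ≤ ∑ l ∈ O, z (p + l) ^ 2)
    (hp : |∑ l ∈ O, (x (p + l) - x (q + l)) * z (p + l)| ≤ s)
    (hq : |∑ l ∈ I, (x (p + l) - x (q + l)) * z (q + l)| ≤ s)
    (hpq : |∑ l ∈ O, z (p + l) * z (q + l)| ≤ s) (hpq' : |∑ l ∈ I, z (p + l) * z (q + l)| ≤ s) :
    t - 6 * s ≤ scaleSlope O x p q z := by
  have hexpand : scaleSlope O x p q z =
      ∑ l ∈ O, z (p + l) ^ 2 + ∑ l ∈ O, (x (p + l) - x (q + l)) * z (p + l) -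
      ∑ l ∈ I, (x (p + l) - x (q + l)) * z (q + l) - ∑ l ∈ O, z (p + l) * z (q + l) -
      ∑ l ∈ I, z (p + l) * z (q + l) + ∑ l ∈ I, z (q + l) ^ 2 := by
    rw [hI, Finset.sum_filter, Finset.sum_filter, Finset.sum_filter, ← Finset.sum_add_distrib,
      ← Finset.sum_sub_distrib, ← Finset.sum_sub_distrib, ← Finset.sum_sub_distrib,
      ← Finset.sum_add_distrib]
    refine Finset.sum_congr rfl fun l _ => ?_
    split_ifs <;> ring
  have hsq_nonneg : 0 ≤ ∑ l ∈ I, z (q + l) ^ 2 := Finset.sum_nonneg fun _ _ => sq_nonneg _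
  linarith [(abs_le.1 hp).1, (abs_le.1 hq).2, (abs_le.1 hpq).2, (abs_le.1 hpq').2]

lemma setOf_scaleSlope_lt_subset {σ : ℝ} {I : Finset V}
    (hI : I = O.filter (q + · ∈ O.image (p + ·))) :
    {z | scaleSlope O x p q z < σ ^ 2 * O.card / 4} ⊆
      {z : V → ℝ | 1 / 4 * σ ^ 2 * O.card ≤ |∑ l ∈ O, z (p + l) ^ 2 - σ ^ 2 * O.card|} ∪
      {z | σ / 8 * σ * O.card ≤ |∑ l ∈ O, (x (p + l) - x (q + l)) * z (p + l)|} ∪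
      {z | σ / 8 * σ * O.card ≤ |∑ l ∈ I, (x (p + l) - x (q + l)) * z (q + l)|} ∪
      {z | 1 / 8 * σ ^ 2 * O.card ≤ |∑ l ∈ O, z (p + l) * z (q + l)|} ∪
      {z | 1 / 8 * σ ^ 2 * O.card ≤ |∑ l ∈ I, z (p + l) * z (q + l)|} := by
  intro z hz
  by_contra hcon
  simp only [Set.mem_union, Set.mem_ofPred_eq, not_or, not_le] at hcon hz
  obtain ⟨⟨⟨⟨hsq, hp⟩, hq⟩, hmul⟩, hmul'⟩ := hcon
  have := scaleSlope_ge (x := x) (z := z) (s := σ ^ 2 * O.card / 8)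
    (t := σ ^ 2 * O.card) hI (by linarith [(abs_lt.1 hsq).1])
    (by linarith) (by linarith) (by linarith) (by linarith)
  linarith

lemma gaussNoise_scaleSlope_lt_le [Fintype V] {σ : ℝ} (hσ : 0 < σ) (hO : ShiftBicolorable O)
    (hx : ∀ i, x i ∈ Set.Icc (0 : ℝ) 1) (hpq : p ≠ q) :
    gaussNoise V σ {z | scaleSlope O x p q z < σ ^ 2 * O.card / 4} ≤
      ENNReal.ofReal (14 * Real.exp (-(min 1 (σ ^ 2) * O.card / 1024))) := by
  set I := O.filter (q + · ∈ O.image (p + ·)) with hI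
  have hIsub : I ⊆ O := Finset.filter_subset _ _
  have hc (l : V) : |x (p + l) - x (q + l)| ≤ 1 :=
    (abs_sub_le_of_nonneg_of_le (hx _).1 (hx _).2 (hx _).1 (hx _).2)
  have hexp {C τ a : ℝ} (hC : 0 ≤ C) (hτ : min 1 (σ ^ 2) / 1024 ≤ τ ^ 2 / a) :
      ENNReal.ofReal (C * Real.exp (-(τ ^ 2 * O.card / a))) ≤
        ENNReal.ofReal (C * Real.exp (-(min 1 (σ ^ 2) * O.card / 1024))) := by
    refine ENNReal.ofReal_le_ofReal ?_
    gcongr C * Real.exp (-?_)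
    rw [mul_div_right_comm, mul_div_right_comm]
    gcongr
  have hmin_one : min 1 (σ ^ 2) ≤ 1 := min_le_left _ _
  have hmin_sq : min 1 (σ ^ 2) ≤ σ ^ 2 := min_le_right _ _
  have hsq := (gaussNoise_abs_sum_sq_sub_ge_le hσ (add_right_injective p).injOn le_rfl
    (τ := 1 / 4) (by norm_num) (by norm_num)).trans (hexp zero_le_two (by linarith))
  have hp := (gaussNoise_abs_sum_mul_const_ge_le hσ (add_right_injective p).injOn le_rfl
    (fun l _ => hc l) (by positivity : 0 ≤ σ / 8)).trans
    (hexp zero_le_two (by linarith [sq_nonneg σ]))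
  have hq := (gaussNoise_abs_sum_mul_const_ge_le hσ (add_right_injective q).injOn
    (Finset.card_le_card hIsub) (fun l _ => hc l) (by positivity : 0 ≤ σ / 8)).trans
    (hexp zero_le_two (by linarith [sq_nonneg σ]))
  have hmul := (gaussNoise_abs_sum_mul_ge_le hσ hO hpq subset_rfl le_rfl (τ := 1 / 8)
    (by norm_num) (by norm_num)).trans (hexp zero_le_four (by linarith))
  have hmul' := (gaussNoise_abs_sum_mul_ge_le hσ hO hpq hIsub (Finset.card_le_card hIsub)
    (τ := 1 / 8) (by norm_num) (by norm_num)).trans (hexp zero_le_four (by linarith))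
  grw [setOf_scaleSlope_lt_subset hI, measure_union_le, measure_union_le, measure_union_le,
    measure_union_le, hsq, hp, hq, hmul, hmul']
  refine le_of_eq ?_
  rw [← ENNReal.ofReal_add, ← ENNReal.ofReal_add, ← ENNReal.ofReal_add, ← ENNReal.ofReal_add]
  · ring_nf
  all_goals positivity

end PatchEnergy

section Variance

variable {V : Type*} [AddCommGroup V] [Fintype V] {O : Finset V} {x : V → ℝ}
  {p : V} {σ K : ℝ}

lemma gaussNoise_compl_le_sum_sq_le (hσ : 0 < σ) (hO : 0 < O.card) (hK : 0 ≤ K)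
    (hKO : K ≤ √O.card) (p : V) :
    gaussNoise V σ {z | σ ^ 2 * O.card - σ ^ 2 * K * √O.card ≤ ∑ l ∈ O, z (p + l) ^ 2}ᶜ ≤
      ENNReal.ofReal (2 * Real.exp (-(K ^ 2 / 16))) := by
  have hcard : (0 : ℝ) < O.card := Nat.cast_pos.2 hO
  have hsqrt : 0 < √O.card := Real.sqrt_pos.2 hcard
  have hdev : K / √O.card * σ ^ 2 * O.card = σ ^ 2 * K * √O.card := by
    nth_rewrite 2 [← Real.mul_self_sqrt hcard.le]
    field_simp
  have hexponent : (K / √O.card) ^ 2 * O.card / 16 = K ^ 2 / 16 := by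
    rw [div_pow, Real.sq_sqrt hcard.le, div_mul_cancel₀ _ hcard.ne']
  rw [← hexponent]
  refine (measure_mono fun z hz => ?_).trans (gaussNoise_abs_sum_sq_sub_ge_le hσ
    (add_right_injective p).injOn le_rfl (by positivity) ((div_le_one hsqrt).2 hKO))
  simp only [Set.mem_compl_iff, Set.mem_ofPred_eq, not_le] at hz ⊢
  rw [hdev, le_abs]
  right
  linarith

lemma gaussNoise_compl_forall_ne_le_scaleSlope_le [DecidableEq V] (hσ : 0 < σ)
    (hO : ShiftBicolorable O) (hx : ∀ i, x i ∈ Set.Icc (0 : ℝ) 1) (p : V) :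
    gaussNoise V σ {z | ∀ q ≠ p, σ ^ 2 * O.card / 4 ≤ scaleSlope O x p q z}ᶜ ≤
      ENNReal.ofReal (Fintype.card V *
        (14 * Real.exp (-(min 1 (σ ^ 2) * O.card / 1024)))) := by
  calc _ ≤ gaussNoise V σ (⋃ q, {z | q ≠ p ∧ scaleSlope O x p q z < σ ^ 2 * O.card / 4}) := by
        refine measure_mono fun z hz => ?_
        simpa using hz
    _ ≤ ∑ q, gaussNoise V σ {z | q ≠ p ∧ scaleSlope O x p q z < σ ^ 2 * O.card / 4} :=
        measure_iUnion_fintype_le _ _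
    _ ≤ ∑ _q : V, ENNReal.ofReal (14 * Real.exp (-(min 1 (σ ^ 2) * O.card / 1024))) := by
        refine Finset.sum_le_sum fun q _ => ?_
        by_cases hq : q = p
        · simp [hq]
        · exact (measure_mono fun z hz => hz.2).trans
            (gaussNoise_scaleSlope_lt_le hσ hO hx (Ne.symm hq))
    _ = _ := by
        rw [Finset.sum_const, Finset.card_univ, nsmul_eq_mul,
          ENNReal.ofReal_mul (p := (Fintype.card V : ℝ)) (by positivity), ENNReal.ofReal_natCast]

lemma scale_exponent_le_three (hσ : 0 < σ) {κ N : ℝ} (hκ : 0 ≤ κ) (hN : 0 ≤ N) (hK : 1 ≤ K)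
    (hκK : κ * K * √N ≤ 1) :
    κ * (σ ^ 2 * K * √N) / σ ^ 2 + 2 * κ ^ 2 * N ≤ 3 := by
  have hκN : κ * √N ≤ 1 := by nlinarith [mul_nonneg hκ (Real.sqrt_nonneg N)]
  calc κ * (σ ^ 2 * K * √N) / σ ^ 2 + 2 * κ ^ 2 * N = κ * K * √N + 2 * (κ * √N) ^ 2 := by
        rw [mul_pow, Real.sq_sqrt hN]
        field_simp
    _ ≤ 1 + 2 * 1 ^ 2 := by gcongr
    _ = 3 := by norm_num

lemma gaussNoise_le_exp_three_mul_scaleOn_preimage [DecidableEq V] (hσ : 0 < σ) {κ : ℝ} (hκ : 0 ≤ κ)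
    (hK : 1 ≤ K) (hκK : κ * K * √O.card ≤ 1) (p : V) {B : Set (V → ℝ)} (hB : MeasurableSet B)
    (hsub : B ⊆ {z | σ ^ 2 * O.card - σ ^ 2 * K * √O.card ≤ ∑ l ∈ O, z (p + l) ^ 2}) :
    gaussNoise V σ B ≤
      ENNReal.ofReal (Real.exp 3) * gaussNoise V σ (scaleOn (O.image (p + ·)) κ ⁻¹' B) := by
  have hcard : (O.image (p + ·)).card = O.card :=
    Finset.card_image_of_injective _ (add_right_injective p)
  refine (gaussNoise_le_mul_scaleOn_preimage hσ (O.image (p + ·)) hκ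
    (X := σ ^ 2 * K * √O.card) (by positivity) hB fun z hz => ?_).trans ?_
  · rw [hcard, Finset.sum_image fun a _ b _ h => add_left_cancel h]
    exact hsub hz
  · rw [hcard]
    gcongr
    exact scale_exponent_le_three hσ hκ (Nat.cast_nonneg _) hK hκK

lemma mul_gaussNoise_unstableSet_patchEnergy_le (hσ : 0 < σ) (hO : ShiftBicolorable O)
    (hx : ∀ i, x i ∈ Set.Icc (0 : ℝ) 1) {v H : ℝ} {J : ℕ} (hv : 0 ≤ v)
    (hK : 1 ≤ K) (hH : 0 ≤ H) (hKO : K ≤ √O.card)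
    (hstep : J * (2 * H / (σ ^ 2 * O.card)) * K * √O.card ≤ 1) (p : V) :
    J * gaussNoise V σ (unstableSet (fun q z => patchEnergy O (x + z) p q) v H O.card) ≤
      J * ENNReal.ofReal (2 * Real.exp (-(K ^ 2 / 16))) +
        ENNReal.ofReal (Real.exp 3) * (ENNReal.ofReal (Real.log (8 * O.card)) +
          J * ENNReal.ofReal (Fintype.card V *
            (14 * Real.exp (-(min 1 (σ ^ 2) * O.card / 1024))))) := by
  classical
  have hcard : 0 < (O.card : ℝ) := Real.sqrt_pos.1 (by linarith)
  set κ₁ := 2 * H / (σ ^ 2 * O.card) with hκ₁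
  refine (mul_measure_unstableSet_le (fun q => measurable_patchEnergy O x p q)
    (Nat.cast_pos.1 hcard) hH (Φ := fun j => scaleOn (O.image (p + ·)) (j * κ₁))
    (fun j => measurable_scaleOn _ _)
    (A := {z | σ ^ 2 * O.card - σ ^ 2 * K * √O.card ≤ ∑ l ∈ O, z (p + l) ^ 2})
    (measurableSet_le measurable_const (by fun_prop))
    (measurableSet_forall_ne_le_scaleSlope O x p _) (c := ENNReal.ofReal (Real.exp 3)) ?_ ?_
    fun z => ⟨p, by simpa using hv⟩).trans (by
      gcongr
      · exact gaussNoise_compl_le_sum_sq_le hσ (Nat.cast_pos.1 hcard) (by linarith) hKO p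
      · exact gaussNoise_compl_forall_ne_le_scaleSlope_le hσ hO hx p)
  · intro j hj B hBm hBA
    have hjJ : ((j + 1 : ℕ) : ℝ) ≤ J := Nat.cast_le.2 hj
    refine gaussNoise_le_exp_three_mul_scaleOn_preimage hσ (by positivity) hK
      (le_trans ?_ hstep) p hBm hBA
    gcongr
  · intro z hz j _ q hle
    rcases eq_or_ne q p with rfl | hq
    · simpa using hv
    have hgrow := patchEnergy_scaleOn_mono (hz q hq) (κ := j * κ₁) (κ' := (j + 1 : ℕ) * κ₁)
      (by positivity) (by gcongr; simp)
    have hincrement : 2 * (((j + 1 : ℕ) : ℝ) * κ₁ - j * κ₁) * (σ ^ 2 * O.card / 4) = H := by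
      rw [hκ₁]
      push_cast
      field_simp
      ring
    linarith

/-- Admissible scales for the variance bound with noise level `σ`, in an array of `T` sites and for
patches of `N` offsets: a site is typical if its squared noise is at most `K`, an array is typical
if its noise is at most `M`, and `J` is the number of dilations of the noise that are compared. The
inequalities make each error term of the bound at most an absolute constant. -/
structure VarianceScales (σ T N K M : ℝ) (J : ℕ) : Prop where
  one_le : 1 ≤ K
  nonneg : 0 ≤ M
  pos : 0 < J
  le_sqrt : K ≤ √N
  dilation_le : J * (2 * (4 * (8 * √K * (M + 1))) / (σ ^ 2 * N)) * K * √N ≤ 1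
  atypical_le : 2 * Real.exp (-K / (4 * σ ^ 2)) ≤ 1 / 2
  tail_le : 64 * σ ^ 2 * N * Real.exp (-K / (8 * σ ^ 2)) ≤ 1
  sup_le : T * (T * (2 * Real.exp (-M ^ 2 / (4 * σ ^ 2)))) ≤ 1
  mul_sup_le : K * (T * (2 * Real.exp (-M ^ 2 / (4 * σ ^ 2)))) ≤ 1
  concentration_le : K * (2 * Real.exp (-(K ^ 2 / 16))) ≤ 1
  log_le : K * Real.exp 3 * Real.log (8 * N) ≤ J
  slope_le : K * Real.exp 3 * (T * (14 * Real.exp (-(min 1 (σ ^ 2) * N / 1024)))) ≤ 1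

lemma half_le_gaussianReal_sq_le (hσ : 0 < σ)
    (hK : 2 * Real.exp (-K / (4 * σ ^ 2)) ≤ 1 / 2) :
    1 / 2 ≤ gaussianReal 0 (σ ^ 2).toNNReal {x | x ^ 2 ≤ K} := by
  have hmeas : MeasurableSet {x : ℝ | x ^ 2 ≤ K} := measurableSet_le (by fun_prop) (by fun_prop)
  have hcompl : gaussianReal 0 (σ ^ 2).toNNReal {x : ℝ | x ^ 2 ≤ K}ᶜ ≤ 1 / 2 := by
    rw [show {x : ℝ | x ^ 2 ≤ K}ᶜ = {x | K < x ^ 2} by ext; simp]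
    refine (gaussianReal_lt_sq_le hσ K).trans ((ENNReal.ofReal_le_ofReal hK).trans_eq ?_)
    rw [one_div, one_div, ENNReal.ofReal_inv_of_pos (by norm_num), ENNReal.ofReal_ofNat]
  rw [prob_compl_eq_one_sub hmeas, tsub_le_iff_right] at hcompl
  rw [← ENNReal.sub_half ENNReal.one_ne_top]
  exact tsub_le_iff_left.2 hcompl

lemma ofReal_mul_le_one {a b : ℝ} {c : ℝ≥0∞} (ha : 0 ≤ a) (hc : c ≤ ENNReal.ofReal b)
    (hab : a * b ≤ 1) : ENNReal.ofReal a * c ≤ 1 := by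
  calc ENNReal.ofReal a * c ≤ ENNReal.ofReal a * ENNReal.ofReal b := by gcongr
    _ = ENNReal.ofReal (a * b) := (ENNReal.ofReal_mul ha).symm
    _ ≤ 1 := ENNReal.ofReal_le_one.2 hab

variable {M : ℝ} {J : ℕ}

lemma mul_gaussNoise_unstableSet_patchEnergy_le_three (hσ : 0 < σ) (hO : ShiftBicolorable O)
    (hx : ∀ i, x i ∈ Set.Icc (0 : ℝ) 1) {v : ℝ} (hv : 0 ≤ v)
    (hs : VarianceScales σ (Fintype.card V) O.card K M J) (p : V) :
    ENNReal.ofReal K * gaussNoise V σ (unstableSet (fun q z => patchEnergy O (x + z) p q) v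
      (4 * (8 * √K * (M + 1))) O.card) ≤ 3 := by
  have hM := hs.nonneg
  have hK := zero_le_one.trans hs.one_le
  have hJ : (J : ℝ≥0∞) ≠ 0 := Nat.cast_ne_zero.2 hs.pos.ne'
  have hunstable := mul_gaussNoise_unstableSet_patchEnergy_le hσ hO hx hv hs.one_le
    (H := 4 * (8 * √K * (M + 1))) (by positivity) hs.le_sqrt hs.dilation_le p
  set u := gaussNoise V σ (unstableSet (fun q z => patchEnergy O (x + z) p q) v
    (4 * (8 * √K * (M + 1))) O.card)
  have hconc := ofReal_mul_le_one hK le_rfl hs.concentration_le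
  have hslope := ofReal_mul_le_one (mul_nonneg hK (Real.exp_nonneg 3)) le_rfl hs.slope_le
  have hlog : ENNReal.ofReal (K * Real.exp 3) * ENNReal.ofReal (Real.log (8 * O.card)) ≤ J := by
    rw [← ENNReal.ofReal_mul (by positivity), ← ENNReal.ofReal_natCast]
    exact ENNReal.ofReal_le_ofReal hs.log_le
  rw [← ENNReal.mul_le_mul_iff_right hJ (ENNReal.natCast_ne_top J)]
  rw [ENNReal.ofReal_mul hK] at hslope hlog
  calc J * (ENNReal.ofReal K * u) = ENNReal.ofReal K * (J * u) := by ring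
    _ ≤ ENNReal.ofReal K * _ := mul_le_mul_right hunstable _
    _ = J * (ENNReal.ofReal K * ENNReal.ofReal (2 * Real.exp (-(K ^ 2 / 16)))) +
        ENNReal.ofReal K * ENNReal.ofReal (Real.exp 3) *
          ENNReal.ofReal (Real.log (8 * O.card)) +
        J * (ENNReal.ofReal K * ENNReal.ofReal (Real.exp 3) * ENNReal.ofReal (Fintype.card V *
          (14 * Real.exp (-(min 1 (σ ^ 2) * O.card / 1024))))) := by ring
    _ ≤ J * 1 + J + J * 1 := by gcongr
    _ = J * 3 := by ring

lemma card_mul_setLIntegral_sq_gaussianReal_le (hσ : 0 < σ) {N : ℕ}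
    (hK : 64 * σ ^ 2 * N * Real.exp (-K / (8 * σ ^ 2)) ≤ 1) :
    (4 * N : ℕ) * ∫⁻ x in {x | x ^ 2 ≤ K}ᶜ, ENNReal.ofReal (x ^ 2)
      ∂gaussianReal 0 (σ ^ 2).toNNReal ≤ 1 := by
  rw [← ENNReal.ofReal_natCast]
  refine ofReal_mul_le_one (Nat.cast_nonneg _) (setLIntegral_sq_gaussianReal_le hσ K)
    (le_of_eq_of_le ?_ hK)
  push_cast
  ring

lemma sum_lintegral_sq_selWeight_patchEnergy_le (hσ : 0 < σ) (hO : ShiftBicolorable O)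
    (h0 : (0 : V) ∉ O) (hx : ∀ i, x i ∈ Set.Icc (0 : ℝ) 1) {v : ℝ} (hv : 0 ≤ v)
    (hs : VarianceScales σ (Fintype.card V) O.card K M J) (p : V) :
    ∑ q, ∫⁻ z, ENNReal.ofReal (z q ^ 2) *
      selWeight (fun q z => patchEnergy O (x + z) p q) v q z ∂gaussNoise V σ ≤
      ENNReal.ofReal (43 * σ ^ 2 + 5) := by
  classical
  have hK := zero_le_one.trans hs.one_le
  have hcard : 0 < O.card :=
    Nat.cast_pos.1 (Real.sqrt_pos.1 (zero_lt_one.trans_le (hs.one_le.trans hs.le_sqrt)))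
  have hself (q : V) : q ∉ O.image (q - ·) := by simpa using h0
  have hsup := gaussNoise_compl_forall_abs_le_le (V := V) hσ hs.nonneg
  have hKsup := ofReal_mul_le_one hK hsup hs.mul_sup_le
  have hTsup := ofReal_mul_le_one (Nat.cast_nonneg _) hsup hs.sup_le
  rw [ENNReal.ofReal_natCast] at hTsup
  refine (sum_lintegral_eval_mul_selWeight_le (fun q => measurable_patchEnergy O x p q) hcard
    Finset.card_image_le (fun q => Finset.card_image_le)
    (fun q hq z c => patchEnergy_update hq (hself q) z c)
    (fun q hq q' hq' z c => patchEnergy_update hq hq' z c) (measurableSet_forall_abs_le M)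
    (measurableSet_le (by fun_prop) measurable_const)
    (half_le_gaussianReal_sq_le hσ hs.atypical_le)
    (fun q z hz hzq q' => abs_patchEnergy_sub_update_le hx hz hzq q') (by fun_prop)
    fun y hy => ENNReal.ofReal_le_ofReal hy).trans ?_
  rw [lintegral_sq_gaussianReal, mul_add (ENNReal.ofReal K)]
  calc _ ≤ 3 * ENNReal.ofReal (σ ^ 2) + 1 + 8 * ENNReal.ofReal (σ ^ 2) * (4 + 1) + (1 + 3) :=
        add_le_add (add_le_add (add_le_add le_rfl
          (card_mul_setLIntegral_sq_gaussianReal_le hσ hs.tail_le)) (by gcongr; exact hTsup))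
          (add_le_add hKsup (mul_gaussNoise_unstableSet_patchEnergy_le_three hσ hO hx hv hs p))
    _ = 43 * ENNReal.ofReal (σ ^ 2) + 5 := by ring
    _ = _ := by
        rw [ENNReal.ofReal_add (by positivity) (by norm_num), ENNReal.ofReal_mul (by norm_num),
          ENNReal.ofReal_ofNat, ENNReal.ofReal_ofNat]

end Variance

/-- The points whose patch in `y` has squared distance at most `v` from the patch around `p`. -/
noncomputable def similarPoints {V : Type*} [Fintype V] [Add V] (O : Finset V) (v : ℝ) (y : V → ℝ)
    (p : V) : Finset V :=
  Finset.univ.filter (patchEnergy O y p · ≤ v)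

/-- The average of the values of `y` at the points whose patch is similar to the one around `p`:
nonlocal means for an arbitrary set of offsets and an unnormalised threshold. -/
noncomputable def patchMean {V : Type*} [Fintype V] [Add V] (O : Finset V) (v : ℝ) (y : V → ℝ)
    (p : V) : ℝ :=
  (∑ q ∈ similarPoints O v y p, y q) / (similarPoints O v y p).card

/-- The noise configurations for which all patch sums of the noise, of its square, and of the
products of two of its translates are close to their means. -/
def concentrated {V : Type*} [Add V] (O : Finset V) (σ τ : ℝ) : Set (V → ℝ) :=
  {z | (∀ p, |∑ l ∈ O, z (p + l) ^ 2 - σ ^ 2 * O.card| < τ * σ ^ 2 * O.card) ∧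
    (∀ p, |∑ l ∈ O, z (p + l)| < τ * σ * O.card) ∧
    ∀ p q, p ≠ q → |∑ l ∈ O, z (p + l) * z (q + l)| < τ * σ ^ 2 * O.card}

section PatchMean

variable {V : Type*} [AddCommGroup V] [Fintype V] {O : Finset V} {x : V → ℝ} {v σ τ K : ℝ}

lemma mem_similarPoints {y : V → ℝ} {p q : V} :
    q ∈ similarPoints O v y p ↔ patchEnergy O y p q ≤ v := by
  simp [similarPoints]

lemma self_mem_similarPoints (hv : 0 ≤ v) (y : V → ℝ) (p : V) : p ∈ similarPoints O v y p := by
  simpa [mem_similarPoints] using hv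

lemma sub_patchMean_eq (hv : 0 ≤ v) (y : V → ℝ) (p : V) (a : ℝ) :
    a - patchMean O v y p =
      (∑ q ∈ similarPoints O v y p, (a - y q)) / (similarPoints O v y p).card := by
  have hpos : 0 < (similarPoints O v y p).card :=
    Finset.card_pos.2 ⟨p, self_mem_similarPoints hv y p⟩
  rw [patchMean, Finset.sum_sub_distrib, Finset.sum_const, nsmul_eq_mul, sub_div,
    mul_div_cancel_left₀ _ (by positivity)]

lemma measurable_patchMean (O : Finset V) (v : ℝ) (x : V → ℝ) (p : V) :
    Measurable fun z => patchMean O v (x + z) p := by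
  have hsum (f : V → (V → ℝ) → ℝ) (hf : ∀ q, Measurable (f q)) :
      Measurable fun z => ∑ q ∈ similarPoints O v (x + z) p, f q z := by
    simp only [similarPoints, Finset.sum_filter]
    exact Finset.measurable_sum _ fun q _ => (hf q).ite
      (measurableSet_le (measurable_patchEnergy O x p q) measurable_const) measurable_const
  refine Measurable.div (hsum _ fun q => ?_) ?_
  · simp only [Pi.add_apply]
    fun_prop
  · simpa using hsum (fun _ _ => 1) fun _ => measurable_const

lemma sq_sub_add_le {V : Type*} {x : V → ℝ} (hx : ∀ i, x i ∈ Set.Icc (0 : ℝ) 1) (z : V → ℝ)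
    (p q : V) :
    (x p - (x + z) q) ^ 2 ≤ 2 * (1 + z q ^ 2) := by
  have hdiff : (x p - x q) ^ 2 ≤ 1 := by
    rw [sq_le_one_iff_abs_le_one, abs_le]
    constructor <;> linarith [(hx p).1, (hx p).2, (hx q).1, (hx q).2]
  rw [Pi.add_apply]
  linarith [sq_nonneg (x p - x q + z q)]

lemma sq_sub_patchMean_le (hx : ∀ i, x i ∈ Set.Icc (0 : ℝ) 1) (hv : 0 ≤ v) (p : V) (z : V → ℝ) :
    (x p - patchMean O v (x + z) p) ^ 2 ≤ 2 + 2 * ((∑ q ∈ similarPoints O v (x + z) p, z q ^ 2) *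
      ((similarPoints O v (x + z) p).card : ℝ)⁻¹) := by
  have hpos : 0 < (similarPoints O v (x + z) p).card :=
    Finset.card_pos.2 ⟨p, self_mem_similarPoints hv (x + z) p⟩
  rw [sub_patchMean_eq hv, div_pow, div_le_iff₀ (by positivity)]
  set W := similarPoints O v (x + z) p
  calc (∑ q ∈ W, (x p - (x + z) q)) ^ 2 ≤ W.card * ∑ q ∈ W, (x p - (x + z) q) ^ 2 :=
        sq_sum_le_card_mul_sum_sq
    _ ≤ W.card * ∑ q ∈ W, 2 * (1 + z q ^ 2) := by
        gcongr with q
        exact sq_sub_add_le hx z p q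
    _ = _ := by
        rw [← Finset.mul_sum, Finset.sum_add_distrib, Finset.sum_const, nsmul_eq_mul, mul_one]
        field_simp

lemma ofReal_sq_sub_patchMean_le (hx : ∀ i, x i ∈ Set.Icc (0 : ℝ) 1) (hv : 0 ≤ v) (p : V)
    (z : V → ℝ) :
    ENNReal.ofReal ((x p - patchMean O v (x + z) p) ^ 2) ≤ 2 + 2 * ∑ q, ENNReal.ofReal (z q ^ 2) *
      selWeight (fun q z => patchEnergy O (x + z) p q) v q z := by
  set W := similarPoints O v (x + z) p with hW
  have hcard : (0 : ℝ) < W.card :=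
    Nat.cast_pos.2 (Finset.card_pos.2 ⟨p, self_mem_similarPoints hv (x + z) p⟩)
  have hweights : ∑ q, ENNReal.ofReal (z q ^ 2) *
      selWeight (fun q z => patchEnergy O (x + z) p q) v q z =
      ENNReal.ofReal ((∑ q ∈ W, z q ^ 2) * (W.card : ℝ)⁻¹) := by
    rw [ENNReal.ofReal_mul (Finset.sum_nonneg fun _ _ => sq_nonneg _),
      ENNReal.ofReal_sum_of_nonneg fun _ _ => sq_nonneg _, Finset.sum_mul, hW, similarPoints,
      Finset.sum_filter, ENNReal.ofReal_inv_of_pos (by simpa only [hW, similarPoints] using hcard),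
      ENNReal.ofReal_natCast]
    simp only [selWeight, countLe, mul_ite, mul_zero]
  rw [hweights]
  refine (ENNReal.ofReal_le_ofReal (sq_sub_patchMean_le hx hv p z)).trans_eq ?_
  rw [ENNReal.ofReal_add (by norm_num) (by positivity), ENNReal.ofReal_mul (by norm_num),
    ENNReal.ofReal_ofNat]

lemma ofReal_sq_sub_patchMean_le_add_sum_indicator (hx : ∀ i, x i ∈ Set.Icc (0 : ℝ) 1)
    (hv : 0 ≤ v) (hK : 0 ≤ K) (p : V) (z : V → ℝ) :
    ENNReal.ofReal ((x p - patchMean O v (x + z) p) ^ 2) ≤ ENNReal.ofReal (2 + 2 * K) +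
      2 * ∑ q, {y : ℝ | y ^ 2 ≤ K}ᶜ.indicator (fun y => ENNReal.ofReal (y ^ 2)) (z q) := by
  set w := selWeight (fun q z => patchEnergy O (x + z) p q) v
  have hterm (q : V) : ENNReal.ofReal (z q ^ 2) * w q z ≤ ENNReal.ofReal K * w q z +
      {y : ℝ | y ^ 2 ≤ K}ᶜ.indicator (fun y => ENNReal.ofReal (y ^ 2)) (z q) := by
    by_cases hq : z q ^ 2 ≤ K
    · exact le_add_right (by gcongr)
    · rw [Set.indicator_of_mem (by simpa using hq)]
      exact (mul_le_of_le_one_right' (selWeight_le_one _ _)).trans le_add_self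
  calc _ ≤ 2 + 2 * ∑ q, ENNReal.ofReal (z q ^ 2) * w q z := ofReal_sq_sub_patchMean_le hx hv p z
    _ ≤ 2 + 2 * (ENNReal.ofReal K * ∑ q, w q z +
        ∑ q, {y : ℝ | y ^ 2 ≤ K}ᶜ.indicator (fun y => ENNReal.ofReal (y ^ 2)) (z q)) := by
        rw [Finset.mul_sum (f := fun q => w q z), ← Finset.sum_add_distrib]
        gcongr with q
        exact hterm q
    _ ≤ 2 + 2 * (ENNReal.ofReal K * 1 +
        ∑ q, {y : ℝ | y ^ 2 ≤ K}ᶜ.indicator (fun y => ENNReal.ofReal (y ^ 2)) (z q)) := by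
        gcongr
        exact sum_selWeight_le_one z
    _ = _ := by
        rw [ENNReal.ofReal_add (by norm_num) (by positivity), ENNReal.ofReal_mul (by norm_num),
          ENNReal.ofReal_ofNat]
        ring

lemma lintegral_sq_sub_patchMean_le (hx : ∀ i, x i ∈ Set.Icc (0 : ℝ) 1) (hv : 0 ≤ v) (p : V)
    {D : ℝ} (hD : 0 ≤ D) (hvar : ∑ q, ∫⁻ z, ENNReal.ofReal (z q ^ 2) *
      selWeight (fun q z => patchEnergy O (x + z) p q) v q z ∂gaussNoise V σ ≤ ENNReal.ofReal D) :
    ∫⁻ z, ENNReal.ofReal ((x p - patchMean O v (x + z) p) ^ 2) ∂gaussNoise V σ ≤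
      ENNReal.ofReal (2 + 2 * D) := by
  have hm (q : V) : Measurable fun z : V → ℝ => ENNReal.ofReal (z q ^ 2) *
      selWeight (fun q z => patchEnergy O (x + z) p q) v q z :=
    Measurable.mul (by fun_prop) (measurable_selWeight (measurable_patchEnergy O x p) v q)
  calc _ ≤ ∫⁻ z, 2 + 2 * ∑ q, ENNReal.ofReal (z q ^ 2) *
          selWeight (fun q z => patchEnergy O (x + z) p q) v q z ∂gaussNoise V σ :=
        lintegral_mono fun z => ofReal_sq_sub_patchMean_le hx hv p z
    _ = 2 + 2 * ∑ q, ∫⁻ z, ENNReal.ofReal (z q ^ 2) *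
          selWeight (fun q z => patchEnergy O (x + z) p q) v q z ∂gaussNoise V σ := by
        rw [lintegral_add_left measurable_const, lintegral_const, measure_univ, mul_one,
          lintegral_const_mul _ (Finset.measurable_sum _ fun q _ => hm q),
          lintegral_finsetSum _ fun q _ => hm q]
    _ ≤ 2 + 2 * ENNReal.ofReal D := by gcongr
    _ = _ := by
        rw [ENNReal.ofReal_add (by norm_num) (by positivity), ENNReal.ofReal_mul (by norm_num),
          ENNReal.ofReal_ofNat]

end PatchMean

section Concentrated

variable {V : Type*} [AddCommGroup V] {O : Finset V} {x : V → ℝ} {v σ τ : ℝ}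

lemma patchEnergy_add_eq {p q : V} {c : ℝ} (hc : ∀ l ∈ O, x (p + l) - x (q + l) = c)
    (z : V → ℝ) :
    patchEnergy O (x + z) p q = c ^ 2 * O.card + 2 * c * (∑ l ∈ O, z (p + l) - ∑ l ∈ O, z (q + l)) +
      ∑ l ∈ O, z (p + l) ^ 2 + ∑ l ∈ O, z (q + l) ^ 2 - 2 * ∑ l ∈ O, z (p + l) * z (q + l) := by
  have hsq : ∀ l ∈ O, ((x + z) (p + l) - (x + z) (q + l)) ^ 2 = c ^ 2 +
      2 * c * (z (p + l) - z (q + l)) + z (p + l) ^ 2 + z (q + l) ^ 2 -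
      2 * (z (p + l) * z (q + l)) := by
    intro l hl
    rw [← hc l hl]
    simp only [Pi.add_apply]
    ring
  rw [patchEnergy, Finset.sum_congr rfl hsq]
  simp only [Finset.sum_sub_distrib, Finset.sum_add_distrib, Finset.sum_const, nsmul_eq_mul,
    ← Finset.mul_sum]
  ring

lemma patchEnergy_le_of_concentrated {p q : V} {z : V → ℝ} (hz : z ∈ concentrated O σ τ)
    (hv : 0 ≤ v) (hle : O.card * (2 * σ ^ 2 + 4 * τ * σ ^ 2) ≤ v)
    (hx : ∀ l ∈ O, x (p + l) = x (q + l)) : patchEnergy O (x + z) p q ≤ v := by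
  rcases eq_or_ne p q with rfl | hpq
  · simpa using hv
  rw [patchEnergy_add_eq (c := 0) fun l hl => by rw [hx l hl, sub_self]]
  linarith [(abs_lt.1 (hz.1 p)).2, (abs_lt.1 (hz.1 q)).2, (abs_lt.1 (hz.2.2 p q hpq)).1]

lemma lt_patchEnergy_of_concentrated {p q : V} {z : V → ℝ} (hz : z ∈ concentrated O σ τ)
    (hpq : p ≠ q) (hle : v ≤ O.card * (1 - 4 * τ * σ + 2 * σ ^ 2 - 4 * τ * σ ^ 2)) {c : ℝ}
    (hc : c = 1 ∨ c = -1) (hx : ∀ l ∈ O, x (p + l) - x (q + l) = c) :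
    v < patchEnergy O (x + z) p q := by
  rw [patchEnergy_add_eq hx]
  have hsqp := (abs_lt.1 (hz.1 p)).1
  have hsqq := (abs_lt.1 (hz.1 q)).1
  have hprod := (abs_lt.1 (hz.2.2 p q hpq)).2
  have hsump := abs_lt.1 (hz.2.1 p)
  have hsumq := abs_lt.1 (hz.2.1 q)
  rcases hc with rfl | rfl <;> linarith [hsump.1, hsump.2, hsumq.1, hsumq.2]

lemma compl_concentrated_subset :
    (concentrated O σ τ)ᶜ ⊆
      (⋃ p, {z | τ * σ ^ 2 * O.card ≤ |∑ l ∈ O, z (p + l) ^ 2 - σ ^ 2 * O.card|}) ∪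
      ((⋃ p, {z | τ * σ * O.card ≤ |∑ l ∈ O, (1 : ℝ) * z (p + l)|}) ∪
      ⋃ p, ⋃ q, {z | p ≠ q ∧ τ * σ ^ 2 * O.card ≤ |∑ l ∈ O, z (p + l) * z (q + l)|}) := by
  intro z hz
  by_contra h
  simp only [Set.mem_union, Set.mem_iUnion, Set.mem_ofPred_eq, not_or, not_exists, not_le,
    not_and, one_mul] at h
  exact hz h

lemma measurableSet_concentrated [Countable V] : MeasurableSet (concentrated O σ τ) := by
  simp only [concentrated, Set.ofPred_and, Set.ofPred_forall]
  refine (MeasurableSet.iInter fun p => ?_).inter ((MeasurableSet.iInter fun p => ?_).inter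
    (MeasurableSet.iInter fun p => MeasurableSet.iInter fun q => MeasurableSet.iInter fun _ => ?_))
  all_goals exact measurableSet_lt (by fun_prop) measurable_const

variable [Fintype V]

lemma gaussNoise_compl_concentrated_le_sum :
    gaussNoise V σ (concentrated O σ τ)ᶜ ≤
      ∑ p, gaussNoise V σ {z | τ * σ ^ 2 * O.card ≤ |∑ l ∈ O, z (p + l) ^ 2 - σ ^ 2 * O.card|} +
      (∑ p, gaussNoise V σ {z | τ * σ * O.card ≤ |∑ l ∈ O, (1 : ℝ) * z (p + l)|} +
      ∑ p, ∑ q, gaussNoise V σ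
        {z | p ≠ q ∧ τ * σ ^ 2 * O.card ≤ |∑ l ∈ O, z (p + l) * z (q + l)|}) := by
  grw [measure_mono compl_concentrated_subset, measure_union_le, measure_union_le,
    measure_iUnion_fintype_le, measure_iUnion_fintype_le, measure_iUnion_fintype_le]
  gcongr
  exact measure_iUnion_fintype_le _ _

lemma gaussNoise_compl_concentrated_le (hσ : 0 < σ) (hO : ShiftBicolorable O)
    (hτ0 : 0 ≤ τ) (hτ1 : τ ≤ 1) :
    gaussNoise V σ (concentrated O σ τ)ᶜ ≤
      ENNReal.ofReal (12 * (Fintype.card V : ℝ) ^ 2 * Real.exp (-(τ ^ 2 * O.card / 16))) := by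
  set T := (Fintype.card V : ℝ) with hT
  set E := Real.exp (-(τ ^ 2 * O.card / 16)) with hE
  have hinj (p : V) : Set.InjOn (p + ·) (O : Set V) := (add_right_injective p).injOn
  have hlinear (p : V) : gaussNoise V σ {z | τ * σ * O.card ≤ |∑ l ∈ O, (1 : ℝ) * z (p + l)|} ≤
      ENNReal.ofReal (2 * E) := by
    refine (gaussNoise_abs_sum_mul_const_ge_le hσ (hinj p) le_rfl (by simp) hτ0).trans ?_
    rw [hE]
    gcongr
    norm_num
  have hproduct (p q : V) : gaussNoise V σ
      {z | p ≠ q ∧ τ * σ ^ 2 * O.card ≤ |∑ l ∈ O, z (p + l) * z (q + l)|} ≤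
      ENNReal.ofReal (4 * E) := by
    by_cases hpq : p = q
    · simp [hpq]
    · exact (measure_mono fun z hz => hz.2).trans
        (gaussNoise_abs_sum_mul_ge_le hσ hO hpq subset_rfl le_rfl hτ0 hτ1)
  have hsum (a : ℝ) : ∑ _p : V, ENNReal.ofReal a = ENNReal.ofReal (T * a) := by
    rw [Finset.sum_const, Finset.card_univ, nsmul_eq_mul, ENNReal.ofReal_mul (by positivity), hT,
      ENNReal.ofReal_natCast]
  calc _ ≤ ∑ _p : V, ENNReal.ofReal (2 * E) + (∑ _p : V, ENNReal.ofReal (2 * E) +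
          ∑ _p : V, ∑ _q : V, ENNReal.ofReal (4 * E)) := by
        refine gaussNoise_compl_concentrated_le_sum.trans ?_
        gcongr with p _ p _ p _ q _
        · exact gaussNoise_abs_sum_sq_sub_ge_le hσ (hinj p) le_rfl hτ0 hτ1
        · exact hlinear p
        · exact hproduct p q
    _ = ENNReal.ofReal (4 * T * E + 4 * T ^ 2 * E) := by
        rw [hsum, hsum, hsum,
          ← ENNReal.ofReal_add (by positivity) (by positivity),
          ← ENNReal.ofReal_add (by positivity) (by positivity)]
        ring_nf
    _ ≤ _ := by
        have hTT : T ≤ T ^ 2 := by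
          rw [hT]
          exact_mod_cast Nat.le_self_pow two_ne_zero _
        have hE0 : 0 ≤ E := (Real.exp_pos _).le
        exact ENNReal.ofReal_le_ofReal (by nlinarith [mul_le_mul_of_nonneg_right hTT hE0])

end Concentrated

lemma lintegral_sq_sum_gaussNoise {V : Type*} [Fintype V] (σ : ℝ) (F : Finset V) :
    ∫⁻ z, ENNReal.ofReal ((∑ i ∈ F, z i) ^ 2) ∂gaussNoise V σ =
      ENNReal.ofReal (σ ^ 2 * F.card) := by
  classical
  have hid : MemLp id 2 (gaussianReal 0 (σ ^ 2).toNNReal) := memLp_id_gaussianReal' 2 (by simp)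
  have heval (i : V) : MemLp (fun z : V → ℝ => z i) 2 (gaussNoise V σ) :=
    hid.comp_measurePreserving (measurePreserving_eval _ i)
  have hmean : ∫ z : V → ℝ, ∑ i ∈ F, z i ∂gaussNoise V σ = 0 := by
    rw [integral_finsetSum _ fun i _ => (heval i).integrable one_le_two]
    exact Finset.sum_eq_zero fun i _ => (integral_comp_eval (i := i)
      (μ := fun _ : V => gaussianReal 0 (σ ^ 2).toNNReal) (f := id) hid.aestronglyMeasurable).trans
      integral_id_gaussianReal
  have hvar : Var[fun z => ∑ i ∈ F, z i; gaussNoise V σ] = σ ^ 2 * F.card := by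
    let X : V → ℝ → ℝ := fun i => if i ∈ F then id else 0
    have hX (i : V) : MemLp (X i) 2 (gaussianReal 0 (σ ^ 2).toNNReal) := by
      by_cases hi : i ∈ F
      · simpa only [X, if_pos hi] using hid
      · simp only [X, if_neg hi, MemLp.zero]
    have hXvar (i : V) : Var[X i; gaussianReal 0 (σ ^ 2).toNNReal] =
        if i ∈ F then σ ^ 2 else 0 := by
      by_cases hi : i ∈ F <;> simp [X, hi, variance_id_gaussianReal, sq_nonneg]
    have hsum : (fun z : V → ℝ => ∑ i ∈ F, z i) = ∑ i, fun z => X i (z i) := by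
      ext z
      simp only [Finset.sum_apply, X, ite_apply, id_eq, Pi.zero_apply, Finset.sum_ite_mem,
        Finset.univ_inter]
    rw [hsum, gaussNoise, variance_sum_pi hX]
    simp [hXvar, mul_comm]
  rw [← hvar, ofReal_variance (memLp_finsetSum _ fun i _ => heval i),
    evariance_eq_lintegral_ofReal, hmean]
  simp only [sub_zero]

lemma lintegral_sum_one_add_sq_gaussNoise {V : Type*} [Fintype V] (σ : ℝ) (E : Finset V) :
    ∫⁻ z, ENNReal.ofReal (∑ i ∈ E, (1 + z i ^ 2)) ∂gaussNoise V σ =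
      ENNReal.ofReal (E.card * (1 + σ ^ 2)) := by
  have hsum (z : V → ℝ) : ENNReal.ofReal (∑ i ∈ E, (1 + z i ^ 2)) =
      ∑ i ∈ E, ENNReal.ofReal (1 + z i ^ 2) :=
    ENNReal.ofReal_sum_of_nonneg fun _ _ => by positivity
  have hterm (i : V) : ∫⁻ z, ENNReal.ofReal (1 + z i ^ 2) ∂gaussNoise V σ =
      ENNReal.ofReal (1 + σ ^ 2) := by
    simp_rw [ENNReal.ofReal_add zero_le_one (sq_nonneg _)]
    rw [lintegral_add_left measurable_const, lintegral_const, measure_univ, mul_one,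
      lintegral_eval_gaussNoise σ i (f := fun x => ENNReal.ofReal (x ^ 2)) (by fun_prop),
      lintegral_sq_gaussianReal]
  simp_rw [hsum]
  rw [lintegral_finsetSum _ fun i _ => by fun_prop]
  simp_rw [hterm]
  rw [Finset.sum_const, nsmul_eq_mul, ENNReal.ofReal_mul (by positivity), ENNReal.ofReal_natCast]

/-- The numerical conditions under which similar patches separate the flat regions of an image:
`T` is the number of pixels, `N` the size of a patch, `v` the threshold, `τ` the relative
concentration of the patch sums, and `K` a truncation level for the squared noise. -/
structure SeparationScales (σ T N τ K v : ℝ) : Prop where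
  nonneg : 0 ≤ τ
  le_one : τ ≤ 1
  level_nonneg : 0 ≤ K
  le_threshold : N * (2 * σ ^ 2 + 4 * τ * σ ^ 2) ≤ v
  threshold_le : v ≤ N * (1 - 4 * τ * σ + 2 * σ ^ 2 - 4 * τ * σ ^ 2)
  concentration_le : T * ((2 + 2 * K) * (12 * T ^ 2 * Real.exp (-(τ ^ 2 * N / 16)))) ≤ 1 / 2
  tail_le : T * (T * (32 * σ ^ 2 * Real.exp (-K / (8 * σ ^ 2)))) ≤ 1 / 2

/-- The points around which `x` is constantly `a`, on the patch and at the centre. -/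
noncomputable def flatSet {V : Type*} [Fintype V] [Add V] (O : Finset V) (x : V → ℝ) (a : ℝ) :
    Finset V :=
  Finset.univ.filter fun p => x p = a ∧ ∀ l ∈ O, x (p + l) = a

lemma mem_flatSet {V : Type*} [Fintype V] [Add V] {O : Finset V} {x : V → ℝ} {a : ℝ} {p : V} :
    p ∈ flatSet O x a ↔ x p = a ∧ ∀ l ∈ O, x (p + l) = a := by
  simp [flatSet]

section Flat

variable {V : Type*} [AddCommGroup V] [Fintype V] {O : Finset V} {x : V → ℝ} {v σ τ K a b : ℝ}
  {p : V} {z : V → ℝ}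

lemma SeparationScales.threshold_nonneg {T N : ℝ} (hs : SeparationScales σ T N τ K v)
    (hN : 0 ≤ N) : 0 ≤ v :=
  (mul_nonneg hN (by have := hs.nonneg; positivity)).trans hs.le_threshold

lemma flatSet_subset_similarPoints (hz : z ∈ concentrated O σ τ) (hv : 0 ≤ v)
    (hle : O.card * (2 * σ ^ 2 + 4 * τ * σ ^ 2) ≤ v) (hp : p ∈ flatSet O x a) :
    flatSet O x a ⊆ similarPoints O v (x + z) p := fun q hq =>
  mem_similarPoints.2 <| patchEnergy_le_of_concentrated hz hv hle fun l hl => by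
    rw [(mem_flatSet.1 hp).2 l hl, (mem_flatSet.1 hq).2 l hl]

lemma disjoint_similarPoints_flatSet (hz : z ∈ concentrated O σ τ)
    (hle : v ≤ O.card * (1 - 4 * τ * σ + 2 * σ ^ 2 - 4 * τ * σ ^ 2)) (hab : a - b = 1 ∨ a - b = -1)
    (hp : p ∈ flatSet O x a) : Disjoint (similarPoints O v (x + z) p) (flatSet O x b) := by
  refine Finset.disjoint_left.2 fun q hq hqb => ?_
  obtain ⟨hpa, hpO⟩ := mem_flatSet.1 hp
  obtain ⟨hqb, hqO⟩ := mem_flatSet.1 hqb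
  have hpq : p ≠ q := by
    rintro rfl
    rw [← hpa, ← hqb, sub_self] at hab
    norm_num at hab
  exact (mem_similarPoints.1 hq).not_gt <| lt_patchEnergy_of_concentrated hz hpq hle hab
    fun l hl => by rw [hpO l hl, hqO l hl]

lemma sq_sub_patchMean_le_of_subset [DecidableEq V] (hx : ∀ i, x i ∈ Set.Icc (0 : ℝ) 1)
    (hv : 0 ≤ v) {F E : Finset V} (hF : ∀ q ∈ F, x q = x p)
    (hFW : F ⊆ similarPoints O v (x + z) p) (hWE : similarPoints O v (x + z) p \ F ⊆ E)
    (hp : p ∈ F) :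
    (x p - patchMean O v (x + z) p) ^ 2 ≤ (F.card ^ 2 : ℝ)⁻¹ *
      (2 * (∑ q ∈ F, z q) ^ 2 + 4 * E.card * ∑ q ∈ E, (1 + z q ^ 2)) := by
  set W := similarPoints O v (x + z) p
  have hFpos : 0 < F.card := Finset.card_pos.2 ⟨p, hp⟩
  have hsplit : ∑ q ∈ W, (x p - (x + z) q) =
      ∑ q ∈ W \ F, (x p - (x + z) q) - ∑ q ∈ F, z q := by
    rw [← Finset.sum_sdiff hFW, sub_eq_add_neg, ← Finset.sum_neg_distrib]
    congr 1
    refine Finset.sum_congr rfl fun q hq => ?_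
    rw [Pi.add_apply, hF q hq]
    ring
  have hrest : (∑ q ∈ W \ F, (x p - (x + z) q)) ^ 2 ≤ 2 * E.card * ∑ q ∈ E, (1 + z q ^ 2) :=
    calc _ ≤ (W \ F).card * ∑ q ∈ W \ F, (x p - (x + z) q) ^ 2 := sq_sum_le_card_mul_sum_sq
      _ ≤ (W \ F).card * ∑ q ∈ W \ F, 2 * (1 + z q ^ 2) := by
          gcongr with q
          exact sq_sub_add_le hx z p q
      _ ≤ E.card * ∑ q ∈ E, 2 * (1 + z q ^ 2) := by gcongr
      _ = _ := by
          rw [← Finset.mul_sum]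
          ring
  rw [sub_patchMean_eq hv, div_pow, div_eq_inv_mul]
  gcongr
  rw [hsplit]
  linarith [sq_nonneg (∑ q ∈ W \ F, (x p - (x + z) q) + ∑ q ∈ F, z q)]

lemma setLIntegral_concentrated_sq_sub_patchMean_le [DecidableEq V]
    (hx : ∀ i, x i ∈ Set.Icc (0 : ℝ) 1) (hab : a - b = 1 ∨ a - b = -1) (hp : p ∈ flatSet O x a)
    (hs : SeparationScales σ (Fintype.card V) O.card τ K v) :
    ∫⁻ z in concentrated O σ τ, ENNReal.ofReal ((x p - patchMean O v (x + z) p) ^ 2)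
        ∂gaussNoise V σ ≤
      ENNReal.ofReal (((flatSet O x a).card ^ 2 : ℝ)⁻¹ * (2 * (σ ^ 2 * (flatSet O x a).card) +
        4 * ((flatSet O x a ∪ flatSet O x b)ᶜ.card * ((flatSet O x a ∪ flatSet O x b)ᶜ.card *
          (1 + σ ^ 2))))) := by
  set F := flatSet O x a with hF
  set E := (F ∪ flatSet O x b)ᶜ with hE
  have hv := hs.threshold_nonneg (Nat.cast_nonneg _)
  have hpointwise : ∀ z ∈ concentrated O σ τ, (x p - patchMean O v (x + z) p) ^ 2 ≤
      (F.card ^ 2 : ℝ)⁻¹ * (2 * (∑ q ∈ F, z q) ^ 2 + 4 * E.card * ∑ q ∈ E, (1 + z q ^ 2)) := by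
    intro z hz
    refine sq_sub_patchMean_le_of_subset hx hv
      (fun q hq => (mem_flatSet.1 hq).1.trans (mem_flatSet.1 hp).1.symm)
      (flatSet_subset_similarPoints hz hv hs.le_threshold hp) (fun q hq => ?_) hp
    obtain ⟨hqW, hqF⟩ := Finset.mem_sdiff.1 hq
    have hdisj := disjoint_similarPoints_flatSet hz hs.threshold_le hab hp
    simp only [hE, Finset.mem_compl, Finset.mem_union, not_or]
    exact ⟨hqF, Finset.disjoint_left.1 hdisj hqW⟩
  have hofReal (z : V → ℝ) : ENNReal.ofReal ((F.card ^ 2 : ℝ)⁻¹ *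
      (2 * (∑ q ∈ F, z q) ^ 2 + 4 * E.card * ∑ q ∈ E, (1 + z q ^ 2))) =
      ENNReal.ofReal (F.card ^ 2 : ℝ)⁻¹ * (ENNReal.ofReal 2 * ENNReal.ofReal ((∑ q ∈ F, z q) ^ 2) +
        ENNReal.ofReal (4 * E.card) * ENNReal.ofReal (∑ q ∈ E, (1 + z q ^ 2))) := by
    rw [ENNReal.ofReal_mul (by positivity), ENNReal.ofReal_add (by positivity)
      (by positivity), ENNReal.ofReal_mul (by positivity), ENNReal.ofReal_mul (by positivity)]
  calc _ ≤ ∫⁻ z, ENNReal.ofReal ((F.card ^ 2 : ℝ)⁻¹ *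
          (2 * (∑ q ∈ F, z q) ^ 2 + 4 * E.card * ∑ q ∈ E, (1 + z q ^ 2))) ∂gaussNoise V σ :=
        (setLIntegral_mono' measurableSet_concentrated fun z hz =>
          ENNReal.ofReal_le_ofReal (hpointwise z hz)).trans (setLIntegral_le_lintegral _ _)
    _ = ENNReal.ofReal (F.card ^ 2 : ℝ)⁻¹ * (ENNReal.ofReal 2 * ENNReal.ofReal (σ ^ 2 * F.card) +
          ENNReal.ofReal (4 * E.card) * ENNReal.ofReal (E.card * (1 + σ ^ 2))) := by
        simp_rw [hofReal]
        rw [lintegral_const_mul _ (by fun_prop), lintegral_add_left (by fun_prop),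
          lintegral_const_mul _ (by fun_prop), lintegral_const_mul _ (by fun_prop),
          lintegral_sq_sum_gaussNoise, lintegral_sum_one_add_sq_gaussNoise]
    _ = _ := by
        rw [← ENNReal.ofReal_mul (by positivity), ← ENNReal.ofReal_mul (by positivity),
          ← ENNReal.ofReal_add (by positivity) (by positivity),
          ← ENNReal.ofReal_mul (by positivity), mul_assoc 4]

lemma setLIntegral_sq_sub_patchMean_le (hσ : 0 < σ) (hx : ∀ i, x i ∈ Set.Icc (0 : ℝ) 1)
    (hv : 0 ≤ v) (hK : 0 ≤ K) (p : V) (A : Set (V → ℝ)) :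
    ∫⁻ z in A, ENNReal.ofReal ((x p - patchMean O v (x + z) p) ^ 2) ∂gaussNoise V σ ≤
      ENNReal.ofReal (2 + 2 * K) * gaussNoise V σ A +
        ENNReal.ofReal (Fintype.card V * (32 * σ ^ 2 * Real.exp (-K / (8 * σ ^ 2)))) := by
  set tail := {y : ℝ | y ^ 2 ≤ K}ᶜ.indicator (fun y => ENNReal.ofReal (y ^ 2)) with htail
  have htail_set : MeasurableSet {y : ℝ | y ^ 2 ≤ K}ᶜ :=
    (measurableSet_le (by fun_prop) measurable_const).compl
  have htail_meas : Measurable tail := Measurable.indicator (by fun_prop) htail_set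
  have htail_eval (q : V) : Measurable fun z : V → ℝ => tail (z q) :=
    htail_meas.comp (measurable_pi_apply q)
  have htail_le (q : V) : ∫⁻ z, tail (z q) ∂gaussNoise V σ ≤
      ENNReal.ofReal (16 * σ ^ 2 * Real.exp (-K / (8 * σ ^ 2))) := by
    rw [lintegral_eval_gaussNoise σ q htail_meas, htail, lintegral_indicator htail_set]
    exact setLIntegral_sq_gaussianReal_le hσ K
  calc _ ≤ ∫⁻ z in A, ENNReal.ofReal (2 + 2 * K) + 2 * ∑ q, tail (z q) ∂gaussNoise V σ :=
        lintegral_mono fun z => ofReal_sq_sub_patchMean_le_add_sum_indicator hx hv hK p z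
    _ ≤ ENNReal.ofReal (2 + 2 * K) * gaussNoise V σ A +
          ∫⁻ z, 2 * ∑ q, tail (z q) ∂gaussNoise V σ := by
        rw [lintegral_add_left measurable_const, setLIntegral_const]
        gcongr
        exact Measure.restrict_le_self
    _ ≤ ENNReal.ofReal (2 + 2 * K) * gaussNoise V σ A +
          2 * ∑ _q : V, ENNReal.ofReal (16 * σ ^ 2 * Real.exp (-K / (8 * σ ^ 2))) := by
        rw [lintegral_const_mul _ (Finset.measurable_sum _ fun q _ => htail_eval q),
          lintegral_finsetSum _ fun q _ => htail_eval q]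
        gcongr with q
        exact htail_le q
    _ = _ := by
        rw [Finset.sum_const, Finset.card_univ, nsmul_eq_mul, ← ENNReal.ofReal_natCast,
          ← ENNReal.ofReal_ofNat, ← ENNReal.ofReal_mul (by positivity),
          ← ENNReal.ofReal_mul (by positivity)]
        ring_nf

lemma setLIntegral_compl_concentrated_sq_sub_patchMean_le (hσ : 0 < σ)
    (hO : ShiftBicolorable O) (hx : ∀ i, x i ∈ Set.Icc (0 : ℝ) 1) (p : V)
    (hs : SeparationScales σ (Fintype.card V) O.card τ K v) :
    Fintype.card V * ∫⁻ z in (concentrated O σ τ)ᶜ,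
        ENNReal.ofReal ((x p - patchMean O v (x + z) p) ^ 2) ∂gaussNoise V σ ≤ 1 := by
  have hK := hs.level_nonneg
  grw [setLIntegral_sq_sub_patchMean_le hσ hx (hs.threshold_nonneg (Nat.cast_nonneg _)) hK p,
    gaussNoise_compl_concentrated_le hσ hO hs.nonneg hs.le_one]
  rw [← ENNReal.ofReal_natCast, ← ENNReal.ofReal_mul (by positivity),
    ← ENNReal.ofReal_add (by positivity) (by positivity), ← ENNReal.ofReal_mul (by positivity)]
  refine ENNReal.ofReal_le_one.2 ?_
  linarith [hs.concentration_le, hs.tail_le]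

lemma card_mul_lintegral_sq_sub_patchMean_le_of_mem_flatSet [DecidableEq V] (hσ : 0 < σ)
    (hO : ShiftBicolorable O) (hx : ∀ i, x i ∈ Set.Icc (0 : ℝ) 1) (hab : a - b = 1 ∨ a - b = -1)
    (hp : p ∈ flatSet O x a) (hs : SeparationScales σ (Fintype.card V) O.card τ K v) {B : ℝ}
    (hE : ((flatSet O x a ∪ flatSet O x b)ᶜ.card : ℝ) ≤ B) (hB : B ≤ (flatSet O x a).card) :
    (flatSet O x a).card *
        ∫⁻ z, ENNReal.ofReal ((x p - patchMean O v (x + z) p) ^ 2) ∂gaussNoise V σ ≤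
      ENNReal.ofReal (2 * σ ^ 2 + 4 * B * (1 + σ ^ 2) + 1) := by
  set F := flatSet O x a
  set E := (F ∪ flatSet O x b)ᶜ
  have hF : (0 : ℝ) < F.card := Nat.cast_pos.2 (Finset.card_pos.2 ⟨p, hp⟩)
  have hB0 : 0 ≤ B := (Nat.cast_nonneg _).trans hE
  have hgood : F.card * ∫⁻ z in concentrated O σ τ,
      ENNReal.ofReal ((x p - patchMean O v (x + z) p) ^ 2) ∂gaussNoise V σ ≤
      ENNReal.ofReal (2 * σ ^ 2 + 4 * B * (1 + σ ^ 2)) := by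
    grw [setLIntegral_concentrated_sq_sub_patchMean_le hx hab hp hs]
    rw [← ENNReal.ofReal_natCast, ← ENNReal.ofReal_mul (by positivity)]
    refine ENNReal.ofReal_le_ofReal ?_
    calc F.card * ((F.card ^ 2 : ℝ)⁻¹ *
            (2 * (σ ^ 2 * F.card) + 4 * (E.card * (E.card * (1 + σ ^ 2)))))
        = 2 * σ ^ 2 + 4 * (E.card * (1 + σ ^ 2)) * (E.card / F.card) := by
          field_simp
      _ ≤ 2 * σ ^ 2 + 4 * (B * (1 + σ ^ 2)) * 1 := by
          gcongr
          exact (div_le_one hF).2 (hE.trans hB)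
      _ = _ := by ring
  have hbad : F.card * ∫⁻ z in (concentrated O σ τ)ᶜ,
      ENNReal.ofReal ((x p - patchMean O v (x + z) p) ^ 2) ∂gaussNoise V σ ≤ ENNReal.ofReal 1 := by
    grw [Finset.card_le_univ F, ENNReal.ofReal_one]
    exact setLIntegral_compl_concentrated_sq_sub_patchMean_le hσ hO hx p hs
  rw [← lintegral_add_compl _ (measurableSet_concentrated (O := O) (σ := σ) (τ := τ)), mul_add,
    ENNReal.ofReal_add (by positivity) zero_le_one]
  exact add_le_add hgood hbad

lemma sum_flatSet_lintegral_sq_sub_patchMean_le [DecidableEq V] (hσ : 0 < σ)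
    (hO : ShiftBicolorable O) (hx : ∀ i, x i ∈ Set.Icc (0 : ℝ) 1) (hab : a - b = 1 ∨ a - b = -1)
    (hs : SeparationScales σ (Fintype.card V) O.card τ K v) {B D : ℝ}
    (hE : ((flatSet O x a ∪ flatSet O x b)ᶜ.card : ℝ) ≤ B) (hB : 1 ≤ B) (hD : 0 ≤ D)
    (hle : ∀ p, ∫⁻ z, ENNReal.ofReal ((x p - patchMean O v (x + z) p) ^ 2) ∂gaussNoise V σ ≤
      ENNReal.ofReal D) :
    ∑ p ∈ flatSet O x a,
      ∫⁻ z, ENNReal.ofReal ((x p - patchMean O v (x + z) p) ^ 2) ∂gaussNoise V σ ≤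
      ENNReal.ofReal (B * (D + 6 * σ ^ 2 + 5)) := by
  set F := flatSet O x a
  rcases le_total B F.card with hBF | hFB
  · have hF0 : (F.card : ℝ≥0∞) ≠ 0 := by
      rintro h
      rw [Nat.cast_eq_zero] at h
      rw [h, Nat.cast_zero] at hBF
      linarith
    refine (Finset.sum_le_card_nsmul F _ (ENNReal.ofReal (B * (D + 6 * σ ^ 2 + 5)) / F.card)
      fun p hp => ?_).trans_eq ?_
    · rw [ENNReal.le_div_iff_mul_le (.inl hF0) (.inl (ENNReal.natCast_ne_top _)), mul_comm]
      refine (card_mul_lintegral_sq_sub_patchMean_le_of_mem_flatSet hσ hO hx hab hp hs hE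
        hBF).trans (ENNReal.ofReal_le_ofReal ?_)
      nlinarith [mul_nonneg (zero_le_one.trans hB) hD, mul_nonneg (sub_nonneg.2 hB) (sq_nonneg σ)]
    · rw [nsmul_eq_mul, ENNReal.mul_div_cancel hF0 (ENNReal.natCast_ne_top _)]
  · calc _ ≤ F.card • ENNReal.ofReal D := Finset.sum_le_card_nsmul F _ _ fun p _ => hle p
      _ = ENNReal.ofReal (F.card * D) := by
          rw [nsmul_eq_mul, ENNReal.ofReal_mul (Nat.cast_nonneg _), ENNReal.ofReal_natCast]
      _ ≤ _ := by
          gcongr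
          linarith [sq_nonneg σ]

lemma sum_lintegral_sq_sub_patchMean_le [DecidableEq V] (hσ : 0 < σ)
    (hO : ShiftBicolorable O) (hx : ∀ i, x i ∈ Set.Icc (0 : ℝ) 1)
    (hs : SeparationScales σ (Fintype.card V) O.card τ K v) {B D : ℝ}
    (hE : ((flatSet O x 1 ∪ flatSet O x 0)ᶜ.card : ℝ) ≤ B) (hB : 1 ≤ B) (hD : 0 ≤ D)
    (hle : ∀ p, ∫⁻ z, ENNReal.ofReal ((x p - patchMean O v (x + z) p) ^ 2) ∂gaussNoise V σ ≤
      ENNReal.ofReal D) :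
    ∑ p, ∫⁻ z, ENNReal.ofReal ((x p - patchMean O v (x + z) p) ^ 2) ∂gaussNoise V σ ≤
      ENNReal.ofReal (B * (3 * D + 12 * σ ^ 2 + 10)) := by
  set r : V → ℝ≥0∞ := fun p =>
    ∫⁻ z, ENNReal.ofReal ((x p - patchMean O v (x + z) p) ^ 2) ∂gaussNoise V σ
  have hone : ∑ p ∈ flatSet O x 1, r p ≤ ENNReal.ofReal (B * (D + 6 * σ ^ 2 + 5)) :=
    sum_flatSet_lintegral_sq_sub_patchMean_le (b := 0) hσ hO hx (by norm_num) hs hE hB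
      hD hle
  have hzero : ∑ p ∈ flatSet O x 0, r p ≤ ENNReal.ofReal (B * (D + 6 * σ ^ 2 + 5)) :=
    sum_flatSet_lintegral_sq_sub_patchMean_le (b := 1) hσ hO hx (by norm_num) hs
      (by rwa [Finset.union_comm]) hB hD hle
  have hrest : ∑ p ∈ (flatSet O x 1 ∪ flatSet O x 0)ᶜ, r p ≤ ENNReal.ofReal (B * D) := by
    refine (Finset.sum_le_card_nsmul _ _ _ fun p _ => hle p).trans ?_
    rw [nsmul_eq_mul, ← ENNReal.ofReal_natCast, ← ENNReal.ofReal_mul (by positivity)]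
    gcongr
  calc ∑ p, r p ≤ ∑ p ∈ flatSet O x 1, r p + ∑ p ∈ flatSet O x 0, r p +
          ∑ p ∈ (flatSet O x 1 ∪ flatSet O x 0)ᶜ, r p := by
        rw [← Finset.sum_add_sum_compl (flatSet O x 1 ∪ flatSet O x 0) r,
          ← Finset.sum_union_inter (s₁ := flatSet O x 1)]
        exact add_le_add le_self_add le_rfl
    _ ≤ _ := add_le_add (add_le_add hone hzero) hrest
    _ = _ := by
        rw [← ENNReal.ofReal_add (by positivity) (by positivity),
          ← ENNReal.ofReal_add (by positivity) (by positivity)]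
        ring_nf

end Flat

/-- The offsets of a patch of half-width `δ` without its centre. -/
noncomputable def boxOffsets (n δ : ℕ) : Finset (ZMod n × ZMod n) :=
  ((Finset.Icc (-(δ : ℤ)) δ ×ˢ Finset.Icc (-(δ : ℤ)) δ).erase 0).image
    fun l => ((l.1 : ZMod n), (l.2 : ZMod n))

section Offsets

variable {n δ : ℕ}

lemma valMinAbs_intCast_of_abs_le {a : ℤ} {m : ℕ} (hm : 2 * m < n) (ha : |a| ≤ m) :
    (a : ZMod n).valMinAbs = a := by
  have : NeZero n := ⟨by omega⟩
  rw [ZMod.valMinAbs_spec]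
  refine ⟨rfl, ?_, ?_⟩ <;> cases abs_cases a <;> omega

lemma injOn_boxCast (hδ : 2 * δ < n) : Set.InjOn
    (fun l : ℤ × ℤ => ((l.1 : ZMod n), (l.2 : ZMod n)))
    (Finset.Icc (-(δ : ℤ)) δ ×ˢ Finset.Icc (-(δ : ℤ)) δ : Finset (ℤ × ℤ)) := by
  intro l hl l' hl' heq
  simp only [Finset.coe_product, Finset.coe_Icc, Set.mem_prod, Set.mem_Icc, ← abs_le] at hl hl'
  rw [Prod.mk.injEq] at heq
  ext
  · rw [← valMinAbs_intCast_of_abs_le hδ hl.1, heq.1, valMinAbs_intCast_of_abs_le hδ hl'.1]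
  · rw [← valMinAbs_intCast_of_abs_le hδ hl.2, heq.2, valMinAbs_intCast_of_abs_le hδ hl'.2]

lemma zero_mem_box (δ : ℕ) :
    (0 : ℤ × ℤ) ∈ Finset.Icc (-(δ : ℤ)) δ ×ˢ Finset.Icc (-(δ : ℤ)) δ := by simp

lemma injOn_boxCast_erase (hδ : 2 * δ < n) : Set.InjOn
    (fun l : ℤ × ℤ => ((l.1 : ZMod n), (l.2 : ZMod n)))
    ((Finset.Icc (-(δ : ℤ)) δ ×ˢ Finset.Icc (-(δ : ℤ)) δ).erase 0 : Finset (ℤ × ℤ)) :=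
  (injOn_boxCast hδ).mono (Finset.coe_subset.2 (Finset.erase_subset _ _))

lemma card_boxOffsets (hδ : 2 * δ < n) : (boxOffsets n δ).card = (2 * δ + 1) ^ 2 - 1 := by
  have hside : ((δ : ℤ) + 1 - -(δ : ℤ)).toNat = 2 * δ + 1 := by omega
  rw [boxOffsets, Finset.card_image_of_injOn (injOn_boxCast_erase hδ),
    Finset.card_erase_of_mem (zero_mem_box δ), Finset.card_product, Int.card_Icc, sq, hside]

lemma cast_card_boxOffsets (hδ : 2 * δ < n) :
    ((boxOffsets n δ).card : ℝ) = (2 * (δ : ℝ) + 1) ^ 2 - 1 := by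
  rw [card_boxOffsets hδ, Nat.cast_sub (Nat.one_le_pow _ _ (by omega))]
  push_cast
  rfl

lemma zero_notMem_boxOffsets (hδ : 2 * δ < n) : (0 : ZMod n × ZMod n) ∉ boxOffsets n δ := by
  intro hzero
  obtain ⟨l, hl, hl0⟩ := Finset.mem_image.1 hzero
  obtain ⟨hne, hbox⟩ := Finset.mem_erase.1 hl
  exact hne (injOn_boxCast hδ hbox (zero_mem_box δ) (by simpa using hl0))

lemma exists_int_of_mem_boxOffsets {l : ZMod n × ZMod n} (hl : l ∈ boxOffsets n δ) :
    ∃ a b : ℤ, |a| ≤ δ ∧ |b| ≤ δ ∧ l = ((a : ZMod n), (b : ZMod n)) := by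
  obtain ⟨⟨a, b⟩, hab, rfl⟩ := Finset.mem_image.1 hl
  simp only [Finset.mem_erase, Finset.mem_product, Finset.mem_Icc, ← abs_le] at hab
  exact ⟨a, b, hab.2.1, hab.2.2, rfl⟩

-- Adding `k` to a representative raises its quotient by `k` by exactly one.
lemma even_valMinAbs_ediv_ne (hδ : 4 * δ < n) {k : ZMod n} (hk : k ≠ 0) {a b : ℤ} (ha : |a| ≤ δ)
    (hb : |b| ≤ δ) (hab : (b : ZMod n) = a + k) :
    decide (Even ((b : ZMod n).valMinAbs / k.valMinAbs)) ≠
      decide (Even ((a : ZMod n).valMinAbs / k.valMinAbs)) := by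
  have hk_eq : k = ((b - a : ℤ) : ZMod n) := by rw [Int.cast_sub, hab, add_sub_cancel_left]
  have hk_val : k.valMinAbs = b - a := by
    rw [hk_eq]
    refine valMinAbs_intCast_of_abs_le (m := 2 * δ) (by omega) ((abs_sub b a).trans ?_)
    push_cast
    linarith
  have hba : b - a ≠ 0 := by rwa [← hk_val, ne_eq, ZMod.valMinAbs_eq_zero]
  have hquot : b / (b - a) = a / (b - a) + 1 := by
    rw [← Int.add_mul_ediv_right _ _ hba, one_mul, add_sub_cancel]
  rw [hk_val, valMinAbs_intCast_of_abs_le (by omega) ha,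
    valMinAbs_intCast_of_abs_le (by omega) hb, hquot, ne_eq, decide_eq_decide, Int.even_add_one]
  tauto

lemma shiftBicolorable_boxOffsets (hδ : 4 * δ < n) : ShiftBicolorable (boxOffsets n δ) := by
  intro k hk
  by_cases hfst : k.1 = 0
  · have hsnd : k.2 ≠ 0 := fun hsnd => hk (Prod.ext hfst hsnd)
    refine ⟨fun l => decide (Even (l.2.valMinAbs / k.2.valMinAbs)), fun l hl hlk => ?_⟩
    obtain ⟨a, b, -, hb, rfl⟩ := exists_int_of_mem_boxOffsets hl
    obtain ⟨a', b', -, hb', heq⟩ := exists_int_of_mem_boxOffsets hlk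
    rw [heq]
    exact even_valMinAbs_ediv_ne hδ hsnd hb hb' (congrArg Prod.snd heq).symm
  · refine ⟨fun l => decide (Even (l.1.valMinAbs / k.1.valMinAbs)), fun l hl hlk => ?_⟩
    obtain ⟨a, b, ha, -, rfl⟩ := exists_int_of_mem_boxOffsets hl
    obtain ⟨a', b', ha', -, heq⟩ := exists_int_of_mem_boxOffsets hlk
    rw [heq]
    exact even_valMinAbs_ediv_ne hδ hfst ha ha' (congrArg Prod.fst heq).symm

lemma patchDistSq_eq (hδ : 2 * δ < n) (y : PixelArray n) (p q : ZMod n × ZMod n) :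
    patchDistSq δ y p q =
      1 / ((2 * (δ : ℝ) + 1) ^ 2 - 1) * patchEnergy (boxOffsets n δ) y p q := by
  rw [patchDistSq, patchEnergy, boxOffsets, Finset.sum_image (injOn_boxCast_erase hδ),
    Finset.sum_erase_eq_sub (zero_mem_box δ), Finset.sum_product_right]
  simp [sq_abs, Prod.add_def]

lemma nlm_eq_patchMean [NeZero n] (hδ0 : 0 < δ) (hδ : 2 * δ < n) (σ t : ℝ) (y : PixelArray n)
    (p : ZMod n × ZMod n) :
    nlm n σ δ t y p = patchMean (boxOffsets n δ) ((boxOffsets n δ).card * (2 * σ ^ 2 + t)) y p := by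
  have hcard : (0 : ℝ) < (2 * (δ : ℝ) + 1) ^ 2 - 1 := by
    have : (0 : ℝ) < δ := Nat.cast_pos.2 hδ0
    nlinarith
  have hweight (q : ZMod n × ZMod n) : nlmWeight σ δ t y p q =
      if patchEnergy (boxOffsets n δ) y p q ≤ (boxOffsets n δ).card * (2 * σ ^ 2 + t)
        then 1 else 0 := by
    simp only [nlmWeight, patchDistSq_eq hδ, one_div, inv_mul_le_iff₀ hcard,
      cast_card_boxOffsets hδ]
  simp only [nlm, patchMean, similarPoints, hweight, ite_mul, one_mul, zero_mul,
    ← Finset.sum_filter, Finset.sum_const, nsmul_eq_mul, mul_one]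

end Offsets

section Pixels

variable {n : ℕ} {h : ℝ → ℝ}

lemma IsHolder.lipschitzWith_one (hh : IsHolder 1 1 h) : LipschitzWith 1 h :=
  .of_dist_le_mul fun s t => by simpa [Real.dist_eq] using hh.2 s t

lemma volume_pixel (p : ZMod n × ZMod n) :
    volume (pixel n p) = ENNReal.ofReal (1 / n) * ENNReal.ofReal (1 / n) := by
  rw [pixel, Measure.volume_eq_prod, Measure.prod_prod, Real.volume_Ico, Real.volume_Ico]
  congr 2 <;> ring

lemma volume_pixel_ne_zero [NeZero n] (p : ZMod n × ZMod n) : volume (pixel n p) ≠ 0 := by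
  rw [volume_pixel]
  simp [NeZero.ne n]

lemma volume_pixel_ne_top (p : ZMod n × ZMod n) : volume (pixel n p) ≠ ∞ := by
  rw [volume_pixel]
  exact ENNReal.mul_ne_top ENNReal.ofReal_ne_top ENNReal.ofReal_ne_top

lemma measurableSet_pixel (p : ZMod n × ZMod n) : MeasurableSet (pixel n p) :=
  measurableSet_Ico.prod measurableSet_Ico

lemma measurable_horizonImage (hh : Continuous h) : Measurable (horizonImage h) :=
  measurable_const.indicator
    (isOpen_lt continuous_snd (hh.comp continuous_fst)).measurableSet

lemma horizonImage_mem_Icc (q : ℝ × ℝ) : horizonImage h q ∈ Set.Icc (0 : ℝ) 1 := by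
  unfold horizonImage Set.indicator
  split_ifs <;> simp

lemma pixelAverages_horizonImage_mem_Icc [NeZero n] (hh : Continuous h) (p : ZMod n × ZMod n) :
    pixelAverages n (horizonImage h) p ∈ Set.Icc (0 : ℝ) 1 := by
  refine (convex_Icc 0 1).set_average_mem isClosed_Icc (volume_pixel_ne_zero p)
    (volume_pixel_ne_top p) (.of_forall fun q => horizonImage_mem_Icc q)
    (Measure.integrableOn_of_bounded (M := 1) (volume_pixel_ne_top p)
      (measurable_horizonImage hh).aestronglyMeasurable (.of_forall fun q => ?_))
  obtain ⟨hq0, hq1⟩ := horizonImage_mem_Icc (h := h) q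
  rwa [Real.norm_of_nonneg hq0]

lemma pixelAverages_eq_of_forall [NeZero n] {f : ℝ × ℝ → ℝ} {p : ZMod n × ZMod n} {a : ℝ}
    (hf : ∀ q ∈ pixel n p, f q = a) : pixelAverages n f p = a := by
  rw [pixelAverages, setAverage_eq, setIntegral_congr_fun (measurableSet_pixel p) hf,
    ← setAverage_eq, setAverage_const (volume_pixel_ne_zero p) (volume_pixel_ne_top p)]

lemma val_add_intCast [NeZero n] {i : ZMod n} {a : ℤ} {δ : ℕ} (ha : |a| ≤ δ) (hi : δ ≤ i.val)
    (hin : i.val + δ < n) : ((i + (a : ZMod n)).val : ℝ) = i.val + a := by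
  have hcast : i + (a : ZMod n) = (((i.val : ℤ) + a : ℤ) : ZMod n) := by simp
  obtain ⟨hla, hua⟩ := abs_le.1 ha
  have hval : (((i + (a : ZMod n)).val : ℕ) : ℤ) = i.val + a := by
    rw [hcast, ZMod.val_intCast, Int.emod_eq_of_lt (by omega) (by omega)]
  exact_mod_cast hval

end Pixels

section Horizon

variable {n : ℕ} [NeZero n] {h : ℝ → ℝ} {K : NNReal} {δ : ℕ} {p : ZMod n × ZMod n}

lemma mem_flatSet_of_forall_mem {f : ℝ × ℝ → ℝ} {c : ℝ}
    (hfst : δ ≤ p.1.val ∧ p.1.val + δ < n) (hsnd : δ ≤ p.2.val ∧ p.2.val + δ < n)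
    (hf : ∀ q : ℝ × ℝ, |q.1 - p.1.val / n| ≤ (δ + 1) / n →
      q.2 ∈ Set.Ico (((p.2.val : ℝ) - δ) / n) ((p.2.val + δ + 1) / n) → f q = c) :
    p ∈ flatSet (boxOffsets n δ) (pixelAverages n f) c := by
  have hn : (0 : ℝ) < n := Nat.cast_pos.2 (NeZero.pos n)
  have htranslate (a b : ℤ) (ha : |a| ≤ δ) (hb : |b| ≤ δ) :
      pixelAverages n f (p + ((a : ZMod n), (b : ZMod n))) = c := by
    refine pixelAverages_eq_of_forall fun q hq => ?_
    obtain ⟨hla, hua⟩ := abs_le.1 (show |(a : ℝ)| ≤ δ by exact_mod_cast ha)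
    obtain ⟨hlb, hub⟩ := abs_le.1 (show |(b : ℝ)| ≤ δ by exact_mod_cast hb)
    simp only [pixel, Set.mem_prod, Set.mem_Ico, Prod.fst_add, Prod.snd_add,
      val_add_intCast ha hfst.1 hfst.2, val_add_intCast hb hsnd.1 hsnd.2, div_le_iff₀ hn,
      lt_div_iff₀ hn] at hq
    refine hf q ?_ ⟨?_, ?_⟩
    · rw [abs_le, ← neg_div, div_le_iff₀ hn, le_div_iff₀ hn, sub_mul, div_mul_cancel₀ _ hn.ne']
      constructor <;> linarith [hq.1.1, hq.1.2]
    · rw [div_le_iff₀ hn]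
      linarith [hq.2.1]
    · rw [lt_div_iff₀ hn]
      linarith [hq.2.2]
  refine mem_flatSet.2 ⟨?_, fun l hl => ?_⟩
  · simpa only [Int.cast_zero, Prod.mk_zero_zero, add_zero] using
      htranslate 0 0 (by simp) (by simp)
  · obtain ⟨a, b, ha, hb, rfl⟩ := exists_int_of_mem_boxOffsets hl
    exact htranslate a b ha hb

lemma mem_flatSet_zero_of_le (hh : LipschitzWith K h)
    (hfst : δ ≤ p.1.val ∧ p.1.val + δ < n) (hsnd : δ ≤ p.2.val ∧ p.2.val + δ < n)
    (hp : n * h (p.1.val / n) + (K + 1) * (δ + 1) ≤ p.2.val) :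
    p ∈ flatSet (boxOffsets n δ) (pixelAverages n (horizonImage h)) 0 := by
  have hn : (0 : ℝ) < n := Nat.cast_pos.2 (NeZero.pos n)
  refine mem_flatSet_of_forall_mem hfst hsnd fun q hq1 hq2 => Set.indicator_of_notMem ?_ _
  have hdist : h q.1 - h (p.1.val / n) ≤ K * ((δ + 1) / n) :=
    (le_abs_self _).trans ((hh.dist_le_mul _ _).trans (by gcongr; exact hq1))
  rw [Set.mem_ofPred_eq, not_lt]
  calc h q.1 ≤ h (p.1.val / n) + K * ((δ + 1) / n) := by linarith
    _ ≤ (p.2.val - δ) / n := by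
        rw [le_div_iff₀ hn]
        field_simp
        linarith
    _ ≤ q.2 := hq2.1

lemma mem_flatSet_one_of_le (hh : LipschitzWith K h)
    (hfst : δ ≤ p.1.val ∧ p.1.val + δ < n) (hsnd : δ ≤ p.2.val ∧ p.2.val + δ < n)
    (hp : p.2.val + (K + 1) * (δ + 1) ≤ n * h (p.1.val / n)) :
    p ∈ flatSet (boxOffsets n δ) (pixelAverages n (horizonImage h)) 1 := by
  have hn : (0 : ℝ) < n := Nat.cast_pos.2 (NeZero.pos n)
  refine mem_flatSet_of_forall_mem hfst hsnd fun q hq1 hq2 => Set.indicator_of_mem ?_ _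
  have hdist : h (p.1.val / n) - h q.1 ≤ K * ((δ + 1) / n) :=
    (le_abs_self _).trans ((hh.dist_le_mul _ _).trans
      (by rw [dist_comm]; gcongr; exact hq1))
  rw [Set.mem_ofPred_eq]
  calc q.2 < (p.2.val + δ + 1) / n := hq2.2
    _ ≤ h (p.1.val / n) - K * ((δ + 1) / n) := by
        rw [div_le_iff₀ hn]
        field_simp
        linarith
    _ ≤ h q.1 := by linarith

lemma card_filter_val_near_boundary_le (n δ : ℕ) [NeZero n] :
    (Finset.univ.filter fun i : ZMod n => ¬(δ ≤ i.val ∧ i.val + δ < n)).card ≤ 2 * δ := by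
  rw [← Finset.card_image_of_injective _ (ZMod.val_injective n)]
  calc _ ≤ (Finset.range δ ∪ Finset.Ico (n - δ) n).card := by
        refine Finset.card_le_card fun k hk => ?_
        obtain ⟨i, hi, rfl⟩ := Finset.mem_image.1 hk
        have hboundary := (Finset.mem_filter.1 hi).2
        have hlt := ZMod.val_lt i
        simp only [Finset.mem_union, Finset.mem_range, Finset.mem_Ico]
        omega
    _ ≤ 2 * δ := by
        refine (Finset.card_union_le _ _).trans ?_
        rw [Finset.card_range, Nat.card_Ico]
        omega

lemma card_filter_abs_val_sub_lt_le (c : ℝ) {m : ℝ} (hm : 0 ≤ m) :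
    ((Finset.univ.filter fun j : ZMod n => |(j.val : ℝ) - c| < m).card : ℝ) ≤ 2 * m + 1 := by
  have hinj : Function.Injective fun j : ZMod n => (j.val : ℤ) :=
    Nat.cast_injective.comp (ZMod.val_injective n)
  rw [← Finset.card_image_of_injective _ hinj]
  have hsub : (Finset.univ.filter fun j : ZMod n => |(j.val : ℝ) - c| < m).image
      (fun j : ZMod n => (j.val : ℤ)) ⊆ Finset.Ioo ⌊c - m⌋ ⌈c + m⌉ := by
    intro k hk
    obtain ⟨j, hj, rfl⟩ := Finset.mem_image.1 hk
    obtain ⟨hlower, hupper⟩ := abs_lt.1 (Finset.mem_filter.1 hj).2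
    rw [Finset.mem_Ioo, Int.floor_lt, Int.lt_ceil, Int.cast_natCast]
    constructor <;> linarith
  refine (Nat.cast_le.2 (Finset.card_le_card hsub)).trans ?_
  rw [Int.card_Ioo]
  have hfloor := Int.sub_one_lt_floor (c - m)
  have hceil := Int.ceil_lt_add_one (c + m)
  have hcast : (((⌈c + m⌉ - ⌊c - m⌋ - 1).toNat : ℤ) : ℝ) ≤ 2 * m + 1 := by
    rw [Int.ofNat_toNat, Int.cast_max]
    push_cast
    exact max_le (by linarith) (by linarith)
  exact_mod_cast hcast

lemma card_filter_abs_val_sub_apply_lt_le (g : ZMod n → ℝ) {m : ℝ} (hm : 0 ≤ m) :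
    ((Finset.univ.filter fun p : ZMod n × ZMod n => |(p.2.val : ℝ) - g p.1| < m).card : ℝ) ≤
      n * (2 * m + 1) := by
  calc _ = ∑ i : ZMod n,
          ((Finset.univ.filter fun j : ZMod n => |(j.val : ℝ) - g i| < m).card : ℝ) := by
        simp only [Finset.card_filter, Fintype.sum_prod_type, Nat.cast_sum]
    _ ≤ ∑ _i : ZMod n, (2 * m + 1) :=
        Finset.sum_le_sum fun i _ => card_filter_abs_val_sub_lt_le (g i) hm
    _ = _ := by rw [Finset.sum_const, Finset.card_univ, ZMod.card, nsmul_eq_mul]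

lemma compl_flatSet_subset (hh : LipschitzWith K h) (δ : ℕ) :
    (flatSet (boxOffsets n δ) (pixelAverages n (horizonImage h)) 1 ∪
      flatSet (boxOffsets n δ) (pixelAverages n (horizonImage h)) 0)ᶜ ⊆
    ((Finset.univ.filter fun i : ZMod n => ¬(δ ≤ i.val ∧ i.val + δ < n)) ×ˢ Finset.univ ∪
      Finset.univ ×ˢ Finset.univ.filter fun i : ZMod n => ¬(δ ≤ i.val ∧ i.val + δ < n)) ∪
    Finset.univ.filter fun p : ZMod n × ZMod n =>
      |(p.2.val : ℝ) - n * h (p.1.val / n)| < (K + 1) * (δ + 1) := by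
  intro p hp
  by_contra hcon
  simp only [Finset.mem_union, Finset.mem_product, Finset.mem_univ, Finset.mem_filter, true_and,
    and_true, not_or, not_not, not_lt] at hcon
  obtain ⟨⟨hfst, hsnd⟩, hedge⟩ := hcon
  rw [Finset.mem_compl, Finset.mem_union, not_or] at hp
  rcases le_abs.1 hedge with habove | hbelow
  · exact hp.2 (mem_flatSet_zero_of_le hh hfst hsnd (by linarith))
  · exact hp.1 (mem_flatSet_one_of_le hh hfst hsnd (by linarith))

lemma card_compl_flatSet_le (hh : LipschitzWith K h) (δ : ℕ) :
    ((flatSet (boxOffsets n δ) (pixelAverages n (horizonImage h)) 1 ∪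
      flatSet (boxOffsets n δ) (pixelAverages n (horizonImage h)) 0)ᶜ.card : ℝ) ≤
      n * (4 * δ + 2 * ((K + 1) * (δ + 1)) + 1) := by
  have hboundary : ((Finset.univ.filter fun i : ZMod n =>
      ¬(δ ≤ i.val ∧ i.val + δ < n)).card : ℝ) ≤ 2 * δ := by
    exact_mod_cast card_filter_val_near_boundary_le n δ
  have hedge := card_filter_abs_val_sub_apply_lt_le (fun i : ZMod n => n * h (i.val / n))
    (m := (K + 1) * (δ + 1)) (by positivity)
  have hcard := (Finset.card_le_card (compl_flatSet_subset (n := n) hh δ)).trans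
    ((Finset.card_union_le _ _).trans (Nat.add_le_add_right (Finset.card_union_le _ _) _))
  rw [Finset.card_product, Finset.card_product, Finset.card_univ, ZMod.card] at hcard
  refine (Nat.cast_le.2 hcard).trans ?_
  push_cast
  nlinarith [hboundary, hedge, (Nat.cast_nonneg n : (0 : ℝ) ≤ n)]

end Horizon

section Growth

open Filter Real

lemma eventually_mul_rpow_le_mul_rpow {r s c : ℝ} (A : ℝ) (hrs : r < s) (hc : 0 < c) :
    ∀ᶠ L : ℝ in atTop, A * L ^ r ≤ c * L ^ s := by
  filter_upwards [(tendsto_rpow_atTop (sub_pos.2 hrs)).eventually_ge_atTop (A / c),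
    eventually_gt_atTop 0] with L hA hL
  rw [div_le_iff₀' hc] at hA
  calc A * L ^ r ≤ c * L ^ (s - r) * L ^ r := by gcongr
    _ = c * L ^ s := by rw [mul_assoc, ← rpow_add hL, sub_add_cancel]

lemma eventually_mul_rpow_mul_exp_neg_le {κ c : ℝ} (A s : ℝ) (hκ : 0 < κ) (hc : 0 < c) :
    ∀ᶠ L : ℝ in atTop, A * L ^ s * exp (-(c * L ^ κ)) ≤ 1 := by
  have hlim := ((tendsto_rpow_mul_exp_neg_mul_atTop_nhds_zero (s / κ) c hc).comp
    (tendsto_rpow_atTop hκ)).const_mul A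
  rw [mul_zero] at hlim
  filter_upwards [hlim.eventually_le_const one_pos, eventually_gt_atTop 0] with L hle hL
  simp only [Function.comp_apply] at hle
  rwa [← rpow_mul hL.le, mul_div_cancel₀ _ hκ.ne', ← mul_assoc, neg_mul] at hle

lemma eventually_mul_rpow_le_exp (A s : ℝ) : ∀ᶠ L : ℝ in atTop, A * L ^ s ≤ exp L := by
  filter_upwards [eventually_mul_rpow_mul_exp_neg_le A s one_pos one_pos] with L hle
  rwa [rpow_one, one_mul, exp_neg, ← div_eq_mul_inv, div_le_one (exp_pos L)] at hle

lemma eventually_mul_rpow_mul_exp_sub_le {s c A : ℝ} (a r : ℝ) (hA : 0 ≤ A) (hs : 1 < s)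
    (hc : 0 < c) :
    ∀ᶠ L : ℝ in atTop, A * L ^ r * exp (a * L - c * L ^ s) ≤ 1 := by
  filter_upwards [eventually_mul_rpow_le_mul_rpow (a + 1) hs hc,
    eventually_mul_rpow_mul_exp_neg_le A r one_pos one_pos, eventually_gt_atTop 0]
    with L hlinear hexp hL
  rw [rpow_one] at hlinear hexp
  refine le_trans ?_ hexp
  gcongr
  linarith

lemma eventually_mul_log_add_one_le {κ s η c A B : ℝ} (hA : 0 ≤ A) (hB : 1 ≤ B)
    (hs : 0 ≤ s) (hκ : 0 ≤ κ) (hη : κ < η) (hc : 0 < c) :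
    ∀ᶠ L : ℝ in atTop, L ^ κ * A * log (B * L ^ s) + 1 ≤ c * L ^ η := by
  obtain ⟨θ, hθ, hκθ⟩ : ∃ θ > 0, κ + θ < η := ⟨(η - κ) / 2, by linarith, by linarith⟩
  filter_upwards [eventually_mul_rpow_le_mul_rpow (A * (log B + s / θ) + 1) hκθ hc,
    eventually_ge_atTop 1] with L hdom hL
  have hL0 : 0 < L := zero_lt_one.trans_le hL
  have hθ1 : 1 ≤ L ^ θ := one_le_rpow hL hθ.le
  have hκ1 : 1 ≤ L ^ κ := one_le_rpow hL hκ
  have hlog : log (B * L ^ s) ≤ (log B + s / θ) * L ^ θ := by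
    rw [log_mul (by positivity) (by positivity), log_rpow hL0, add_mul, div_mul_eq_mul_div,
      mul_div_assoc]
    gcongr
    · exact le_mul_of_one_le_right (log_nonneg hB) hθ1
    · exact log_le_rpow_div hL0.le hθ
  calc _ ≤ L ^ κ * A * ((log B + s / θ) * L ^ θ) + L ^ κ * L ^ θ := by
        gcongr
        exact one_le_mul_of_one_le_of_one_le hκ1 hθ1
    _ = (A * (log B + s / θ) + 1) * L ^ (κ + θ) := by
        rw [rpow_add hL0]
        ring
    _ ≤ _ := hdom

end Growth

section VarianceScales

open Filter Real

variable {σ κ : ℝ}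

lemma eventually_level_bounds (s : ℝ) (hκ : 0 < κ) (hσ : 0 < σ) :
    ∀ᶠ L : ℝ in atTop, 2 * exp (-L ^ κ / (4 * σ ^ 2)) ≤ 1 / 2 ∧
      (∀ N ≤ 25 * L ^ s, 64 * σ ^ 2 * N * exp (-L ^ κ / (8 * σ ^ 2)) ≤ 1) ∧
      L ^ κ * (2 * exp (-((L ^ κ) ^ 2 / 16))) ≤ 1 := by
  filter_upwards [eventually_gt_atTop 0,
    eventually_mul_rpow_mul_exp_neg_le 4 0 hκ (show 0 < 1 / (4 * σ ^ 2) by positivity),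
    eventually_mul_rpow_mul_exp_neg_le (64 * σ ^ 2 * 25) s hκ
      (show 0 < 1 / (8 * σ ^ 2) by positivity),
    eventually_mul_rpow_mul_exp_neg_le 2 κ (mul_pos hκ two_pos)
      (show (0 : ℝ) < 1 / 16 by norm_num)] with L hL hatypical htail hconcentration
  refine ⟨?_, fun N hN => ?_, ?_⟩
  · rw [rpow_zero, mul_one, one_div_mul_eq_div, ← neg_div] at hatypical
    linarith
  · rw [one_div_mul_eq_div, ← neg_div, mul_assoc (64 * σ ^ 2)] at htail
    refine le_trans ?_ htail
    gcongr
  · rw [rpow_mul hL.le, rpow_two, one_div_mul_eq_div] at hconcentration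
    linarith

lemma eventually_sup_bounds (κ : ℝ) (hσ : 0 < σ) :
    ∀ᶠ L : ℝ in atTop,
      exp (2 * L) * (exp (2 * L) * (2 * exp (-√(24 * σ ^ 2 * L) ^ 2 / (4 * σ ^ 2)))) ≤ 1 ∧
      L ^ κ * (exp (2 * L) * (2 * exp (-√(24 * σ ^ 2 * L) ^ 2 / (4 * σ ^ 2)))) ≤ 1 := by
  filter_upwards [eventually_ge_atTop 0,
    eventually_mul_rpow_mul_exp_neg_le 2 0 one_pos (show (0 : ℝ) < 2 by norm_num),
    eventually_mul_rpow_mul_exp_neg_le 2 κ one_pos (show (0 : ℝ) < 4 by norm_num)]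
    with L hL hsup hmul
  have hexponent : -√(24 * σ ^ 2 * L) ^ 2 / (4 * σ ^ 2) = -(2 * L) + (-(2 * L) + -(2 * L)) := by
    rw [sq_sqrt (by positivity)]
    field_simp
    ring
  have hquarter : exp (-(4 * L)) = exp (-(2 * L)) * exp (-(2 * L)) := by
    rw [← exp_add]
    ring_nf
  have hcancel : exp (2 * L) * exp (-(2 * L)) = 1 := by rw [← exp_add, add_neg_cancel, exp_zero]
  rw [rpow_zero, mul_one, rpow_one] at hsup
  rw [rpow_one, hquarter] at hmul
  rw [hexponent, exp_add, exp_add]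
  refine ⟨le_of_eq_of_le ?_ hsup, le_of_eq_of_le ?_ hmul⟩ <;> grind

lemma eventually_slope_bound {s c : ℝ} (κ : ℝ) (hs : 1 < s) (hc : 0 < c) :
    ∀ᶠ L : ℝ in atTop, ∀ N, L ^ s ≤ N →
      L ^ κ * exp 3 * (exp (2 * L) * (14 * exp (-(c * N / 1024)))) ≤ 1 := by
  filter_upwards [eventually_gt_atTop 0, eventually_mul_rpow_mul_exp_sub_le (A := 14 * exp 3) 2 κ
    (by positivity) hs (show 0 < c / 1024 by positivity)] with L hL hle N hN
  calc _ = 14 * exp 3 * L ^ κ * exp (2 * L - c * N / 1024) := by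
        rw [sub_eq_add_neg, exp_add]
        ring
    _ ≤ 14 * exp 3 * L ^ κ * exp (2 * L - c / 1024 * L ^ s) := by
        rw [mul_div_right_comm]
        gcongr
    _ ≤ 1 := hle

/-- The number of dilations of the noise in `VarianceScales`: the largest one for which
`VarianceScales.dilation_le` holds. -/
noncomputable def dilationCount (σ N K M : ℝ) : ℕ :=
  ⌊σ ^ 2 * √N / (64 * √K * (M + 1) * K)⌋₊

lemma dilationCount_mul_le {N K M : ℝ} (hσ : 0 < σ) (hN : 0 < N) (hK : 0 < K) (hM : 0 ≤ M) :
    dilationCount σ N K M * (2 * (4 * (8 * √K * (M + 1))) / (σ ^ 2 * N)) * K * √N ≤ 1 := by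
  calc _ ≤ σ ^ 2 * √N / (64 * √K * (M + 1) * K) *
          (2 * (4 * (8 * √K * (M + 1))) / (σ ^ 2 * N)) * K * √N := by
        gcongr
        exact Nat.floor_le (by positivity)
    _ = √N * √N / N := by
        field_simp
        ring
    _ = 1 := by rw [mul_self_sqrt hN.le, div_self hN.ne']

lemma sqrt_add_one_le_mul_rpow_half {L : ℝ} (hσ : 0 < σ) (hL : 1 ≤ L) :
    √(24 * σ ^ 2 * L) + 1 ≤ (5 * σ + 1) * L ^ (1 / 2 : ℝ) := by
  rw [← sqrt_eq_rpow, add_mul, one_mul]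
  refine add_le_add (sqrt_le_iff.2 ⟨by positivity, ?_⟩) (one_le_sqrt.2 hL)
  rw [mul_pow, sq_sqrt (by positivity)]
  nlinarith [mul_pos (sq_pos_of_pos hσ) (zero_lt_one.trans_le hL)]

lemma rpow_half_add_le_sqrt {ε L N : ℝ} (hL : 0 < L) (hN : L ^ (1 + 2 * ε) ≤ N) :
    L ^ (1 / 2 + ε) ≤ √N := by
  refine le_sqrt_of_sq_le ((le_of_eq ?_).trans hN)
  rw [← rpow_natCast, ← rpow_mul hL.le]
  congr 1
  push_cast
  ring

lemma mul_rpow_le_dilationRatio {ε L N : ℝ} (hσ : 0 < σ) (hL : 1 ≤ L)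
    (hN : L ^ (1 + 2 * ε) ≤ N) :
    σ ^ 2 / (64 * (5 * σ + 1)) * L ^ (13 / 16 * ε) ≤
      σ ^ 2 * √N / (64 * √(L ^ (ε / 8)) * (√(24 * σ ^ 2 * L) + 1) * L ^ (ε / 8)) := by
  have hL0 : 0 < L := zero_lt_one.trans_le hL
  have hsqrt : √(L ^ (ε / 8)) = L ^ (ε / 16) := by
    rw [sqrt_eq_rpow, ← rpow_mul hL0.le]
    ring_nf
  rw [hsqrt, le_div_iff₀ (by positivity)]
  calc _ ≤ σ ^ 2 / (64 * (5 * σ + 1)) * L ^ (13 / 16 * ε) *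
          (64 * L ^ (ε / 16) * ((5 * σ + 1) * L ^ (1 / 2 : ℝ)) * L ^ (ε / 8)) := by
        gcongr
        exact sqrt_add_one_le_mul_rpow_half hσ hL
    _ = σ ^ 2 * (L ^ (13 / 16 * ε) * (L ^ (ε / 16) * L ^ (1 / 2 : ℝ) * L ^ (ε / 8))) := by
        field_simp
    _ = σ ^ 2 * L ^ (1 / 2 + ε) := by
        rw [← rpow_add hL0, ← rpow_add hL0, ← rpow_add hL0]
        ring_nf
    _ ≤ _ := by
        gcongr
        exact rpow_half_add_le_sqrt hL0 hN

lemma eventually_log_le_dilationCount {ε : ℝ} (hε : 0 < ε) (hσ : 0 < σ) :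
    ∀ᶠ L : ℝ in atTop, ∀ N, L ^ (1 + 2 * ε) ≤ N → N ≤ 25 * L ^ (1 + 2 * ε) →
      L ^ (ε / 8) * exp 3 * log (8 * N) ≤
        dilationCount σ N (L ^ (ε / 8)) √(24 * σ ^ 2 * L) := by
  filter_upwards [eventually_ge_atTop 1, eventually_mul_log_add_one_le (κ := ε / 8)
    (s := 1 + 2 * ε) (η := 13 / 16 * ε) (c := σ ^ 2 / (64 * (5 * σ + 1))) (A := exp 3) (B := 200)
    (exp_pos 3).le (by norm_num) (by linarith) (by linarith) (by linarith) (by positivity)]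
    with L hL hlog N hNlower hNupper
  have hN : 0 < N := (rpow_pos_of_pos (zero_lt_one.trans_le hL) _).trans_le hNlower
  have hmono : L ^ (ε / 8) * exp 3 * log (8 * N) ≤
      L ^ (ε / 8) * exp 3 * log (200 * L ^ (1 + 2 * ε)) :=
    mul_le_mul_of_nonneg_left (log_le_log (by positivity) (by linarith)) (by positivity)
  have hfloor := (mul_rpow_le_dilationRatio hσ hL hNlower).trans_lt (Nat.lt_floor_add_one _)
  rw [dilationCount]
  linarith

lemma eventually_exists_varianceScales {ε : ℝ} (hε : 0 < ε) (hσ : 0 < σ) :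
    ∀ᶠ L : ℝ in atTop, ∀ N, L ^ (1 + 2 * ε) ≤ N → N ≤ 25 * L ^ (1 + 2 * ε) →
      ∃ K M J, VarianceScales σ (exp (2 * L)) N K M J := by
  filter_upwards [eventually_ge_atTop 1,
    eventually_level_bounds (1 + 2 * ε) (show 0 < ε / 8 by linarith) hσ,
    eventually_sup_bounds (ε / 8) hσ, eventually_log_le_dilationCount hε hσ,
    eventually_slope_bound (ε / 8) (show 1 < 1 + 2 * ε by linarith)
      (show 0 < min 1 (σ ^ 2) by positivity)]
    with L hL ⟨hatypical, htail, hconcentration⟩ ⟨hsup, hmul⟩ hlog hslope N hNlower hNupper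
  have hK : 1 ≤ L ^ (ε / 8) := one_le_rpow hL (by linarith)
  have hN : 1 ≤ N := (one_le_rpow hL (by linarith)).trans hNlower
  have hlogpos : 0 < log (8 * N) := log_pos (by linarith)
  refine ⟨L ^ (ε / 8), √(24 * σ ^ 2 * L), dilationCount σ N (L ^ (ε / 8)) √(24 * σ ^ 2 * L), ?_⟩
  exact
    { one_le := hK
      nonneg := sqrt_nonneg _
      pos := Nat.cast_pos.1 ((show 0 < L ^ (ε / 8) * exp 3 * log (8 * N) by positivity).trans_le
        (hlog N hNlower hNupper))
      le_sqrt := (rpow_le_rpow_of_exponent_le hL (by linarith)).trans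
        (rpow_half_add_le_sqrt (by positivity) hNlower)
      dilation_le := dilationCount_mul_le hσ (by positivity) (by positivity) (sqrt_nonneg _)
      atypical_le := hatypical
      tail_le := htail N hNupper
      sup_le := hsup
      mul_sup_le := hmul
      concentration_le := hconcentration
      log_le := hlog N hNlower hNupper
      slope_le := hslope N hNlower }

end VarianceScales

section SeparationScales

open Filter Real

variable {ε σ : ℝ}

lemma eventually_concentration_bound {B : ℝ} (hB : 0 ≤ B) (hε : 0 < ε) :
    ∀ᶠ L : ℝ in atTop, ∀ N, L ^ (1 + 2 * ε) ≤ N →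
      exp (2 * L) * ((2 + 2 * (B * L)) * (12 * exp (2 * L) ^ 2 *
        exp (-((1 / (2 * L ^ (ε / 2))) ^ 2 * N / 16)))) ≤ 1 / 2 := by
  filter_upwards [eventually_ge_atTop 1,
    eventually_mul_rpow_mul_exp_sub_le (A := 24 * (2 + 2 * B)) 6 1 (by positivity)
      (show 1 < 1 + ε by linarith) (show (0 : ℝ) < 1 / 64 by norm_num)] with L hL hle N hN
  have hL0 : 0 < L := zero_lt_one.trans_le hL
  have hexponent : 1 / 64 * L ^ (1 + ε) ≤ (1 / (2 * L ^ (ε / 2))) ^ 2 * N / 16 := by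
    have hsplit : L ^ (1 + 2 * ε) = L ^ (1 + ε) * (L ^ (ε / 2)) ^ 2 := by
      rw [← rpow_natCast, ← rpow_mul hL0.le, ← rpow_add hL0]
      congr 1
      push_cast
      ring
    calc _ = (1 / (2 * L ^ (ε / 2))) ^ 2 * L ^ (1 + 2 * ε) / 16 := by
          rw [hsplit]
          field_simp
          ring
      _ ≤ _ := by gcongr
  rw [rpow_one] at hle
  calc _ = 12 * (2 + 2 * B * L) *
          exp (6 * L - (1 / (2 * L ^ (ε / 2))) ^ 2 * N / 16) := by
        rw [show 6 * L = 2 * L + (2 * L + 2 * L) by ring, sub_eq_add_neg, exp_add, exp_add,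
          exp_add]
        ring
    _ ≤ 12 * ((2 + 2 * B) * L) * exp (6 * L - 1 / 64 * L ^ (1 + ε)) := by
        gcongr
        linarith
    _ ≤ 1 / 2 := by linarith

lemma eventually_tail_bound (hσ : 0 < σ) :
    ∀ᶠ L : ℝ in atTop,
      exp (2 * L) * (exp (2 * L) * (32 * σ ^ 2 * exp (-(40 * σ ^ 2 * L) / (8 * σ ^ 2)))) ≤
        1 / 2 := by
  filter_upwards [eventually_mul_rpow_mul_exp_neg_le (64 * σ ^ 2) 0 one_pos one_pos] with L hle
  rw [rpow_zero, mul_one, one_mul, rpow_one] at hle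
  calc _ = 32 * σ ^ 2 * exp (-L) := by
        rw [show -(40 * σ ^ 2 * L) / (8 * σ ^ 2) = -(5 * L) by field_simp; ring,
          show -L = 2 * L + (2 * L + -(5 * L)) by ring, exp_add, exp_add]
        ring
    _ ≤ 1 / 2 := by linarith

lemma eventually_exists_separationScales (hε : 0 < ε) (hσ : 0 < σ) :
    ∀ᶠ L : ℝ in atTop, ∀ N, L ^ (1 + 2 * ε) ≤ N →
      ∃ τ K, SeparationScales σ (exp (2 * L)) N τ K
        (N * (2 * σ ^ 2 + 2 * σ ^ 2 / L ^ (ε / 2))) := by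
  filter_upwards [eventually_ge_atTop 1,
    eventually_mul_rpow_le_mul_rpow (4 * σ ^ 2 + 2 * σ) (half_pos hε) one_pos,
    eventually_concentration_bound (B := 40 * σ ^ 2) (by positivity) hε,
    eventually_tail_bound hσ] with L hL hgap hconcentration htail N hN
  have hN0 : 0 ≤ N := (rpow_nonneg (by linarith) _).trans hN
  have hpow : 1 ≤ L ^ (ε / 2) := one_le_rpow hL (half_pos hε).le
  rw [rpow_zero, mul_one, one_mul] at hgap
  have hthreshold : 4 * (1 / (2 * L ^ (ε / 2))) * σ ^ 2 = 2 * σ ^ 2 / L ^ (ε / 2) := by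
    field_simp
    ring
  refine ⟨1 / (2 * L ^ (ε / 2)), 40 * σ ^ 2 * L, by positivity, ?_, by positivity, ?_, ?_,
    hconcentration N hN, htail⟩
  · rw [div_le_one (by positivity)]
    linarith
  · rw [hthreshold]
  · have hmargin : 8 * (1 / (2 * L ^ (ε / 2))) * σ ^ 2 + 4 * (1 / (2 * L ^ (ε / 2))) * σ ≤ 1 := by
      calc _ = (4 * σ ^ 2 + 2 * σ) / L ^ (ε / 2) := by
            field_simp
            ring
        _ ≤ 1 := (div_le_one (by positivity)).2 hgap
    rw [← hthreshold]
    gcongr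
    linarith

end SeparationScales

section Risk

variable {n : ℕ} {ε σ : ℝ}

lemma patchHalfWidth_le (ε : ℝ) (hn : 1 ≤ Real.log n) :
    (patchHalfWidth ε n : ℝ) ≤ 2 * Real.log n ^ (1 / 2 + ε) :=
  Nat.floor_le (by positivity)

lemma four_mul_patchHalfWidth_lt (hn : 1 ≤ Real.log n)
    (hgrowth : 9 * Real.log n ^ (1 / 2 + ε) ≤ n) : 4 * patchHalfWidth ε n < n := by
  have hradius : 0 < Real.log n ^ (1 / 2 + ε) := by positivity
  have hlt : (4 : ℝ) * patchHalfWidth ε n < n := by linarith [patchHalfWidth_le ε hn]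
  exact_mod_cast hlt

lemma patchHalfWidth_bounds (hε : 0 < ε) (hn : 1 ≤ Real.log n) :
    0 < patchHalfWidth ε n ∧
      Real.log n ^ (1 + 2 * ε) ≤ (2 * (patchHalfWidth ε n : ℝ) + 1) ^ 2 - 1 ∧
      (2 * (patchHalfWidth ε n : ℝ) + 1) ^ 2 - 1 ≤ 25 * Real.log n ^ (1 + 2 * ε) := by
  have hradius : 1 ≤ Real.log n ^ (1 / 2 + ε) := Real.one_le_rpow hn (by linarith)
  have hsq : Real.log n ^ (1 + 2 * ε) = (Real.log n ^ (1 / 2 + ε)) ^ 2 := by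
    rw [← Real.rpow_natCast, ← Real.rpow_mul (by linarith)]
    congr 1
    push_cast
    ring
  have hupper := patchHalfWidth_le ε hn
  have hlower : 2 * Real.log n ^ (1 / 2 + ε) < patchHalfWidth ε n + 1 := Nat.lt_floor_add_one _
  refine ⟨by exact_mod_cast (show (0 : ℝ) < patchHalfWidth ε n by linarith), ?_, ?_⟩ <;>
    rw [hsq] <;> nlinarith

variable [NeZero n]

lemma risk_eq_sum_lintegral {est : PixelArray n → PixelArray n} {f : ℝ × ℝ → ℝ}
    (hest : ∀ p, Measurable fun z => est (pixelAverages n f + z) p) :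
    risk n σ est f = ENNReal.ofReal (1 / (n : ℝ) ^ 2) *
      ∑ p, ∫⁻ z, ENNReal.ofReal ((pixelAverages n f p - est (pixelAverages n f + z) p) ^ 2)
        ∂gaussNoise (ZMod n × ZMod n) σ := by
  have hmeas (p : ZMod n × ZMod n) : Measurable fun z =>
      ENNReal.ofReal ((pixelAverages n f p - est (pixelAverages n f + z) p) ^ 2) :=
    ((measurable_const.sub (hest p)).pow_const 2).ennreal_ofReal
  rw [← lintegral_finsetSum _ fun p _ => hmeas p,
    ← lintegral_const_mul _ (Finset.measurable_sum _ fun p _ => hmeas p)]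
  refine lintegral_congr fun z => ?_
  rw [ENNReal.ofReal_mul (by positivity), ENNReal.ofReal_sum_of_nonneg fun _ _ => sq_nonneg _]

lemma card_pixels_eq_exp : (Fintype.card (ZMod n × ZMod n) : ℝ) = Real.exp (2 * Real.log n) := by
  rw [Fintype.card_prod, ZMod.card, two_mul, Real.exp_add,
    Real.exp_log (Nat.cast_pos.2 (NeZero.pos n)), Nat.cast_mul]

lemma card_compl_flatSet_le_mul_rpow {h : ℝ → ℝ} {K : NNReal} (hh : LipschitzWith K h)
    (hε : 0 < ε) (hn : 1 ≤ Real.log n) :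
    ((flatSet (boxOffsets n (patchHalfWidth ε n)) (pixelAverages n (horizonImage h)) 1 ∪
      flatSet (boxOffsets n (patchHalfWidth ε n)) (pixelAverages n (horizonImage h)) 0)ᶜ.card : ℝ) ≤
      n * ((15 + 6 * K) * Real.log n ^ (1 / 2 + ε)) := by
  have hradius : 1 ≤ Real.log n ^ (1 / 2 + ε) := Real.one_le_rpow hn (by linarith)
  grw [card_compl_flatSet_le hh, patchHalfWidth_le ε hn]
  gcongr
  nlinarith [mul_le_mul_of_nonneg_left hradius K.2]

lemma risk_nlm_horizonImage_le {h : ℝ → ℝ} {K : NNReal} {k m τ κ : ℝ} {J : ℕ}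
    (hh : LipschitzWith K h) (hε : 0 < ε) (hσ : 0 < σ) (hn : 1 ≤ Real.log n)
    (hδ : 4 * patchHalfWidth ε n < n)
    (hvar : VarianceScales σ (Real.exp (2 * Real.log n))
      ((2 * (patchHalfWidth ε n : ℝ) + 1) ^ 2 - 1) k m J)
    (hsep : SeparationScales σ (Real.exp (2 * Real.log n))
      ((2 * (patchHalfWidth ε n : ℝ) + 1) ^ 2 - 1) τ κ
      (((2 * (patchHalfWidth ε n : ℝ) + 1) ^ 2 - 1) * (2 * σ ^ 2 + thresholdParam ε σ n))) :
    risk n σ (nlm n σ (patchHalfWidth ε n) (thresholdParam ε σ n)) (horizonImage h) ≤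
      ENNReal.ofReal ((15 + 6 * K) * (270 * σ ^ 2 + 46) * (Real.log n ^ (1 / 2 + ε) / n)) := by
  have hn0 : (1 : ℝ) ≤ n := Nat.one_le_cast.2 NeZero.one_le
  have hδ2 : 2 * patchHalfWidth ε n < n := by omega
  have hx := pixelAverages_horizonImage_mem_Icc (n := n) hh.continuous
  have hO := shiftBicolorable_boxOffsets hδ
  rw [← card_pixels_eq_exp, ← cast_card_boxOffsets hδ2] at hvar hsep
  have hv := hsep.threshold_nonneg (Nat.cast_nonneg _)
  have hradius : 1 ≤ Real.log n ^ (1 / 2 + ε) := Real.one_le_rpow hn (by linarith)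
  have hconst : (1 : ℝ) ≤ 15 + 6 * K := by linarith [K.coe_nonneg]
  rw [risk_eq_sum_lintegral fun p => by
    simpa only [nlm_eq_patchMean (patchHalfWidth_bounds hε hn).1 hδ2] using
      measurable_patchMean _ _ _ p]
  simp only [nlm_eq_patchMean (patchHalfWidth_bounds hε hn).1 hδ2]
  grw [sum_lintegral_sq_sub_patchMean_le hσ hO hx hsep (card_compl_flatSet_le_mul_rpow hh hε hn)
    (one_le_mul_of_one_le_of_one_le hn0 (one_le_mul_of_one_le_of_one_le hconst hradius))
    (by positivity)
    fun p => lintegral_sq_sub_patchMean_le hx hv p (by positivity)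
      (sum_lintegral_sq_selWeight_patchEnergy_le hσ hO (zero_notMem_boxOffsets hδ2) hx hv hvar p)]
  rw [← ENNReal.ofReal_mul (by positivity)]
  refine ENNReal.ofReal_le_ofReal (le_of_eq ?_)
  field_simp
  ring

end Risk

lemma horizonClass_subset (α C : ℝ) :
    horizonClass α C ⊆ {f | ∃ h, LipschitzWith 1 h ∧ f = horizonImage h} :=
  fun _ ⟨h, _, hlip, hf⟩ => ⟨h, hlip.lipschitzWith_one, hf⟩

theorem theorem4_general (ε σ : ℝ) (K : NNReal) (hε : 0 < ε) (hσ : 0 < σ) :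
    ∃ (c : ℝ) (n₀ : ℕ), ∀ (n : ℕ) [NeZero n], n₀ < n →
      worstCaseRisk n σ (nlm n σ (patchHalfWidth ε n) (thresholdParam ε σ n))
        {f | ∃ h, LipschitzWith K h ∧ f = horizonImage h}
        ≤ ENNReal.ofReal (c * (Real.log n ^ (1 / 2 + ε) / n)) := by
  obtain ⟨n₀, hn₀⟩ := Filter.eventually_atTop.1
    ((Real.tendsto_log_atTop.comp tendsto_natCast_atTop_atTop).eventually
      ((Filter.eventually_ge_atTop (1 : ℝ)).and
        ((eventually_mul_rpow_le_exp 9 (1 / 2 + ε)).and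
          ((eventually_exists_varianceScales hε hσ).and
            (eventually_exists_separationScales hε hσ)))))
  refine ⟨(15 + 6 * K) * (270 * σ ^ 2 + 46), n₀, fun n _ hn => iSup₂_le ?_⟩
  rintro _ ⟨h, hh, rfl⟩
  obtain ⟨hlog, hgrowth, hvariance, hseparation⟩ := hn₀ n hn.le
  obtain ⟨-, hlower, hupper⟩ := patchHalfWidth_bounds hε hlog
  obtain ⟨_, _, _, hvar⟩ := hvariance _ hlower hupper
  obtain ⟨_, _, hsep⟩ := hseparation _ hlower
  rw [Function.comp_apply, Real.exp_log (Nat.cast_pos.2 (NeZero.pos n))] at hgrowth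
  exact risk_nlm_horizonImage_le hh hε hσ hlog (four_mul_patchHalfWidth_lt hlog hgrowth) hvar hsep

theorem theorem4 (ε σ α C : ℝ) (hε : 0 < ε) (hσ : 0 < σ) (hα : 0 < α) (hC : 0 < C) :
    ∃ (c : ℝ) (n₀ : ℕ), ∀ (n : ℕ) [NeZero n], n₀ < n →
      worstCaseRisk n σ (nlm n σ (patchHalfWidth ε n) (thresholdParam ε σ n)) (horizonClass α C)
        ≤ ENNReal.ofReal (c * (Real.log n ^ (1 / 2 + ε) / n)) := by
  obtain ⟨c, n₀, hc⟩ := theorem4_general ε σ 1 hε hσ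
  exact ⟨c, n₀, fun n _ hn => (biSup_mono (horizonClass_subset α C)).trans (hc n hn)⟩
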